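/- **Conventions.** Fix $m\ge 0$. For a field $F$, let $R_m$ be the ring of formal power series of bounded degree over $F$ in $x_1,x_2,\dots$ that are symmetric in $x_{m+1},x_{m+2},\dots$. An $m$-partition is a pair $\Lambda=(\pmb a;\lambda)$ with $\pmb a\in\mathbb Z_{\ge0}^m$ and $\lambda$ a partition; it is dominant if $a_1\ge\dots\ge a_m$. Throughout, $\Omega=(\pmb b;\mu)$. Let $\pmb a\cup\lambda$ be the partition obtained by sorting the entries of $\pmb a$ and $\lambda$, let $\Lambda^{(i)}=(a_1+1,\dots,a_i+1,a_{i+1},\dots,a_m)\cup\lambda$, and let $\Omega\le\Lambda$ mean that $\Omega^{(i)}\le\Lambda^{(i)}$ in the dominance order on partitions for all $0\le i\le m$. Write $s_i\pmb a$ for $\pmb a$ with $a_i,a_{i+1}$ exchanged, and $s_i\Lambda=(s_i\pmb a;\lambda)$. For $t\in F^\times$ and $1\le i<m$ let $T_i=t+\frac{tx_i-x_{i+1}}{x_i-x_{i+1}}(K_{i,i+1}-1)$, where $K_{i,i+1}$ exchanges $x_i$ and $x_{i+1}$. The non-symmetric Hall–Littlewood polynomials are given by $H_{\pmb a}=x^{\pmb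 a}$ if $\pmb a$ is dominant and $H_{\pmb a}=T_iH_{s_i\pmb a}$ if $a_i<a_{i+1}$. Put $k_\Lambda(x;t)=H_{\pmb a}(x_1,\dots,x_m;t)\,s_\lambda(x)$, with $s_\lambda$ the Schur function in all the variables $x_1,x_2,\dots$, and $k_\Lambda(x)=x^{\pmb a}s_\lambda(x)$. The $k_\Lambda(x;t)$ form a basis of $R_m$, and $\langle\cdot,\cdot\rangle_m$ is the bilinear form on $R_m$ for which this basis is self-dual; $T_i^*$ is the adjoint of $T_i$. Words and tableaux. The operator $\sigma_i$ acts on a word by repeatedly pairing, in the subword of letters $i,i+1$, adjacent factors $(i+1)\,i$, and replacing the remaining unpaired subword $i^r(i+1)^s$ by $i^s(i+1)^r$. The charge of a word whose evaluation $(v_1,v_2,\dots)$ satisfies $v_1\ge v_2\ge\cdots$ is the sum of the labels obtained as follows: reading cyclically from right to left, label the first $1$, then the next $2$, then the next $3$, and so on, with the label starting at $0$ and growing by one each time the end of the word is passed; then repeat on the unlabelled letters, starting again with label $0$. The charge of any other word is the charge of the word with weakly decreasing evaluation obtained from it by the $\sigma_i$'s. For $\Lambda$ dominant, let $\mathcal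 S_{\Lambda\Omega}$ be the set of skew tableaux $T$ of shape $(\pmb a\cup\lambda)/\mu$ (English notation, rows weakly and columns strictly increasing) in the letters $1,\dots,m$ in which $i$ appears $b_i$ times and always within the first $a_i$ columns. For $T\in\mathcal S_{\Lambda\Omega}$ let $\bar T$ be the skew tableau of shape $\mu/\lambda$ in the letters $\bar1>\bar2>\dots>\bar m$ whose column $c$ contains $\bar i$ if and only if $c\le a_i$ and $i$ is not in column $c$ of $T$. Let $\mathrm{charge}_{\pmb a,\pmb b}(T)=\#\{i<j: b_i<b_j\}+\mathrm{charge}(w)$, where $w$ is the word obtained by replacing $\bar i$ by $m+1-i$ in the reading word of $\bar T$ (rows from bottom to top, each from left to right) followed by $\bar1^{\,a_1-a_1}\,\bar2^{\,a_1-a_2}\cdots\bar m^{\,a_1-a_m}$. The dual $m$-symmetric Schur functions $s^*_\Lambda(x;t)=\sum_\Omega D_{\Lambda\Omega}(t)\,k_\Omega(x;t)$ are defined by $D_{\Lambda\Omega}(t)=\sum_{T\in\mathcal S_{\Lambda\Omega}}t^{\mathrm{charge}_{\pmb a,\pmb b}(T)}$ if $\Lambda$ is dominant, and recursively by $s^*_\Lambda=t^{-1}T_i^*s^*_{s_i\Lambda}$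 if $a_i<a_{i+1}$. In both recursions the smallest admissible $i$ is taken. **Proposition.** The $D_{\Lambda\Omega}(t)$ are Laurent polynomials in $t$ with integer coefficients, independent of $F$. At $t=1$, over every field $F$, the dual $m$-symmetric Schur functions are unitriangularly related to the $k_\Omega(x)$: $D_{\Lambda\Lambda}(1)=1$, and $D_{\Lambda\Omega}(1)=0$ unless $\Omega\le\Lambda$, so that $$s^*_\Lambda(x;1)=k_\Lambda(x)+\sum_{\Omega\le\Lambda,\ \Omega\ne\Lambda}D_{\Lambda\Omega}(1)\,k_\Omega(x),$$ where only finitely many $D_{\Lambda\Omega}(1)$ are nonzero for each $\Lambda$. Hence $\{s^*_\Lambda(x;1)\}_\Lambda$ is a basis of $R_m$. Consequently, for generic $t$, that is, whenever $F$ has characteristic $0$ and $t\in F$ is transcendental over $\mathbb Q$ (for instance $F=\mathbb Q(q,t)$ with $t$ the indeterminate), $\{s^*_\Lambda(x;t)\}_\Lambda$ is a basis of $R_m$. There is then exactly one family $\{s_\Lambda(x;t)\}_\Lambda$ in $R_m$ with $\langle s_\Lambda(x;t),s^*_\Omega(x;t)\rangle_m=\delta_{\Lambda\Omega}$ for all $\Lambda,\Omega$,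 and it is a basis of $R_m$: the $m$-symmetric Schur functions are well defined as the dual basis. -/

import Mathlib

/-! ### `m`-partitions, diagrams, dominance

Indices start at `0`: the `m` non-symmetric variables are `x 0, …, x (m - 1)`, the non-symmetric
entries of an `m`-partition are `a 0, …, a (m - 1)`, and rows and columns are numbered from `0`.
A partition is represented by its Young diagram (English notation, Mathlib's `YoungDiagram`). -/

universe u

namespace MSym

section Combinatorics

/-- An `m`-partition `(a; lam)`: a weak composition with `m` parts and a partition. -/
@[ext]
structure MPartition (m : ℕ) where
  comp : Fin m → ℕ
  part : YoungDiagram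

variable {m : ℕ}

/-- `a ∪ lam`: the partition obtained by sorting the concatenation of `a` and `lam`. -/
def unionDiagram (a : Fin m → ℕ) (lam : YoungDiagram) : YoungDiagram :=
  YoungDiagram.ofRowLens
    ((Finset.univ.val.map a + (lam.rowLens : Multiset ℕ)).sort (fun x y => x ≥ y))
    (Multiset.pairwise_sort _ _).sortedGE

/-- `Λ^(i) = (a + 1^i) ∪ lam`, the first `i` entries of `a` being increased by one. -/
def MPartition.level (L : MPartition m) (i : ℕ) : YoungDiagram :=
  unionDiagram (fun j => if (j : ℕ) < i then L.comp j + 1 else L.comp j) L.part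

/-- The dominance order on partitions: `Dominates lam mu` means `lam ≥ mu`. -/
def Dominates (lam mu : YoungDiagram) : Prop :=
  mu.card = lam.card ∧
    ∀ i : ℕ, ∑ j ∈ Finset.range i, mu.rowLen j ≤ ∑ j ∈ Finset.range i, lam.rowLen j

/-- The dominance order on `m`-partitions. -/
instance : LE (MPartition m) where
  le O L := ∀ i ≤ m, Dominates (L.level i) (O.level i)

/-- `a` has an ascent at `i`: `a_i < a_{i+1}`. -/
def IsAscent (a : Fin m → ℕ) (i : ℕ) : Prop :=
  ∃ h : i + 1 < m, a ⟨i, Nat.lt_of_succ_lt h⟩ < a ⟨i + 1, h⟩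

/-- The composition `s_i a`. -/
def swapComp (i : ℕ) (h : i + 1 < m) (a : Fin m → ℕ) : Fin m → ℕ :=
  fun j => a (Equiv.swap ⟨i, Nat.lt_of_succ_lt h⟩ ⟨i + 1, h⟩ j)

theorem swapComp_weight_lt (a : Fin m → ℕ) (i : ℕ) (h : i + 1 < m)
    (ha : a ⟨i, Nat.lt_of_succ_lt h⟩ < a ⟨i + 1, h⟩) :
    ∑ j : Fin m, (j : ℕ) * swapComp i h a j < ∑ j : Fin m, (j : ℕ) * a j := by
  set p : Fin m := ⟨i, Nat.lt_of_succ_lt h⟩ with hp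
  set q : Fin m := ⟨i + 1, h⟩ with hq
  have hpq : q ≠ p := by simp [hp, hq]
  have hq' : q ∈ Finset.univ.erase p := by simp [hpq]
  rw [← Finset.add_sum_erase _ _ (Finset.mem_univ p),
    ← Finset.add_sum_erase _ (fun j : Fin m => (j : ℕ) * a j) (Finset.mem_univ p),
    ← Finset.add_sum_erase _ _ hq',
    ← Finset.add_sum_erase _ (fun j : Fin m => (j : ℕ) * a j) hq']
  have hrest : ∑ j ∈ (Finset.univ.erase p).erase q, (j : ℕ) * swapComp i h a j
      = ∑ j ∈ (Finset.univ.erase p).erase q, (j : ℕ) * a j := by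
    refine Finset.sum_congr rfl fun j hj => ?_
    simp only [Finset.mem_erase, Finset.mem_univ, and_true] at hj
    simp only [swapComp]
    rw [Equiv.swap_apply_of_ne_of_ne hj.2 hj.1]
  rw [hrest]
  have h1 : swapComp i h a p = a q := by simp [swapComp, hp, hq]
  have h2 : swapComp i h a q = a p := by simp [swapComp, hp, hq]
  have h3 : (p : ℕ) = i := rfl
  have h4 : (q : ℕ) = i + 1 := rfl
  rw [h1, h2, h3, h4]
  nlinarith

/-! ### Charge of words -/

/-- Scan a word from left to right, pairing each letter `c` with the nearest unpaired letter `o`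
on its left; the result marks the unpaired letters `c`. The number `d` counts the letters `o` that
are still unpaired. -/
def markUnpaired (o c : ℕ) : ℕ → List ℕ → List Bool
  | _, [] => []
  | d, x :: w =>
    if x = o then false :: markUnpaired o c (d + 1) w
    else if x = c then
      (if d = 0 then true :: markUnpaired o c 0 w else false :: markUnpaired o c (d - 1) w)
    else false :: markUnpaired o c d w

/-- Replace the marked letters of a word, from left to right, by `s` letters `i` followed by
letters `i + 1`. -/
def refill (i : ℕ) : ℕ → List (ℕ × Bool) → List ℕ
  | _, [] => []
  | s, (x, false) :: w => x :: refill i s w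
  | 0, (_, true) :: w => (i + 1) :: refill i 0 w
  | s + 1, (_, true) :: w => i :: refill i s w

/-- The operator `σ_i` on words: after pairing all factors `(i+1) i`, the subword `i^r (i+1)^s` of
unpaired letters is replaced by `i^s (i+1)^r`. -/
def sigma (i : ℕ) (w : List ℕ) : List ℕ :=
  let lower := markUnpaired (i + 1) i 0 w
  let upper := (markUnpaired i (i + 1) 0 w.reverse).reverse
  refill i (upper.count true) (w.zip (List.zipWith or lower upper))

/-- Make the evaluation of a word in the letters `1, …, n` dominant with the operators `σ_i`
(`n` passes of bubble sort on the evaluation). -/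
def toDominantWord (n : ℕ) (w : List ℕ) : List ℕ :=
  (List.replicate n (List.range' 1 (n - 1))).flatten.foldl
    (fun v i => if v.count i < v.count (i + 1) then sigma i v else v) w

/-- Label one letter `k`, one letter `k + 1`, … of a word which is written here in the direction of
reading. `after` and `before` are the unlabelled letters after and before the current position and
`l` is the current label, which grows by one when the end of the word is passed. The result is the
sum of the labels and the word of the letters that remain unlabelled. -/
def chargePass : ℕ → ℕ → ℕ → List ℕ → List ℕ → ℕ × List ℕ
  | 0, _, _, before, after => (0, before ++ after)
  | fuel + 1, k, l, before, after =>
    if k ∈ after then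
      let r := chargePass fuel (k + 1) l (before ++ after.take (after.idxOf k))
        (after.drop (after.idxOf k + 1))
      (l + r.1, r.2)
    else if k ∈ before then
      let r := chargePass fuel (k + 1) (l + 1) (before.take (before.idxOf k))
        (before.drop (before.idxOf k + 1) ++ after)
      (l + 1 + r.1, r.2)
    else (0, before ++ after)

/-- Repeat the labelling on the unlabelled letters until all letters have been labelled. -/
def chargeLoop : ℕ → List ℕ → ℕ
  | 0, _ => 0
  | fuel + 1, v =>
    let r := chargePass v.length 1 0 [] v
    r.1 + chargeLoop fuel r.2

/-- The charge of a word of dominant evaluation; words are read from right to left. -/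
def chargeDominant (w : List ℕ) : ℕ := chargeLoop w.length w.reverse

/-- The charge of a word in the letters `1, …, n`. -/
def charge (n : ℕ) (w : List ℕ) : ℕ := chargeDominant (toDominantWord n w)

/-! ### The skew tableaux and their charge -/

/-- Fillings with the letters `1, …, m` (written `0, …, m - 1`) of the cells of `(a ∪ lam) / mu`,
where `L = (a; lam)` and `O = (b; mu)`. -/
abbrev Filling (L O : MPartition m) : Type :=
  ↥((unionDiagram L.comp L.part).cells \ O.part.cells) → Fin m

/-- The set `S_{L O}` of skew tableaux of shape `(a ∪ lam) / mu` in which the letter `i` appears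
`b_i` times and always within the first `a_i` columns. -/
def skewTableaux (L O : MPartition m) : Finset (Filling L O) :=
  {T | O.part.cells ⊆ (unionDiagram L.comp L.part).cells ∧
    (∀ x y, x.1.1 = y.1.1 → x.1.2 < y.1.2 → T x ≤ T y) ∧
    (∀ x y, x.1.2 = y.1.2 → x.1.1 < y.1.1 → T x < T y) ∧
    (∀ i, (Finset.univ.filter fun x => T x = i).card = O.comp i) ∧
    (∀ x, x.1.2 < L.comp (T x))}

/-- Column `c` of the complementary tableau `T̄` of shape `mu / lam`, from top to bottom: `ī` occurs
in it iff `c` is one of the first `a_i` columns and `i` is not in column `c` of `T`. Barred letters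
are ordered by `1̄ > 2̄ > ⋯ > m̄`; the `i`-th of them (counted from `1`) is written as the number
`m + 1 - i`, which is an order isomorphism. -/
def barColumn (L O : MPartition m) (T : Filling L O) (c : ℕ) : List ℕ :=
  ((Finset.univ.filter fun i : Fin m => c < L.comp i ∧ ∀ x, x.1.2 = c → T x ≠ i).image
    fun i : Fin m => m - (i : ℕ)).sort

/-- The word of `T̄`: the rows are read from bottom to top, each of them from left to right. -/
def barWord (L O : MPartition m) (T : Filling L O) : List ℕ :=
  (List.range (O.part.colLen 0)).reverse.flatMap fun r =>
    (List.range' (L.part.rowLen r) (O.part.rowLen r - L.part.rowLen r)).map fun c =>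
      (barColumn L O T c).getD (r - L.part.colLen c) 0

/-- The word `u_a = 1̄^{a_1 - a_1} 2̄^{a_1 - a_2} ⋯ m̄^{a_1 - a_m}` for dominant `a`
(so that `a_1` is the maximum of `a`). -/
def uWord (a : Fin m → ℕ) : List ℕ :=
  (List.ofFn fun i : Fin m => List.replicate (Finset.univ.sup a - a i) (m - (i : ℕ))).flatten

/-- The number of inversions `#{i < j | b_i < b_j}`. -/
def inv (b : Fin m → ℕ) : ℕ :=
  (Finset.univ.filter fun p : Fin m × Fin m => p.1 < p.2 ∧ b p.1 < b p.2).card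

/-- `charge_{a,b}(T) = Inv(b) + charge(T̄ u_a)`. -/
def tableauCharge (L O : MPartition m) (T : Filling L O) : ℕ :=
  inv O.comp + charge m (barWord L O T ++ uWord L.comp)

/-- `∑_T t^{charge_{a,b}(T)}` over the skew tableaux `T ∈ S_{L O}` (used for dominant `L`). -/
def dominantCoeff {F : Type*} [CommSemiring F] (t : F) (L O : MPartition m) : F :=
  ∑ T ∈ skewTableaux L O, t ^ tableauCharge L O T

end Combinatorics

/-! ### The ring `R_m` of `m`-symmetric functions -/

noncomputable section

variable (F : Type u) [Field F] (m : ℕ)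

theorem coeff_renameEquiv (s : Equiv.Perm ℕ) (f : MvPowerSeries ℕ F) (n : ℕ →₀ ℕ) :
    MvPowerSeries.coeff (n.embDomain s.toEmbedding) (MvPowerSeries.renameEquiv F s f)
      = MvPowerSeries.coeff n f :=
  MvPowerSeries.coeff_embDomain_rename s.toEmbedding f n

/-- `R_m`: the formal power series of bounded degree in `x_0, x_1, x_2, …` that are symmetric in
the variables `x_m, x_{m+1}, …`. -/
def R : Subalgebra F (MvPowerSeries ℕ F) where
  carrier := {f | (∃ d : ℕ, ∀ n, MvPowerSeries.coeff n f ≠ 0 → n.degree ≤ d) ∧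
    ∀ s : Equiv.Perm ℕ, (∀ i < m, s i = i) → MvPowerSeries.renameEquiv F s f = f}
  mul_mem' := by
    classical
    rintro f g ⟨⟨d, hd⟩, hf⟩ ⟨⟨e, he⟩, hg⟩
    refine ⟨⟨d + e, fun n hn => ?_⟩, fun s hs => by rw [map_mul, hf s hs, hg s hs]⟩
    rw [MvPowerSeries.coeff_mul] at hn
    obtain ⟨p, hp, hne⟩ := Finset.exists_ne_zero_of_sum_ne_zero hn
    have h1 := hd _ (left_ne_zero_of_mul hne)
    have h2 := he _ (right_ne_zero_of_mul hne)
    have h3 : n.degree = p.1.degree + p.2.degree := by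
      rw [← map_add, Finset.HasAntidiagonal.mem_antidiagonal.mp hp]
    omega
  add_mem' := by
    rintro f g ⟨⟨d, hd⟩, hf⟩ ⟨⟨e, he⟩, hg⟩
    refine ⟨⟨d + e, fun n hn => ?_⟩, fun s hs => by rw [map_add, hf s hs, hg s hs]⟩
    by_cases h1 : MvPowerSeries.coeff n f = 0
    · have h2 : MvPowerSeries.coeff n g ≠ 0 := by
        intro h2
        exact hn (by rw [map_add, h1, h2, add_zero])
      have := he n h2
      omega
    · have := hd n h1
      omega
  algebraMap_mem' r := by
    classical
    refine ⟨⟨0, fun n hn => ?_⟩, fun s _ => AlgEquiv.commutes _ r⟩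
    rw [MvPowerSeries.algebraMap_apply, MvPowerSeries.coeff_C] at hn
    by_cases h : n = 0
    · simp [h]
    · simp [h] at hn

variable {m}

/-- The variable `x_i` with `i < m`, as an element of `R_m`. -/
def xVar (i : Fin m) : R F m :=
  ⟨MvPowerSeries.X (i : ℕ), by
    classical
    refine ⟨⟨1, fun n hn => ?_⟩, fun s hs => ?_⟩
    · rw [MvPowerSeries.coeff_X] at hn
      by_cases h : n = Finsupp.single (i : ℕ) 1
      · simp [h]
      · simp [h] at hn
    · exact (MvPowerSeries.rename_X s (i : ℕ)).trans (by rw [hs i i.2])⟩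

variable (m)

/-- The formal power series which is the sum of all monomials of degree `r`. -/
def hSeries (r : ℕ) : MvPowerSeries ℕ F := fun n => if n.degree = r then 1 else 0

theorem coeff_hSeries (r : ℕ) (n : ℕ →₀ ℕ) :
    MvPowerSeries.coeff n (hSeries F r) = if n.degree = r then 1 else 0 := rfl

/-- The complete homogeneous symmetric function `h_r(x_0, x_1, …)`. -/
def hFun (r : ℕ) : R F m :=
  ⟨hSeries F r, by
    refine ⟨⟨r, fun n hn => ?_⟩, fun s _ => ?_⟩
    · rw [coeff_hSeries] at hn
      by_cases h : n.degree = r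
      · exact h.le
      · simp [h] at hn
    · ext n
      obtain ⟨k, rfl⟩ : ∃ k : ℕ →₀ ℕ, k.embDomain s.toEmbedding = n := by
        refine ⟨n.embDomain s.symm.toEmbedding, ?_⟩
        rw [Finsupp.embDomain_eq_mapDomain, Finsupp.embDomain_eq_mapDomain,
          ← Finsupp.mapDomain_comp]
        have : (s.toEmbedding : ℕ → ℕ) ∘ (s.symm.toEmbedding : ℕ → ℕ) = id := by
          funext x; simp
        rw [this, Finsupp.mapDomain_id]
      rw [coeff_renameEquiv, coeff_hSeries, coeff_hSeries, Finsupp.embDomain_eq_mapDomain,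
        Finsupp.degree_mapDomain]⟩

/-- `h_r` for an integer `r`, with `h_r = 0` for `r < 0`. -/
def hInt (r : ℤ) : R F m := if 0 ≤ r then hFun F m r.toNat else 0

/-- The Schur function `s_lam(x_0, x_1, …) = det (h_{lam_i - i + j})`. -/
def schur (lam : YoungDiagram) : R F m :=
  Matrix.det (Matrix.of fun i j : Fin (lam.colLen 0) =>
    hInt F m ((lam.rowLen i : ℤ) - (i : ℤ) + (j : ℤ)))

variable {m}

/-- The monomial `x^a = x_0^{a_0} ⋯ x_{m-1}^{a_{m-1}}`. -/
def xPow (a : Fin m → ℕ) : R F m := ∏ i, xVar F i ^ a i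

/-- `k_L(x) = x^a s_lam(x)`. -/
def kOne (L : MPartition m) : R F m := xPow F L.comp * schur F m L.part

/-! ### Hecke operators and the basis `k_L(x;t)` -/

variable {F}

open Classical in
/-- The quotient `(K_{i,i+1} f - f) / (x_i - x_{i+1})`, where `K_{i,i+1}` exchanges the variables
`x_i` and `x_{i+1}`. The quotient exists in `R_m` and is unique. -/
def divDiff (i : ℕ) (h : i + 1 < m) (f : R F m) : R F m :=
  if H : ∃ g : R F m,
      (((xVar F ⟨i, Nat.lt_of_succ_lt h⟩ - xVar F ⟨i + 1, h⟩) * g : R F m) : MvPowerSeries ℕ F)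
        = MvPowerSeries.renameEquiv F (Equiv.swap i (i + 1)) (f : MvPowerSeries ℕ F) - f
  then H.choose else 0

/-- The generator `T_i = t + (t x_i - x_{i+1}) / (x_i - x_{i+1}) (K_{i,i+1} - 1)` of the Hecke
algebra, acting on `R_m`. -/
def hecke (t : Fˣ) (i : ℕ) (h : i + 1 < m) (f : R F m) : R F m :=
  (t : F) • f +
    ((t : F) • xVar F ⟨i, Nat.lt_of_succ_lt h⟩ - xVar F ⟨i + 1, h⟩) * divDiff i h f

open Classical in
/-- The non-symmetric Hall-Littlewood polynomial `H_a(x_0, …, x_{m-1}; t)`: it is `x^a` for dominant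
`a`, and `H_a = T_i H_{s_i a}` if `a_i < a_{i+1}` (the smallest such `i` is used). -/
def hallLittlewood (t : Fˣ) (a : Fin m → ℕ) : R F m :=
  if H : ∃ i, IsAscent a i then
    hecke t (Nat.find H) (Nat.find_spec H).1
      (hallLittlewood t (swapComp (Nat.find H) (Nat.find_spec H).1 a))
  else xPow F a
termination_by ∑ j : Fin m, (j : ℕ) * a j
decreasing_by exact swapComp_weight_lt a _ _ (Nat.find_spec H).2

/-- `k_L(x;t) = H_a(x_0, …, x_{m-1}; t) s_lam(x)`. -/
def k (t : Fˣ) (L : MPartition m) : R F m := hallLittlewood t L.comp * schur F m L.part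

open Classical in
/-- The coefficients of the expansion of an element of `R_m` in the basis `k_L(x;t)`. -/
def kCoeff (t : Fˣ) (f : R F m) : MPartition m →₀ F :=
  if H : ∃ b : Module.Basis (MPartition m) F (R F m), ∀ L, b L = k t L
  then H.choose.repr f else 0

open Classical in
/-- Two families `u`, `v` in `R_m` are dual with respect to a bilinear form. -/
def IsDual (B : LinearMap.BilinForm F (R F m)) (u v : MPartition m → R F m) : Prop :=
  ∀ L O, B (u L) (v O) = if L = O then 1 else 0

open Classical in
/-- The bilinear scalar product on `R_m` for which the basis `k_L(x;t)` is self-dual. -/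
def scalar (t : Fˣ) : LinearMap.BilinForm F (R F m) :=
  if H : ∃ B : LinearMap.BilinForm F (R F m), IsDual B (k t) (k t) then H.choose else 0

open Classical in
/-- The adjoint `T_i^*` of `T_i` with respect to the scalar product. -/
def heckeAdj (t : Fˣ) (i : ℕ) (h : i + 1 < m) : R F m → R F m :=
  if H : ∃ S : R F m → R F m, ∀ f g, scalar t (hecke t i h f) g = scalar t f (S g)
  then H.choose else 0

/-! ### The dual `m`-symmetric Schur functions -/

open Classical in
/-- The function `s^*_{(a; lam)}(x;t)`: it is `∑_O (∑_T t^{charge(T)}) k_O(x;t)` for dominant `a`, and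
`t⁻¹ T_i^* s^*_{(s_i a; lam)}(x;t)` if `a_i < a_{i+1}` (the smallest such `i` is used). -/
def dualSchurAux (t : Fˣ) (lam : YoungDiagram) (a : Fin m → ℕ) : R F m :=
  if H : ∃ i, IsAscent a i then
    ((t⁻¹ : Fˣ) : F) • heckeAdj t (Nat.find H) (Nat.find_spec H).1
      (dualSchurAux t lam (swapComp (Nat.find H) (Nat.find_spec H).1 a))
  else ∑ᶠ O : MPartition m, dominantCoeff (t : F) ⟨a, lam⟩ O • k t O
termination_by ∑ j : Fin m, (j : ℕ) * a j
decreasing_by exact swapComp_weight_lt a _ _ (Nat.find_spec H).2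

/-- The dual `m`-symmetric Schur function `s^*_L(x;t)`. -/
def dualSchur (t : Fˣ) (L : MPartition m) : R F m := dualSchurAux t L.part L.comp

/-- The coefficient `D_{L O}(t)` of `k_O(x;t)` in `s^*_L(x;t)`. -/
def D (t : Fˣ) (L O : MPartition m) : F := kCoeff t (dualSchur t L) O

end

end MSym

/-!
# The dual `m`-symmetric Schur functions form a basis of `R_m`

Everything is a triangularity argument. A family that is triangular with nonzero diagonal with
respect to a basis is again a basis (`exists_basis_of_triangular`); this is applied four times.

* *The functions `x^a s_lam`.* An element of `R_m` is determined by its coefficients at the exponents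
  `(a, lam)` of `m`-partitions (`exists_coeff_expo_ne_zero`). Column operations on the Jacobi-Trudi
  determinant split off one variable at a time (`coeff_det_jtMatrix`), which shows that the exponents
  in `s_lam` are lexicographically at most `lam`, with coefficient `1` at `lam`. Hence the coordinates
  of `x^a s_lam` are unitriangular (`exists_basis_kOne`).
* *The functions `k_L(x;t)`.* The Hecke operator `T_i` does not increase the sum of the squares of an
  exponent, and `T_i x^a = x^{s_i a} + (lower terms)` for `a_i > a_{i+1}`. So `H_a` has leading term
  `x^a` (`hallLittlewood_sub_mem`).
* *The functions `s^*_L(x;t)`.* The quadratic, commutation and braid relations give the action of `T_i`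
  on all `k_L(x;t)` (`hecke_k_of_eq`, `hecke_k_of_gt`, `hecke_k_of_lt`), and with it the matrix of
  the adjoint `T_i^*`. In particular `t⁻¹ T_i^*` maps `k_b` to `k_{s_i b}` if `b_i > b_{i+1}`, and it
  preserves `∑ b_i`. For dominant `a`, a tableau in `S_{L O}` has at most `a_i` letters `i`, and if all
  these bounds are attained then `O = L` and the tableau is unique. Hence
  `s^*_L = t^n k_L + (terms k_O with ∑ b_i < ∑ a_i)` for some `n` (`dualCoeff_triangular`). This holds
  for every invertible `t`.
* *The dual basis.* Its matrix is the transposed inverse of the previous one. The columns of the latter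
  are finite because all transition matrices are homogeneous (`exists_basis_dualSchur`).

The recursion for the coefficients makes sense over every commutative ring (`dualCoeff`), in
particular over the Laurent polynomials, and commutes with ring homomorphisms. At `t = 1` it merely
permutes the entries of both indices simultaneously. For a tableau in `S_{L O}`, counting the
letters in the columns from `c` on bounds the number of cells in these columns of
`(b + e) ∪ mu` by that of `(a + e) ∪ lam` for *every* `e ∈ {0,1}^m`; this condition (`StrongLE`)
is invariant under simultaneous permutations and implies the dominance order on `m`-partitions.
-/


namespace MSym

/-! ### Triangular families -/

section Triangular

variable {ι F M : Type*} [Field F] [AddCommGroup M] [Module F M]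

theorem repr_sub_basis_of_triangular (lt : ι → ι → Prop) (b : Module.Basis ι F M) (v : ι → M)
    (h : ∀ i j, b.repr (v i) j ≠ 0 → j = i ∨ lt j i) (i : ι) :
    v i - b.repr (v i) i • b i ∈ Submodule.span F (b '' {j | lt j i}) := by
  classical
  rw [b.mem_span_image]
  intro j hj
  rw [Finset.mem_coe, Finsupp.mem_support_iff, map_sub, map_smul, b.repr_self,
    Finsupp.sub_apply, Finsupp.smul_apply] at hj
  by_cases hji : j = i
  · subst hji
    simp at hj
  · rw [Finsupp.single_apply, if_neg (Ne.symm hji), smul_zero, sub_zero] at hj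
    exact (h i j hj).resolve_left hji

theorem mem_span_of_triangular {lt : ι → ι → Prop} (hwf : WellFounded lt)
    (htrans : ∀ i j l, lt i j → lt j l → lt i l) (b : Module.Basis ι F M) (v : ι → M)
    (h : ∀ i j, b.repr (v i) j ≠ 0 → j = i ∨ lt j i) (hd : ∀ i, b.repr (v i) i ≠ 0) (i : ι) :
    b i ∈ Submodule.span F (v '' {j | j = i ∨ lt j i}) := by
  induction i using hwf.induction with
  | _ i ih =>
    have h1 : v i - b.repr (v i) i • b i ∈ Submodule.span F (v '' {j | j = i ∨ lt j i}) := by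
      refine Submodule.span_le.2 ?_ (repr_sub_basis_of_triangular lt b v h i)
      rintro _ ⟨j, hj, rfl⟩
      refine Submodule.span_mono (Set.image_mono ?_) (ih j hj)
      rintro l (rfl | hl)
      · exact Or.inr hj
      · exact Or.inr (htrans _ _ _ hl hj)
    have h2 : v i ∈ Submodule.span F (v '' {j | j = i ∨ lt j i}) :=
      Submodule.subset_span ⟨i, Or.inl rfl, rfl⟩
    have h3 := Submodule.smul_mem _ (b.repr (v i) i)⁻¹ (Submodule.sub_mem _ h2 h1)
    rwa [sub_sub_cancel, inv_smul_smul₀ (hd i)] at h3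

theorem linearIndependent_of_triangular {lt : ι → ι → Prop} (hwf : WellFounded lt)
    (b : Module.Basis ι F M) (v : ι → M)
    (h : ∀ i j, b.repr (v i) j ≠ 0 → j = i ∨ lt j i) (hd : ∀ i, b.repr (v i) i ≠ 0) :
    LinearIndependent F v := by
  classical
  rw [linearIndependent_iff]
  intro x hx
  by_contra hne
  have hs : x.support.Nonempty := Finsupp.support_nonempty_iff.2 hne
  -- An index of the support that is maximal for `lt`: its coordinate sees only the diagonal term.
  obtain ⟨i, hi, hmax⟩ : ∃ i ∈ x.support, ∀ j ∈ x.support, ¬ lt i j := by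
    by_contra! hcon
    -- Otherwise an infinite ascending chain lives in a finite set, where it must have a cycle.
    choose! g hg hlt using hcon
    obtain ⟨i₀, hi₀⟩ := hs
    have hmem : ∀ n, g^[n] i₀ ∈ x.support := by
      intro n
      induction n with
      | zero => exact hi₀
      | succ n ih => rw [Function.iterate_succ_apply']; exact hg _ ih
    have hstep : ∀ n, Relation.TransGen lt (g^[n] i₀) (g^[n + 1] i₀) := fun n => by
      rw [Function.iterate_succ_apply']
      exact Relation.TransGen.single (hlt _ (hmem n))
    have hchain : ∀ n k, Relation.TransGen lt (g^[n] i₀) (g^[n + 1 + k] i₀) := by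
      intro n k
      induction k with
      | zero => exact hstep n
      | succ k ih => exact ih.trans (hstep (n + 1 + k))
    have hinj : Function.Injective fun n => (⟨g^[n] i₀, hmem n⟩ : x.support) := by
      have key : ∀ a c, a < c → g^[a] i₀ ≠ g^[c] i₀ := by
        intro a c hac heq
        obtain ⟨k, rfl⟩ := Nat.exists_eq_add_of_le (Nat.succ_le_of_lt hac)
        have := hchain a k
        rw [Nat.succ_eq_add_one] at heq
        rw [← heq] at this
        exact hwf.transGen.irrefl.irrefl _ this
      intro a c hac
      have hac' := congrArg Subtype.val hac
      rcases lt_trichotomy a c with h1 | h1 | h1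
      · exact absurd hac' (key _ _ h1)
      · exact h1
      · exact absurd hac'.symm (key _ _ h1)
    exact not_injective_infinite_finite _ hinj
  have h1 := congrArg (fun y => b.repr y i) hx
  simp only [Finsupp.linearCombination_apply, Finsupp.sum, map_sum, map_smul, map_zero,
    Finsupp.coe_finsetSum, Finset.sum_apply, Finsupp.smul_apply, smul_eq_mul,
    Finsupp.zero_apply] at h1
  rw [Finset.sum_eq_single_of_mem i hi] at h1
  · exact (mul_ne_zero (Finsupp.mem_support_iff.1 hi) (hd i)) h1
  · intro j hj hji
    by_contra hcon
    rcases h j i (right_ne_zero_of_mul hcon) with h2 | h2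
    · exact hji h2.symm
    · exact hmax j hj h2

/-- A family that is triangular with nonzero diagonal with respect to a basis is a basis, and the
inverse transition matrix is triangular with nonzero diagonal as well. -/
theorem exists_basis_of_triangular {lt : ι → ι → Prop} (hwf : WellFounded lt)
    (htrans : ∀ i j l, lt i j → lt j l → lt i l) (b : Module.Basis ι F M) (v : ι → M)
    (h : ∀ i j, b.repr (v i) j ≠ 0 → j = i ∨ lt j i) (hd : ∀ i, b.repr (v i) i ≠ 0) :
    ∃ b' : Module.Basis ι F M, (∀ i, b' i = v i) ∧
      (∀ i j, b'.repr (b i) j ≠ 0 → j = i ∨ lt j i) ∧ ∀ i, b'.repr (b i) i ≠ 0 := by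
  have hspan := mem_span_of_triangular hwf htrans b v h hd
  have hli := linearIndependent_of_triangular hwf b v h hd
  have htop : ⊤ ≤ Submodule.span F (Set.range v) := by
    rw [← b.span_eq, Submodule.span_le]
    rintro _ ⟨i, rfl⟩
    exact Submodule.span_mono (Set.image_subset_range _ _) (hspan i)
  have hv : ⇑(Module.Basis.mk hli htop) = v := Module.Basis.coe_mk hli htop
  set b' := Module.Basis.mk hli htop
  have hoff : ∀ i j, b'.repr (b i) j ≠ 0 → j = i ∨ lt j i := by
    intro i j hj
    have h1 := hspan i
    rw [← hv, b'.mem_span_image] at h1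
    exact h1 (by simpa using hj)
  refine ⟨b', fun i => congrFun hv i, hoff, fun i hcon => ?_⟩
  -- If the diagonal entry vanished, `v i` would have no component along itself.
  have h2 : b'.repr (v i - b.repr (v i) i • b i) i = 0 := by
    have h3 := repr_sub_basis_of_triangular lt b v h i
    refine Submodule.span_induction (p := fun y _ => b'.repr y i = 0) ?_ ?_ ?_ ?_ h3
    · rintro _ ⟨j, hj, rfl⟩
      by_contra hc
      rcases hoff j i hc with rfl | h4
      · exact hwf.irrefl.irrefl _ hj
      · exact hwf.irrefl.irrefl _ (htrans _ _ _ h4 hj)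
    · simp
    · intro y z _ _ hy hz
      simp [hy, hz]
    · intro c y _ hy
      simp [hy]
  rw [map_sub, map_smul, Finsupp.sub_apply, Finsupp.smul_apply, hcon, smul_zero, sub_zero,
    ← congrFun hv i, b'.repr_self, Finsupp.single_eq_same] at h2
  exact one_ne_zero h2

end Triangular

/-! ### Monomial coefficients of Jacobi-Trudi determinants -/

section JacobiTrudi

variable (F : Type*) [Field F]

/-- The complete homogeneous series of degree `r` in the variables `x_p, x_{p+1}, …`
(zero for `r < 0`). -/
noncomputable def hVar (p : ℕ) (r : ℤ) : MvPowerSeries ℕ F := by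
  classical exact fun n => if (∀ i < p, n i = 0) ∧ (n.degree : ℤ) = r then 1 else 0

open Classical in
theorem coeff_hVar (p : ℕ) (r : ℤ) (n : ℕ →₀ ℕ) :
    MvPowerSeries.coeff n (hVar F p r)
      = if (∀ i < p, n i = 0) ∧ (n.degree : ℤ) = r then 1 else 0 := rfl

theorem coeff_X_mul' (p : ℕ) (e : ℕ →₀ ℕ) (g : MvPowerSeries ℕ F) :
    MvPowerSeries.coeff e (MvPowerSeries.X p * g)
      = if e p = 0 then 0 else MvPowerSeries.coeff (e - Finsupp.single p 1) g := by
  classical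
  rw [MvPowerSeries.X, MvPowerSeries.coeff_monomial_mul, one_mul]
  by_cases h : e p = 0
  · rw [if_pos h, if_neg]
    rw [Finsupp.single_le_iff]
    omega
  · rw [if_pos (Finsupp.single_le_iff.2 (Nat.one_le_iff_ne_zero.2 h)), if_neg h]

theorem degree_sub_single {e : ℕ →₀ ℕ} {p : ℕ} (h : e p ≠ 0) :
    (e - Finsupp.single p 1).degree + 1 = e.degree := by
  have h1 : e - Finsupp.single p 1 + Finsupp.single p 1 = e :=
    tsub_add_cancel_of_le (Finsupp.single_le_iff.2 (Nat.one_le_iff_ne_zero.2 h))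
  conv_rhs => rw [← h1]
  simp

theorem hVar_eq_add (p : ℕ) (r : ℤ) :
    hVar F p r = hVar F (p + 1) r + MvPowerSeries.X p * hVar F p (r - 1) := by
  classical
  ext e
  rw [map_add, coeff_X_mul', coeff_hVar, coeff_hVar, coeff_hVar]
  by_cases h : e p = 0
  · have h1 : (∀ i < p + 1, e i = 0) ↔ ∀ i < p, e i = 0 := by
      refine ⟨fun H i hi => H i (by omega), fun H i hi => ?_⟩
      rcases Nat.lt_succ_iff_lt_or_eq.1 hi with h2 | rfl
      · exact H i h2
      · exact h
    rw [if_pos h, add_zero]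
    simp only [h1]
  · have h1 : ¬ ∀ i < p + 1, e i = 0 := fun H => h (H p (by omega))
    have h2 : (∀ i < p, (e - Finsupp.single p 1 : ℕ →₀ ℕ) i = 0) ↔ ∀ i < p, e i = 0 := by
      refine forall₂_congr fun i hi => ?_
      rw [Finsupp.tsub_apply, Finsupp.single_eq_of_ne (by omega)]
      simp
    have h3 := degree_sub_single h
    have h4 : (((e - Finsupp.single p 1).degree : ℤ) = r - 1) ↔ ((e.degree : ℤ) = r) := by
      rw [← h3]; push_cast; constructor <;> intro <;> linarith
    simp only [h1, h2, h4, h, false_and, if_false, zero_add]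

/-- The subalgebra of the power series in which the variable `x_p` does not occur. -/
def varFree (p : ℕ) : Subalgebra F (MvPowerSeries ℕ F) where
  carrier := {g | ∀ e : ℕ →₀ ℕ, e p ≠ 0 → MvPowerSeries.coeff e g = 0}
  mul_mem' := by
    classical
    intro f g hf hg e he
    rw [MvPowerSeries.coeff_mul]
    refine Finset.sum_eq_zero fun q hq => ?_
    rw [Finset.HasAntidiagonal.mem_antidiagonal] at hq
    by_cases h1 : q.1 p = 0
    · have h2 : q.2 p ≠ 0 := by
        intro h2
        apply he
        rw [← hq, Finsupp.add_apply, h1, h2]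
      rw [hg _ h2, mul_zero]
    · rw [hf _ h1, zero_mul]
  add_mem' := by
    intro f g hf hg e he
    rw [map_add, hf e he, hg e he, add_zero]
  algebraMap_mem' r := by
    classical
    intro e he
    rw [MvPowerSeries.algebraMap_apply, MvPowerSeries.coeff_C, if_neg]
    rintro rfl
    exact he rfl

theorem hVar_succ_mem_varFree (p : ℕ) (r : ℤ) : hVar F (p + 1) r ∈ varFree F p := by
  intro e he
  rw [coeff_hVar, if_neg]
  exact fun h => he (h.1 p (by omega))

theorem det_mem_of_forall_mem {n : ℕ} (S : Subalgebra F (MvPowerSeries ℕ F))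
    (A : Matrix (Fin n) (Fin n) (MvPowerSeries ℕ F)) (h : ∀ i j, A i j ∈ S) : A.det ∈ S := by
  rw [Matrix.det_apply]
  refine S.sum_mem fun s _ => ?_
  rw [Units.smul_def]
  exact S.zsmul_mem (S.prod_mem fun i _ => h _ _) _

variable {F}

theorem coeff_hVar_mul {p : ℕ} {g : MvPowerSeries ℕ F} (hg : g ∈ varFree F p) (r : ℤ)
    (e : ℕ →₀ ℕ) :
    MvPowerSeries.coeff e (hVar F p r * g)
      = MvPowerSeries.coeff (e.erase p) (hVar F (p + 1) (r - e p) * g) := by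
  induction hk : e p generalizing e r with
  | zero =>
    rw [hVar_eq_add, add_mul, map_add, mul_assoc, coeff_X_mul', if_pos hk, add_zero,
      Finsupp.erase_of_notMem_support (by simp [hk])]
    simp
  | succ k ih =>
    have h1 : e p ≠ 0 := by omega
    have h2 := (varFree F p).mul_mem (hVar_succ_mem_varFree F p r) hg e h1
    rw [hVar_eq_add, add_mul, map_add, mul_assoc, coeff_X_mul', if_neg h1, h2, zero_add,
      ih _ _ (by simp [hk])]
    have h3 : (e - Finsupp.single p 1).erase p = e.erase p := by
      ext i
      by_cases hi : i = p
      · subst hi; simp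
      · simp [Finsupp.erase_ne hi, Finsupp.single_eq_of_ne hi]
    rw [h3]
    have h4 : r - 1 - (k : ℤ) = r - ((k + 1 : ℕ) : ℤ) := by
      push_cast
      ring
    rw [h4]

variable (F) in
/-- The Jacobi-Trudi matrix `(h_{l_i - i + j})` of size `n` in the variables `x_p, x_{p+1}, …`. -/
noncomputable def jtMatrix (p n : ℕ) (l : ℕ → ℤ) : Matrix (Fin n) (Fin n) (MvPowerSeries ℕ F) :=
  Matrix.of fun i j => hVar F p (l i - (i : ℤ) + (j : ℤ))

variable (F) in
/-- The Jacobi-Trudi matrix in the variables `x_{p+1}, x_{p+2}, …`, with the indices in the first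
column lowered by `k`. -/
noncomputable def jtShift (p n : ℕ) (l : ℕ → ℤ) (k : ℤ) :
    Matrix (Fin (n + 1)) (Fin (n + 1)) (MvPowerSeries ℕ F) :=
  Matrix.of fun i j => hVar F (p + 1) (l i - (i : ℤ) + (if j = 0 then -k else (j : ℤ)))

/-- Subtracting `x_p` times its left neighbour from each column removes `x_p` from all columns but
the first, in which the exponent of `x_p` can then be read off. -/
theorem coeff_det_jtMatrix (p n : ℕ) (l : ℕ → ℤ) (e : ℕ →₀ ℕ) :
    MvPowerSeries.coeff e (jtMatrix F p (n + 1) l).det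
      = MvPowerSeries.coeff (e.erase p) (jtShift F p n l (e p)).det := by
  let B : Matrix (Fin (n + 1)) (Fin (n + 1)) (MvPowerSeries ℕ F) := Matrix.of fun i j =>
    if j = 0 then hVar F p (l i - (i : ℤ)) else hVar F (p + 1) (l i - (i : ℤ) + (j : ℤ))
  have hB : (jtMatrix F p (n + 1) l).det = B.det := by
    refine Matrix.det_eq_of_forall_col_eq_smul_add_pred (fun _ => MvPowerSeries.X p) ?_ ?_
    · intro i
      simp [jtMatrix, B]
    · intro i j
      simp only [jtMatrix, B, Matrix.of_apply, Fin.succ_ne_zero, if_false]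
      have h1 : l i - (i : ℤ) + ((j.succ : ℕ) : ℤ) - 1 = l i - (i : ℤ) + ((j.castSucc : ℕ) : ℤ) := by
        simp only [Fin.val_succ, Fin.val_castSucc]
        push_cast
        ring
      rw [hVar_eq_add, h1]
  rw [hB, Matrix.det_succ_column_zero, Matrix.det_succ_column_zero, map_sum, map_sum]
  refine Finset.sum_congr rfl fun i _ => ?_
  have hminor : B.submatrix i.succAbove Fin.succ
      = (jtShift F p n l (e p)).submatrix i.succAbove Fin.succ := by
    ext a c : 2
    simp [B, jtShift, Matrix.submatrix_apply]
  rw [hminor]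
  have hmem : (-1) ^ (i : ℕ) * ((jtShift F p n l (e p)).submatrix i.succAbove Fin.succ).det
      ∈ varFree F p := by
    refine (varFree F p).mul_mem ((varFree F p).pow_mem ((varFree F p).neg_mem
      (varFree F p).one_mem) _) (det_mem_of_forall_mem F _ _ fun a c => ?_)
    exact hVar_succ_mem_varFree F p _
  have h1 : B i 0 = hVar F p (l i - (i : ℤ)) := by simp [B]
  have h2 : jtShift F p n l (e p) i 0 = hVar F (p + 1) (l i - (i : ℤ) - (e p : ℤ)) := by
    simp [jtShift, sub_eq_add_neg]
  rw [h1, h2, mul_comm ((-1) ^ (i : ℕ)) (hVar F p _), mul_assoc, coeff_hVar_mul hmem,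
    mul_comm ((-1) ^ (i : ℕ)) (hVar F (p + 1) _), mul_assoc]

theorem coeff_det_jtMatrix_of_eq_zero (p n : ℕ) (l : ℕ → ℤ) {e : ℕ →₀ ℕ} (he : e p = 0) :
    MvPowerSeries.coeff e (jtMatrix F p n l).det
      = MvPowerSeries.coeff e (jtMatrix F (p + 1) n l).det := by
  cases n with
  | zero => simp
  | succ n =>
    rw [coeff_det_jtMatrix, he, Finsupp.erase_of_notMem_support (by simp [he])]
    congr 2
    ext i j : 2
    simp only [jtShift, jtMatrix, Matrix.of_apply]
    split_ifs with h
    · subst h; simp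
    · rfl

theorem coeff_det_jtMatrix_zero_of_forall (p n : ℕ) (l : ℕ → ℤ) {e : ℕ →₀ ℕ}
    (he : ∀ i < p, e i = 0) :
    MvPowerSeries.coeff e (jtMatrix F 0 n l).det
      = MvPowerSeries.coeff e (jtMatrix F p n l).det := by
  induction p with
  | zero => rfl
  | succ p ih =>
    rw [ih fun i hi => he i (by omega), coeff_det_jtMatrix_of_eq_zero p n l (he p (by omega))]

theorem hVar_of_neg (p : ℕ) {r : ℤ} (hr : r < 0) : hVar F p r = 0 := by
  ext e
  rw [coeff_hVar, if_neg, map_zero]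
  rintro ⟨-, h⟩
  omega

theorem hVar_zero (p : ℕ) : hVar F p 0 = 1 := by
  classical
  ext e
  rw [coeff_hVar, MvPowerSeries.coeff_one]
  refine if_congr ?_ rfl rfl
  constructor
  · rintro ⟨-, h⟩
    exact (Finsupp.degree_eq_zero_iff e).1 (by exact_mod_cast h)
  · rintro rfl
    simp

theorem coeff_det_jtMatrix_of_lt (p n : ℕ) {l : ℕ → ℤ} (hl : Antitone l) {e : ℕ →₀ ℕ}
    (he : l 0 < e p) : MvPowerSeries.coeff e (jtMatrix F p (n + 1) l).det = 0 := by
  rw [coeff_det_jtMatrix, Matrix.det_eq_zero_of_column_eq_zero 0, map_zero]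
  intro i
  have := hl (Nat.zero_le (i : ℕ))
  simp only [jtShift, Matrix.of_apply, if_true]
  exact hVar_of_neg _ (by omega)

theorem coeff_det_jtMatrix_of_eq (p n : ℕ) {l : ℕ → ℤ} (hl : Antitone l) {e : ℕ →₀ ℕ}
    (he : (e p : ℤ) = l 0) :
    MvPowerSeries.coeff e (jtMatrix F p (n + 1) l).det
      = MvPowerSeries.coeff (e.erase p) (jtMatrix F (p + 1) n fun i => l (i + 1)).det := by
  rw [coeff_det_jtMatrix, Matrix.det_succ_column_zero, Finset.sum_eq_single 0]
  · have h1 : jtShift F p n l (e p) 0 0 = 1 := by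
      simp [jtShift, he, hVar_zero]
    rw [h1]
    simp only [Fin.val_zero, pow_zero, one_mul]
    congr 2
    ext i j : 2
    simp only [jtShift, jtMatrix, Matrix.submatrix_apply, Matrix.of_apply, Fin.succ_ne_zero,
      if_false, Fin.zero_succAbove, Fin.val_succ]
    have h2 : l ((i : ℕ) + 1) - (((i : ℕ) + 1 : ℕ) : ℤ) + (((j : ℕ) + 1 : ℕ) : ℤ)
        = l ((i : ℕ) + 1) - (i : ℤ) + (j : ℤ) := by
      push_cast
      ring
    rw [h2]
  · intro i _ hi
    have h0 : 0 < (i : ℕ) := Nat.pos_of_ne_zero fun h => hi (Fin.ext h)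
    have := hl (Nat.zero_le (i : ℕ))
    have h1 : jtShift F p n l (e p) i 0 = 0 := by
      simp only [jtShift, Matrix.of_apply, if_true]
      exact hVar_of_neg _ (by omega)
    rw [h1, mul_zero, zero_mul]
  · simp

/-- The monomials of a Schur function in `x_p, x_{p+1}, …` have exponents that are
lexicographically at most the partition. -/
theorem lex_of_coeff_det_jtMatrix_ne_zero (n p : ℕ) {l : ℕ → ℕ} (hl : Antitone l)
    (hn : ∀ i, n ≤ i → l i = 0) {e : ℕ →₀ ℕ} (he : ∀ i < p, e i = 0)
    (h : MvPowerSeries.coeff e (jtMatrix F p n fun i => (l i : ℤ)).det ≠ 0) :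
    (∀ i, e (p + i) = l i) ∨ ∃ j, (∀ i < j, e (p + i) = l i) ∧ e (p + j) < l j := by
  classical
  induction n generalizing p l e with
  | zero =>
    left
    rw [Matrix.det_isEmpty, MvPowerSeries.coeff_one] at h
    have h1 : e = 0 := by
      by_contra hc
      exact h (if_neg hc)
    intro i
    rw [h1, hn i (Nat.zero_le _)]
    rfl
  | succ n ih =>
    have hl' : Antitone fun i => (l i : ℤ) := fun i j hij => Int.ofNat_le.2 (hl hij)
    rcases lt_trichotomy (e p) (l 0) with h1 | h1 | h1
    · exact Or.inr ⟨0, by simp, by simpa using h1⟩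
    · rw [coeff_det_jtMatrix_of_eq p n hl' (by exact_mod_cast h1)] at h
      have hshift : ∀ i, (e.erase p) (p + 1 + i) = e (p + (i + 1)) := fun i => by
        rw [Finsupp.erase_ne (by omega)]
        congr 1
        omega
      have h2 := ih (p + 1) (l := fun i => l (i + 1)) (fun i j hij => hl (by omega))
        (fun i hi => hn _ (by omega)) (e := e.erase p) (fun i hi => by
          rcases Nat.lt_succ_iff_lt_or_eq.1 hi with h3 | rfl
          · rw [Finsupp.erase_ne (by omega)]; exact he i h3
          · simp) h
      simp only [hshift] at h2
      rcases h2 with h2 | ⟨j, hj, hj'⟩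
      · left
        intro i
        cases i with
        | zero => exact h1
        | succ i => exact h2 i
      · right
        refine ⟨j + 1, fun i hi => ?_, hj'⟩
        cases i with
        | zero => exact h1
        | succ i => exact hj i (by omega)
    · exact absurd (coeff_det_jtMatrix_of_lt p n hl' (by exact_mod_cast h1)) h

theorem coeff_det_jtMatrix_eq_one (n p : ℕ) {l : ℕ → ℕ} (hl : Antitone l)
    (hn : ∀ i, n ≤ i → l i = 0) {e : ℕ →₀ ℕ} (he : ∀ i < p, e i = 0)
    (h : ∀ i, e (p + i) = l i) :
    MvPowerSeries.coeff e (jtMatrix F p n fun i => (l i : ℤ)).det = 1 := by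
  classical
  induction n generalizing p l e with
  | zero =>
    have h1 : e = 0 := by
      ext i
      rcases lt_or_ge i p with hi | hi
      · exact he i hi
      · obtain ⟨k, rfl⟩ := Nat.exists_eq_add_of_le hi
        rw [h k, hn k (Nat.zero_le _)]
        rfl
    rw [h1, Matrix.det_isEmpty, MvPowerSeries.coeff_one, if_pos rfl]
  | succ n ih =>
    have hl' : Antitone fun i => (l i : ℤ) := fun i j hij => Int.ofNat_le.2 (hl hij)
    rw [coeff_det_jtMatrix_of_eq p n hl' (by exact_mod_cast h 0)]
    refine ih (p + 1) (l := fun i => l (i + 1)) (fun i j hij => hl (by omega))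
        (fun i hi => hn _ (by omega)) (fun i hi => ?_) fun i => ?_
    · rcases Nat.lt_succ_iff_lt_or_eq.1 hi with h3 | rfl
      · rw [Finsupp.erase_ne (by omega)]; exact he i h3
      · simp
    · rw [Finsupp.erase_ne (by omega), ← h]
      congr 1
      omega

theorem degree_eq_of_coeff_prod_hVar_ne_zero {ι : Type*} (s : Finset ι) (r : ι → ℤ) (p : ℕ)
    {e : ℕ →₀ ℕ} (h : MvPowerSeries.coeff e (∏ i ∈ s, hVar F p (r i)) ≠ 0) :
    (e.degree : ℤ) = ∑ i ∈ s, r i := by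
  classical
  induction s using Finset.induction_on generalizing e with
  | empty =>
    rw [Finset.prod_empty, MvPowerSeries.coeff_one] at h
    have h1 : e = 0 := by
      by_contra hc
      exact h (if_neg hc)
    simp [h1]
  | insert a s ha ih =>
    rw [Finset.prod_insert ha, MvPowerSeries.coeff_mul] at h
    obtain ⟨q, hq, hne⟩ := Finset.exists_ne_zero_of_sum_ne_zero h
    rw [Finset.HasAntidiagonal.mem_antidiagonal] at hq
    have h1 := left_ne_zero_of_mul hne
    rw [coeff_hVar] at h1
    have h2 : (q.1.degree : ℤ) = r a := by
      by_contra hc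
      exact h1 (if_neg fun h => hc h.2)
    rw [Finset.sum_insert ha, ← ih (right_ne_zero_of_mul hne), ← h2, ← hq, map_add]
    push_cast
    rfl

theorem degree_eq_of_coeff_det_jtMatrix_ne_zero (p n : ℕ) (l : ℕ → ℤ) {e : ℕ →₀ ℕ}
    (h : MvPowerSeries.coeff e (jtMatrix F p n l).det ≠ 0) :
    (e.degree : ℤ) = ∑ i : Fin n, l i := by
  rw [Matrix.det_apply, map_sum] at h
  obtain ⟨s, -, hs⟩ := Finset.exists_ne_zero_of_sum_ne_zero h
  rw [Units.smul_def, map_zsmul] at hs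
  have h1 := right_ne_zero_of_smul hs
  simp only [jtMatrix, Matrix.of_apply] at h1
  rw [degree_eq_of_coeff_prod_hVar_ne_zero _ _ _ h1, Finset.sum_add_distrib,
    Finset.sum_sub_distrib, Equiv.sum_comp s fun i : Fin n => l i,
    Equiv.sum_comp s fun i : Fin n => ((i : ℕ) : ℤ)]
  ring

end JacobiTrudi

/-! ### The basis `x^a s_lam` of `R_m` -/

section Diagrams

theorem rowLen_eq_zero_of_le (lam : YoungDiagram) {i : ℕ} (h : lam.colLen 0 ≤ i) :
    lam.rowLen i = 0 := by
  by_contra hc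
  have h1 : (i, 0) ∈ lam := YoungDiagram.mem_iff_lt_rowLen.2 (Nat.pos_of_ne_zero hc)
  exact absurd (YoungDiagram.mem_iff_lt_colLen.1 h1) (by omega)

theorem card_filter_le_col (lam : YoungDiagram) (c : ℕ) {n : ℕ} (hn : lam.colLen 0 ≤ n) :
    (lam.cells.filter fun x => c ≤ x.2).card = ∑ i ∈ Finset.range n, (lam.rowLen i - c) := by
  rw [Finset.card_eq_sum_card_fiberwise (f := Prod.fst) (t := Finset.range n)]
  · refine Finset.sum_congr rfl fun i _ => ?_
    have h : ((lam.cells.filter fun x => c ≤ x.2).filter fun x => x.1 = i)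
        = (Finset.Ico c (lam.rowLen i)).map ⟨fun j => (i, j), fun a b h => by simpa using h⟩ := by
      ext ⟨r, j⟩
      simp only [Finset.mem_filter, YoungDiagram.mem_cells, Finset.mem_map, Finset.mem_Ico,
        YoungDiagram.mem_iff_lt_rowLen]
      constructor
      · rintro ⟨⟨h1, h2⟩, rfl⟩
        exact ⟨j, ⟨h2, h1⟩, rfl⟩
      · rintro ⟨k, ⟨h1, h2⟩, h3⟩
        obtain ⟨rfl, rfl⟩ := Prod.mk.inj h3
        exact ⟨⟨h2, h1⟩, rfl⟩
    rw [h, Finset.card_map, Nat.card_Ico]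
  · intro x hx
    have hx' : x ∈ lam := by simpa using Finset.mem_of_mem_filter x hx
    have h1 : (x.1, x.2) ∈ lam := hx'
    have h2 := YoungDiagram.mem_iff_lt_colLen.1 (lam.up_left_mem le_rfl (Nat.zero_le x.2) h1)
    simpa using lt_of_lt_of_le h2 hn

theorem sum_rowLen (lam : YoungDiagram) {n : ℕ} (hn : lam.colLen 0 ≤ n) :
    ∑ i ∈ Finset.range n, lam.rowLen i = lam.card := by
  have h := card_filter_le_col lam 0 hn
  simp only [Nat.zero_le, Finset.filter_true, Nat.sub_zero] at h
  exact h.symm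

theorem eq_of_rowLen_eq {lam mu : YoungDiagram} (h : ∀ i, lam.rowLen i = mu.rowLen i) :
    lam = mu := by
  ext ⟨i, j⟩
  rw [YoungDiagram.mem_cells, YoungDiagram.mem_cells, YoungDiagram.mem_iff_lt_rowLen,
    YoungDiagram.mem_iff_lt_rowLen, h]

theorem exists_rowLen_eq {g : ℕ → ℕ} (hg : Antitone g) {N : ℕ} (hN : ∀ i, N ≤ i → g i = 0) :
    ∃ lam : YoungDiagram, ∀ i, lam.rowLen i = g i := by
  have hmem : ∀ c : ℕ × ℕ, c ∈ ((Finset.range N ×ˢ Finset.range (g 0)).filter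
      fun c : ℕ × ℕ => c.2 < g c.1) ↔ c.2 < g c.1 := by
    intro c
    simp only [Finset.mem_filter, Finset.mem_product, Finset.mem_range, and_iff_right_iff_imp]
    intro h
    refine ⟨?_, lt_of_lt_of_le h (hg (Nat.zero_le _))⟩
    by_contra hc
    rw [hN _ (by omega)] at h
    omega
  refine ⟨⟨(Finset.range N ×ˢ Finset.range (g 0)).filter fun c : ℕ × ℕ => c.2 < g c.1, ?_⟩, ?_⟩
  · intro c d hdc hc
    rw [Finset.mem_coe, hmem] at hc ⊢
    exact lt_of_le_of_lt hdc.2 (lt_of_lt_of_le hc (hg hdc.1))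
  · intro i
    refine eq_of_forall_lt_iff fun j => ?_
    exact YoungDiagram.mem_iff_lt_rowLen.symm.trans (hmem (i, j))

end Diagrams

section Exponents

variable {m : ℕ}

/-- The size `a_1 + ⋯ + a_m + |lam|` of an `m`-partition. -/
def MPartition.size (L : MPartition m) : ℕ := ∑ i, L.comp i + L.part.card

theorem finite_size_le (m d : ℕ) : {L : MPartition m | L.size ≤ d}.Finite := by
  have hinj : Function.Injective fun L : MPartition m => (L.comp, L.part.cells) := by
    rintro ⟨a, lam⟩ ⟨b, mu⟩ h
    simp only [Prod.mk.injEq] at h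
    ext1
    · exact h.1
    · exact YoungDiagram.ext h.2
  refine Set.Finite.of_finite_image (f := fun L : MPartition m => (L.comp, L.part.cells)) ?_
    hinj.injOn
  refine Set.Finite.subset (Set.Finite.prod (Set.Finite.pi' fun _ : Fin m => Set.finite_Iic d)
    ((Finset.range (d + 1) ×ˢ Finset.range (d + 1)).powerset.finite_toSet)) ?_
  rintro _ ⟨L, hL, rfl⟩
  have hL' : L.size ≤ d := hL
  refine ⟨fun i => ?_, ?_⟩
  · have := Finset.single_le_sum (f := L.comp) (fun _ _ => Nat.zero_le _) (Finset.mem_univ i)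
    simp only [MPartition.size] at hL'
    simp only [Set.mem_Iic]
    omega
  · rw [Finset.mem_coe, Finset.mem_powerset]
    intro c hc
    have hc' : (c.1, c.2) ∈ L.part := by simpa using hc
    have h1 : L.part.rowLen c.1 ≤ L.part.card := by
      rw [YoungDiagram.rowLen_eq_card]
      exact Finset.card_le_card (Finset.filter_subset _ _)
    have h2 : L.part.colLen c.2 ≤ L.part.card := by
      rw [YoungDiagram.colLen_eq_card]
      exact Finset.card_le_card (Finset.filter_subset _ _)
    have h3 := YoungDiagram.mem_iff_lt_rowLen.1 hc'
    have h4 := YoungDiagram.mem_iff_lt_colLen.1 hc'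
    simp only [MPartition.size] at hL'
    simp only [Finset.mem_product, Finset.mem_range]
    omega

/-- The exponent of `x^a`. -/
noncomputable def compExpo (a : Fin m → ℕ) : ℕ →₀ ℕ := ∑ i : Fin m, Finsupp.single (i : ℕ) (a i)

/-- The exponent `(0, …, 0, lam_1, lam_2, …)` with `m` leading zeros. -/
noncomputable def partExpo (m : ℕ) (lam : YoungDiagram) : ℕ →₀ ℕ :=
  Finsupp.onFinset (Finset.range (m + lam.colLen 0))
    (fun n => if n < m then 0 else lam.rowLen (n - m)) fun n hn => by
      rw [Finset.mem_range]
      by_contra hc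
      rw [if_neg (by omega), rowLen_eq_zero_of_le lam (by omega)] at hn
      exact hn rfl

/-- The exponent `(a_1, …, a_m, lam_1, lam_2, …)`. -/
noncomputable def expo (L : MPartition m) : ℕ →₀ ℕ := compExpo L.comp + partExpo m L.part

theorem compExpo_apply (a : Fin m → ℕ) (i : Fin m) : compExpo a i = a i := by
  classical
  rw [compExpo, Finsupp.finsetSum_apply, Finset.sum_eq_single i]
  · simp
  · intro j _ hj
    exact Finsupp.single_eq_of_ne fun h => hj (Fin.ext h.symm)
  · simp

theorem compExpo_of_le (a : Fin m → ℕ) {n : ℕ} (h : m ≤ n) : compExpo a n = 0 := by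
  classical
  rw [compExpo, Finsupp.finsetSum_apply]
  exact Finset.sum_eq_zero fun i _ => Finsupp.single_eq_of_ne (by omega)

theorem degree_compExpo (a : Fin m → ℕ) : (compExpo a).degree = ∑ i, a i := by
  simp [compExpo, map_sum]

theorem partExpo_of_lt (lam : YoungDiagram) {n : ℕ} (h : n < m) : partExpo m lam n = 0 := by
  simp [partExpo, h]

theorem partExpo_add (lam : YoungDiagram) (i : ℕ) : partExpo m lam (m + i) = lam.rowLen i := by
  simp [partExpo]

theorem degree_partExpo (lam : YoungDiagram) : (partExpo m lam).degree = lam.card := by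
  have hsub : (partExpo m lam).support ⊆ Finset.range (m + lam.colLen 0) :=
    Finsupp.support_onFinset_subset
  rw [Finsupp.degree_apply, Finset.sum_subset hsub
    fun x _ hx => by simpa using hx, Finset.sum_range_add, ← sum_rowLen lam le_rfl]
  rw [Finset.sum_eq_zero fun i hi => partExpo_of_lt lam (Finset.mem_range.1 hi), zero_add]
  exact Finset.sum_congr rfl fun i _ => partExpo_add lam i

theorem degree_expo (L : MPartition m) : (expo L).degree = L.size := by
  rw [expo, map_add, degree_compExpo, degree_partExpo, MPartition.size]

theorem expo_apply (L : MPartition m) (i : Fin m) : expo L i = L.comp i := by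
  rw [expo, Finsupp.add_apply, compExpo_apply, partExpo_of_lt _ i.2, add_zero]

theorem expo_add (L : MPartition m) (i : ℕ) : expo L (m + i) = L.part.rowLen i := by
  rw [expo, Finsupp.add_apply, compExpo_of_le _ (by omega), partExpo_add, zero_add]

/-- Every exponent which is weakly decreasing from index `m` on is that of an `m`-partition. -/
theorem exists_expo_eq (n : ℕ →₀ ℕ) (hn : ∀ i, m ≤ i → n (i + 1) ≤ n i) :
    ∃ L : MPartition m, expo L = n := by
  obtain ⟨N, hN⟩ := n.support.exists_nat_subset_range
  obtain ⟨lam, hlam⟩ := exists_rowLen_eq (g := fun i => n (m + i))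
    (antitone_nat_of_succ_le fun i => hn (m + i) (by omega)) (N := N) fun i hi => by
      by_contra hc
      have := Finset.mem_range.1 (hN (Finsupp.mem_support_iff.2 hc))
      omega
  refine ⟨⟨fun i => n i, lam⟩, Finsupp.ext fun j => ?_⟩
  rcases lt_or_ge j m with hj | hj
  · exact expo_apply ⟨fun i => n i, lam⟩ ⟨j, hj⟩
  · obtain ⟨k, rfl⟩ := Nat.exists_eq_add_of_le hj
    rw [expo_add]
    exact hlam k

end Exponents

section Coordinates

variable {F : Type u} [Field F] {m : ℕ}

theorem coeff_embDomain_of_mem (f : R F m) (s : Equiv.Perm ℕ) (hs : ∀ i < m, s i = i)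
    (n : ℕ →₀ ℕ) :
    MvPowerSeries.coeff (n.embDomain s.toEmbedding) (f : MvPowerSeries ℕ F)
      = MvPowerSeries.coeff n (f : MvPowerSeries ℕ F) := by
  conv_lhs => rw [← f.2.2 s hs]
  exact coeff_renameEquiv F s f n

theorem finsupp_sum_mul_eq (n : ℕ →₀ ℕ) {N : ℕ} (hN : n.support ⊆ Finset.range N) :
    n.sum (fun i k => i * k) = ∑ i : Fin N, (i : ℕ) * n i := by
  rw [Fin.sum_univ_eq_sum_range fun i => i * n i, Finsupp.sum_of_support_subset n hN]
  intro i _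
  exact mul_zero i

/-- An element of `R_m` is determined by its coefficients at the exponents of `m`-partitions: among
the monomials that occur, one that minimizes `∑ j n_j` is weakly decreasing from index `m` on. -/
theorem exists_coeff_expo_ne_zero {f : R F m} (hf : f ≠ 0) :
    ∃ L : MPartition m, MvPowerSeries.coeff (expo L) (f : MvPowerSeries ℕ F) ≠ 0 := by
  classical
  have hex : ∃ w, ∃ n : ℕ →₀ ℕ, n.sum (fun i k => i * k) = w ∧
      MvPowerSeries.coeff n (f : MvPowerSeries ℕ F) ≠ 0 := by
    by_contra! hc
    exact hf (Subtype.ext (MvPowerSeries.ext fun n => by simpa using hc _ n rfl))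
  obtain ⟨n, hw, hn⟩ := Nat.find_spec hex
  have hmin := fun w => Nat.find_min hex (m := w)
  suffices h : ∀ i, m ≤ i → n (i + 1) ≤ n i by
    obtain ⟨L, hL⟩ := exists_expo_eq n h
    exact ⟨L, by rwa [hL]⟩
  intro i hi
  by_contra! hlt
  set s : Equiv.Perm ℕ := Equiv.swap i (i + 1) with hs
  have hn' : MvPowerSeries.coeff (n.embDomain s.toEmbedding) (f : MvPowerSeries ℕ F) ≠ 0 := by
    rwa [coeff_embDomain_of_mem f s fun j hj =>
      Equiv.swap_apply_of_ne_of_ne (by omega) (by omega)]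
  have happ : ∀ j, (n.embDomain s.toEmbedding) j = n (s j) := by
    intro j
    have h1 : j = s.toEmbedding (s j) := by simp [hs]
    conv_lhs => rw [h1]
    rw [Finsupp.embDomain_apply_self]
  obtain ⟨N₁, hN₁⟩ := n.support.exists_nat_subset_range
  set N := N₁ + i + 2 with hN
  have hsup : n.support ⊆ Finset.range N := hN₁.trans (by simpa using by omega)
  have hsup' : (n.embDomain s.toEmbedding).support ⊆ Finset.range N := by
    intro j hj
    rw [Finsupp.mem_support_iff, happ] at hj
    have h1 := Finset.mem_range.1 (hN₁ (Finsupp.mem_support_iff.2 hj))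
    rw [Finset.mem_range]
    by_contra hc
    rw [hs, Equiv.swap_apply_of_ne_of_ne (by omega) (by omega)] at h1
    omega
  refine hmin _ ?_ ⟨_, rfl, hn'⟩
  rw [← hw, finsupp_sum_mul_eq _ hsup', finsupp_sum_mul_eq _ hsup]
  have hiN : i + 1 < N := by omega
  have key := swapComp_weight_lt (fun j : Fin N => n j) i hiN hlt
  convert key using 3 with j
  rw [happ, swapComp]
  congr 1
  by_cases h1 : (j : ℕ) = i
  · have : j = ⟨i, by omega⟩ := Fin.ext h1
    rw [this]
    simp [hs]
  · by_cases h2 : (j : ℕ) = i + 1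
    · have : j = ⟨i + 1, hiN⟩ := Fin.ext h2
      rw [this]
      simp [hs]
    · rw [hs, Equiv.swap_apply_of_ne_of_ne h1 h2, Equiv.swap_apply_of_ne_of_ne
        (fun h => h1 (congrArg Fin.val h)) (fun h => h2 (congrArg Fin.val h))]

theorem finite_coeff_expo (f : R F m) :
    (Function.support fun L : MPartition m =>
      MvPowerSeries.coeff (expo L) (f : MvPowerSeries ℕ F)).Finite := by
  obtain ⟨d, hd⟩ := f.2.1
  refine (finite_size_le m d).subset fun L hL => ?_
  have := hd _ hL
  rwa [degree_expo] at this

variable (F m) in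
/-- The coordinates of an element of `R_m`: its coefficients at the exponents of `m`-partitions. -/
noncomputable def coords : R F m →ₗ[F] (MPartition m →₀ F) where
  toFun f := Finsupp.ofSupportFinite _ (finite_coeff_expo f)
  map_add' f g := by
    ext L
    simp [Finsupp.ofSupportFinite_coe]
  map_smul' c f := by
    ext L
    simp [Finsupp.ofSupportFinite_coe]

theorem coords_apply (f : R F m) (L : MPartition m) :
    coords F m f L = MvPowerSeries.coeff (expo L) (f : MvPowerSeries ℕ F) := rfl

theorem coords_injective : Function.Injective (coords F m) := by
  rw [injective_iff_map_eq_zero]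
  intro f hf
  by_contra hne
  obtain ⟨L, hL⟩ := exists_coeff_expo_ne_zero hne
  apply hL
  rw [← coords_apply, hf, Finsupp.zero_apply]

theorem coe_hInt (r : ℤ) : ((hInt F m r : R F m) : MvPowerSeries ℕ F) = hVar F 0 r := by
  classical
  rw [hInt]
  split_ifs with h
  · ext n
    rw [hFun, coeff_hSeries, coeff_hVar]
    refine if_congr ?_ rfl rfl
    simp only [not_lt_zero, IsEmpty.forall_iff, implies_true, true_and]
    omega
  · rw [hVar_of_neg 0 (by omega)]
    rfl

theorem coe_schur (lam : YoungDiagram) :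
    ((schur F m lam : R F m) : MvPowerSeries ℕ F)
      = (jtMatrix F 0 (lam.colLen 0) fun i => (lam.rowLen i : ℤ)).det := by
  have h := AlgHom.map_det (R F m).val (Matrix.of fun i j : Fin (lam.colLen 0) =>
    hInt F m ((lam.rowLen i : ℤ) - (i : ℤ) + (j : ℤ)))
  refine Eq.trans h ?_
  congr 1
  refine Matrix.ext fun i j => ?_
  exact coe_hInt (F := F) (m := m) ((lam.rowLen i : ℤ) - (i : ℤ) + (j : ℤ))

theorem coe_xPow (a : Fin m → ℕ) :
    ((xPow F a : R F m) : MvPowerSeries ℕ F) = MvPowerSeries.monomial (compExpo a) 1 := by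
  have h : ((xPow F a : R F m) : MvPowerSeries ℕ F)
      = ∏ i : Fin m, MvPowerSeries.X (i : ℕ) ^ a i := by
    have h1 := map_prod (R F m).val (fun i : Fin m => xVar F i ^ a i) Finset.univ
    refine h1.trans (Finset.prod_congr rfl fun i _ => ?_)
    exact map_pow (R F m).val (xVar F i) (a i)
  rw [h, compExpo]
  refine Finset.induction_on (Finset.univ : Finset (Fin m)) ?_ fun i s hi ih => ?_
  · simp
  · rw [Finset.prod_insert hi, Finset.sum_insert hi, ih, MvPowerSeries.X_pow_eq,
      MvPowerSeries.monomial_mul_monomial, one_mul]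

theorem coeff_schur_partExpo_self (lam : YoungDiagram) :
    MvPowerSeries.coeff (partExpo m lam) ((schur F m lam : R F m) : MvPowerSeries ℕ F) = 1 := by
  have h : ∀ i < m, partExpo m lam i = 0 := fun i hi => partExpo_of_lt lam hi
  rw [coe_schur, coeff_det_jtMatrix_zero_of_forall m _ _ h]
  exact coeff_det_jtMatrix_eq_one _ m (fun i j hij => lam.rowLen_anti i j hij)
    (fun i hi => rowLen_eq_zero_of_le lam hi) h (partExpo_add lam)

theorem toLex_le_of_coeff_schur_ne_zero {lam mu : YoungDiagram}
    (h : MvPowerSeries.coeff (partExpo m mu) ((schur F m lam : R F m) : MvPowerSeries ℕ F) ≠ 0) :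
    mu = lam ∨ toLex mu.rowLen < toLex lam.rowLen := by
  have h0 : ∀ i < m, partExpo m mu i = 0 := fun i hi => partExpo_of_lt mu hi
  rw [coe_schur, coeff_det_jtMatrix_zero_of_forall m _ _ h0] at h
  have := lex_of_coeff_det_jtMatrix_ne_zero _ m (fun i j hij => lam.rowLen_anti i j hij)
    (fun i hi => rowLen_eq_zero_of_le lam hi) h0 h
  simp only [partExpo_add] at this
  rcases this with h1 | h1
  · exact Or.inl (eq_of_rowLen_eq h1)
  · exact Or.inr h1

theorem degree_eq_of_coeff_schur_ne_zero {lam : YoungDiagram} {e : ℕ →₀ ℕ}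
    (h : MvPowerSeries.coeff e ((schur F m lam : R F m) : MvPowerSeries ℕ F) ≠ 0) :
    e.degree = lam.card := by
  rw [coe_schur] at h
  have := degree_eq_of_coeff_det_jtMatrix_ne_zero _ _ _ h
  rw [Fin.sum_univ_eq_sum_range fun i => (lam.rowLen i : ℤ), ← Nat.cast_sum,
    sum_rowLen lam le_rfl] at this
  exact_mod_cast this

/-- The order with respect to which `x^a s_lam` has leading monomial `x^(a, lam)`: among
`m`-partitions of the same size, compare `|lam|` and then `lam` lexicographically. -/
def LexLT (O L : MPartition m) : Prop :=
  O.size = L.size ∧ toLex (O.part.card, toLex O.part.rowLen) < toLex (L.part.card, toLex L.part.rowLen)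

theorem LexLT.trans {L₁ L₂ L₃ : MPartition m} (h : LexLT L₁ L₂) (h' : LexLT L₂ L₃) :
    LexLT L₁ L₃ := ⟨h.1.trans h'.1, h.2.trans h'.2⟩

theorem wellFounded_of_finite {ι : Type*} {lt : ι → ι → Prop}
    (htrans : ∀ i j l, lt i j → lt j l → lt i l) (hirr : ∀ i, ¬ lt i i)
    (hfin : ∀ i, {j | lt j i}.Finite) : WellFounded lt := by
  refine Subrelation.wf (r := InvImage (· < ·) fun i => {j | lt j i}.ncard) ?_
    (InvImage.wf _ wellFounded_lt)
  intro i j hij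
  refine Set.ncard_lt_ncard ?_ (hfin j)
  refine (Set.ssubset_iff_of_subset fun l hl => htrans _ _ _ hl hij).2 ⟨i, hij, hirr i⟩

theorem wellFounded_lexLT : WellFounded (LexLT (m := m)) :=
  wellFounded_of_finite (fun _ _ _ h h' => h.trans h') (fun _ h => lt_irrefl _ h.2)
    fun L => (finite_size_le m L.size).subset fun _ hO => hO.1.le

theorem coeff_expo_kOne_self (L : MPartition m) : coords F m (kOne F L) L = 1 := by
  classical
  rw [coords_apply, kOne, MulMemClass.coe_mul, coe_xPow, MvPowerSeries.coeff_monomial_mul, expo,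
    if_pos le_self_add, add_tsub_cancel_left, coeff_schur_partExpo_self, mul_one]

theorem lexLT_of_coeff_expo_kOne_ne_zero {L O : MPartition m} (h : coords F m (kOne F L) O ≠ 0) :
    O = L ∨ LexLT O L := by
  classical
  rw [coords_apply, kOne, MulMemClass.coe_mul, coe_xPow, MvPowerSeries.coeff_monomial_mul] at h
  have hle : compExpo L.comp ≤ expo O := by
    by_contra hc
    exact h (if_neg hc)
  rw [if_pos hle, one_mul] at h
  have hdeg := degree_eq_of_coeff_schur_ne_zero h
  have hsize : O.size = L.size := by
    have h1 := congrArg Finsupp.degree (tsub_add_cancel_of_le hle)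
    rw [map_add, hdeg, degree_compExpo, degree_expo] at h1
    rw [← h1, MPartition.size, add_comm]
  have hcomp : ∀ i, L.comp i ≤ O.comp i := fun i => by
    have := hle i
    rwa [compExpo_apply, expo_apply] at this
  by_cases hab : L.comp = O.comp
  · rw [expo, hab, add_tsub_cancel_left] at h
    rcases toLex_le_of_coeff_schur_ne_zero h with h1 | h1
    · left
      ext1
      · exact hab.symm
      · exact h1
    · refine Or.inr ⟨hsize, Prod.Lex.lt_iff.2 (Or.inr ⟨?_, h1⟩)⟩
      simp only [MPartition.size, hab] at hsize
      simpa using hsize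
  · refine Or.inr ⟨hsize, Prod.Lex.lt_iff.2 (Or.inl ?_)⟩
    obtain ⟨i, hi⟩ := Function.ne_iff.1 hab
    have := Finset.sum_lt_sum (fun i _ => hcomp i)
      ⟨i, Finset.mem_univ i, lt_of_le_of_ne (hcomp i) hi⟩
    simp only [MPartition.size] at hsize
    simp only [ofLex_toLex]
    omega

/-- The functions `x^a s_lam` form a basis of `R_m`. -/
theorem exists_basis_kOne :
    ∃ b : Module.Basis (MPartition m) F (R F m), ∀ L, b L = kOne F L := by
  obtain ⟨b, hb, -⟩ := exists_basis_of_triangular (wellFounded_lexLT (m := m))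
    (fun _ _ _ h h' => h.trans h') (Finsupp.basisSingleOne (R := F) (ι := MPartition m))
    (fun L => coords F m (kOne F L)) (fun L O h => lexLT_of_coeff_expo_kOne_ne_zero h)
    (fun L => by
      have := coeff_expo_kOne_self (F := F) L
      simp [this])
  have hsurj : Function.Surjective (coords F m) := by
    rw [← LinearMap.range_eq_top, eq_top_iff, ← b.span_eq, Submodule.span_le]
    rintro _ ⟨L, rfl⟩
    exact ⟨kOne F L, (hb L).symm⟩
  refine ⟨b.map (LinearEquiv.ofBijective _ ⟨coords_injective, hsurj⟩).symm, fun L => ?_⟩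
  rw [Module.Basis.map_apply, LinearEquiv.symm_apply_eq, hb]
  rfl

end Coordinates

/-! ### The Hecke operators -/

section Hecke

variable {F : Type u} [Field F] {m : ℕ}

theorem exists_embDomain_eq (s : Equiv.Perm ℕ) (n : ℕ →₀ ℕ) :
    ∃ k : ℕ →₀ ℕ, k.embDomain s.toEmbedding = n := by
  refine ⟨n.embDomain s.symm.toEmbedding, Finsupp.ext fun j => ?_⟩
  have h1 : j = s.toEmbedding (s.symm j) := by simp
  conv_lhs => rw [h1]
  rw [Finsupp.embDomain_apply_self]
  have h2 : s.symm j = s.symm.toEmbedding j := rfl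
  rw [h2, Finsupp.embDomain_apply_self]

theorem renameEquiv_renameEquiv (u v : Equiv.Perm ℕ) (g : MvPowerSeries ℕ F) :
    MvPowerSeries.renameEquiv F v (MvPowerSeries.renameEquiv F u g)
      = MvPowerSeries.renameEquiv F (u.trans v) g := by
  rw [← MvPowerSeries.renameEquiv_trans]
  rfl

theorem renameEquiv_mem (s : Equiv.Perm ℕ) (hs : ∀ i, m ≤ i → s i = i) (f : R F m) :
    MvPowerSeries.renameEquiv F s (f : MvPowerSeries ℕ F) ∈ R F m := by
  refine ⟨?_, fun s' hs' => ?_⟩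
  · obtain ⟨d, hd⟩ := f.2.1
    refine ⟨d, fun n hn => ?_⟩
    obtain ⟨k, rfl⟩ := exists_embDomain_eq s n
    rw [coeff_renameEquiv] at hn
    rw [Finsupp.embDomain_eq_mapDomain, Finsupp.degree_mapDomain]
    exact hd k hn
  · have hcomm : s.trans s' = s'.trans s := by
      ext j
      simp only [Equiv.trans_apply]
      rcases lt_or_ge j m with hj | hj
      · have h1 : s j < m := by
          by_contra hc
          have h2 := s.injective (hs (s j) (by omega))
          omega
        rw [hs' j hj, hs' _ h1]
      · have h1 : m ≤ s' j := by
          by_contra hc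
          have h2 := s'.injective (hs' (s' j) (by omega))
          omega
        rw [hs j hj, hs _ h1]
    rw [renameEquiv_renameEquiv, hcomm, ← renameEquiv_renameEquiv, f.2.2 s' hs']

/-- The operator `K_{i,i+1}` on `R_m`, which exchanges `x_i` and `x_{i+1}`. -/
noncomputable def swapVar (i : ℕ) (h : i + 1 < m) : R F m →ₐ[F] R F m :=
  ((MvPowerSeries.renameEquiv F (Equiv.swap i (i + 1))).toAlgHom.comp (R F m).val).codRestrict
    (R F m) fun f => renameEquiv_mem _
      (fun j hj => Equiv.swap_apply_of_ne_of_ne (by omega) (by omega)) f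

theorem coe_swapVar (i : ℕ) (h : i + 1 < m) (f : R F m) :
    ((swapVar i h f : R F m) : MvPowerSeries ℕ F)
      = MvPowerSeries.renameEquiv F (Equiv.swap i (i + 1)) (f : MvPowerSeries ℕ F) := rfl

theorem swapVar_xVar (i : ℕ) (h : i + 1 < m) (j : Fin m) :
    swapVar i h (xVar F j)
      = xVar F (Equiv.swap ⟨i, Nat.lt_of_succ_lt h⟩ ⟨i + 1, h⟩ j) := by
  refine Subtype.ext ((MvPowerSeries.rename_X _ _).trans ?_)
  rw [xVar]
  congr 1
  by_cases h1 : (j : ℕ) = i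
  · have h2 : j = ⟨i, Nat.lt_of_succ_lt h⟩ := Fin.ext h1
    rw [h2]
    simp
  · by_cases h2 : (j : ℕ) = i + 1
    · have h3 : j = ⟨i + 1, h⟩ := Fin.ext h2
      rw [h3]
      simp
    · rw [Equiv.swap_apply_of_ne_of_ne h1 h2, Equiv.swap_apply_of_ne_of_ne
        (fun h => h1 (congrArg Fin.val h)) (fun h => h2 (congrArg Fin.val h))]

theorem renameEquiv_hVar (s : Equiv.Perm ℕ) (r : ℤ) :
    MvPowerSeries.renameEquiv F s (hVar F 0 r) = hVar F 0 r := by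
  classical
  ext n
  obtain ⟨k, rfl⟩ := exists_embDomain_eq s n
  rw [coeff_renameEquiv, coeff_hVar, coeff_hVar, Finsupp.embDomain_eq_mapDomain,
    Finsupp.degree_mapDomain]
  simp

theorem swapVar_schur (i : ℕ) (h : i + 1 < m) (lam : YoungDiagram) :
    swapVar i h (schur F m lam) = schur F m lam := by
  refine (AlgHom.map_det (swapVar (F := F) i h) _).trans ?_
  rw [schur]
  congr 1
  refine Matrix.ext fun a c => Subtype.ext ?_
  have h1 : ∀ r : ℤ, ((swapVar i h (hInt F m r) : R F m) : MvPowerSeries ℕ F)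
      = ((hInt F m r : R F m) : MvPowerSeries ℕ F) := fun r => by
    rw [coe_swapVar, coe_hInt, renameEquiv_hVar]
  exact h1 _

theorem swapVar_comp_of_eq {i j k l : ℕ} (hi : i + 1 < m) (hj : j + 1 < m) (hk : k + 1 < m)
    (hl : l + 1 < m)
    (h : ∀ n, Equiv.swap i (i + 1) (Equiv.swap j (j + 1) n)
      = Equiv.swap k (k + 1) (Equiv.swap l (l + 1) n)) (f : R F m) :
    swapVar i hi (swapVar j hj f) = swapVar k hk (swapVar l hl f) := by
  refine Subtype.ext ?_
  rw [coe_swapVar, coe_swapVar, coe_swapVar, coe_swapVar,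
    renameEquiv_renameEquiv, renameEquiv_renameEquiv]
  congr 1
  congr 1
  exact Equiv.ext h

theorem swapVar_swapVar (i : ℕ) (h : i + 1 < m) (f : R F m) :
    swapVar i h (swapVar i h f) = f := by
  refine Subtype.ext ?_
  have h1 := AlgEquiv.symm_apply_apply (MvPowerSeries.renameEquiv F (Equiv.swap i (i + 1)))
    (f : MvPowerSeries ℕ F)
  rwa [MvPowerSeries.renameEquiv_symm, Equiv.symm_swap] at h1

theorem swapVar_comm {i j : ℕ} (hi : i + 1 < m) (hj : j + 1 < m) (hij : i + 1 < j) (f : R F m) :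
    swapVar i hi (swapVar j hj f) = swapVar j hj (swapVar i hi f) := by
  refine swapVar_comp_of_eq hi hj hj hi (fun n => ?_) f
  simp only [Equiv.swap_apply_def]
  split_ifs <;> omega

theorem swapVar_braid {i : ℕ} (h : i + 1 < m) (h' : i + 1 + 1 < m) (f : R F m) :
    swapVar i h (swapVar (i + 1) h' (swapVar i h f))
      = swapVar (i + 1) h' (swapVar i h (swapVar (i + 1) h' f)) := by
  refine Subtype.ext ?_
  simp only [coe_swapVar, renameEquiv_renameEquiv]
  congr 1
  congr 1
  ext n
  simp only [Equiv.trans_apply, Equiv.swap_apply_def]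
  split_ifs <;> omega

theorem xVar_sub_dvd (i : ℕ) (h : i + 1 < m) (f : R F m) :
    xVar F ⟨i, Nat.lt_of_succ_lt h⟩ - xVar F ⟨i + 1, h⟩ ∣ swapVar i h f - f := by
  set d := xVar F ⟨i, Nat.lt_of_succ_lt h⟩ - xVar F ⟨i + 1, h⟩ with hd
  let S : Subalgebra F (R F m) :=
    { carrier := {f | d ∣ swapVar i h f - f}
      mul_mem' := by
        intro f g hf hg
        have : swapVar i h (f * g) - f * g
            = swapVar i h f * (swapVar i h g - g) + g * (swapVar i h f - f) := by
          rw [map_mul]; ring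
        rw [Set.mem_ofPred_eq, this]
        exact dvd_add (Dvd.dvd.mul_left hg _) (Dvd.dvd.mul_left hf _)
      add_mem' := by
        intro f g hf hg
        have : swapVar i h (f + g) - (f + g) = (swapVar i h f - f) + (swapVar i h g - g) := by
          rw [map_add]; ring
        rw [Set.mem_ofPred_eq, this]
        exact dvd_add hf hg
      algebraMap_mem' := by
        intro r
        rw [Set.mem_ofPred_eq, AlgHom.commutes, sub_self]
        exact dvd_zero _ }
  have hx : ∀ j, xVar F j ∈ S := by
    intro j
    change d ∣ swapVar i h (xVar F j) - xVar F j
    rw [swapVar_xVar]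
    by_cases h1 : j = ⟨i, Nat.lt_of_succ_lt h⟩
    · rw [h1, Equiv.swap_apply_left]
      exact ⟨-1, by rw [hd]; ring⟩
    · by_cases h2 : j = ⟨i + 1, h⟩
      · rw [h2, Equiv.swap_apply_right]
      · rw [Equiv.swap_apply_of_ne_of_ne h1 h2, sub_self]
        exact dvd_zero _
  have hk : ∀ L : MPartition m, kOne F L ∈ S := fun L =>
    S.mul_mem (S.prod_mem fun j _ => S.pow_mem (hx j) _) (by
      change d ∣ swapVar i h (schur F m L.part) - schur F m L.part
      rw [swapVar_schur, sub_self]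
      exact dvd_zero _)
  obtain ⟨b, hb⟩ := exists_basis_kOne (F := F) (m := m)
  have htop : (⊤ : Submodule F (R F m)) ≤ Subalgebra.toSubmodule S := by
    rw [← b.span_eq, Submodule.span_le]
    rintro _ ⟨L, rfl⟩
    rw [hb]
    exact hk L
  exact htop (Submodule.mem_top (x := f))

theorem divDiff_spec (i : ℕ) (h : i + 1 < m) (f : R F m) :
    (xVar F ⟨i, Nat.lt_of_succ_lt h⟩ - xVar F ⟨i + 1, h⟩) * divDiff i h f = swapVar i h f - f := by
  have H : ∃ g : R F m,
      (((xVar F ⟨i, Nat.lt_of_succ_lt h⟩ - xVar F ⟨i + 1, h⟩) * g : R F m) : MvPowerSeries ℕ F)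
        = MvPowerSeries.renameEquiv F (Equiv.swap i (i + 1)) (f : MvPowerSeries ℕ F) - f := by
    obtain ⟨g, hg⟩ := xVar_sub_dvd i h f
    exact ⟨g, by rw [← hg]; rfl⟩
  rw [divDiff, dif_pos H]
  exact Subtype.ext H.choose_spec

theorem xVar_sub_ne_zero {i j : Fin m} (hij : i ≠ j) : xVar F i - xVar F j ≠ 0 := by
  intro hc
  have h1 : (MvPowerSeries.X (i : ℕ) : MvPowerSeries ℕ F) = MvPowerSeries.X (j : ℕ) :=
    congrArg Subtype.val (sub_eq_zero.1 hc)
  exact hij (Fin.ext (MvPowerSeries.X_inj.1 h1))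

theorem hecke_spec (t : Fˣ) (i : ℕ) (h : i + 1 < m) (f : R F m) :
    (xVar F ⟨i, Nat.lt_of_succ_lt h⟩ - xVar F ⟨i + 1, h⟩) * hecke t i h f
      = (1 - algebraMap F (R F m) t) * xVar F ⟨i + 1, h⟩ * f
        + (algebraMap F (R F m) t * xVar F ⟨i, Nat.lt_of_succ_lt h⟩ - xVar F ⟨i + 1, h⟩)
          * swapVar i h f := by
  rw [hecke, Algebra.smul_def, Algebra.smul_def]
  linear_combination (algebraMap F (R F m) t * xVar F ⟨i, Nat.lt_of_succ_lt h⟩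
    - xVar F ⟨i + 1, h⟩) * divDiff_spec i h f

theorem hecke_eq_of (t : Fˣ) (i : ℕ) (h : i + 1 < m) {f g : R F m}
    (hg : (xVar F ⟨i, Nat.lt_of_succ_lt h⟩ - xVar F ⟨i + 1, h⟩) * g
      = (1 - algebraMap F (R F m) t) * xVar F ⟨i + 1, h⟩ * f
        + (algebraMap F (R F m) t * xVar F ⟨i, Nat.lt_of_succ_lt h⟩ - xVar F ⟨i + 1, h⟩)
          * swapVar i h f) : hecke t i h f = g := by
  have hne : xVar F ⟨i, Nat.lt_of_succ_lt h⟩ - xVar F ⟨i + 1, h⟩ ≠ 0 :=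
    xVar_sub_ne_zero fun hc => by simpa using congrArg Fin.val hc
  have h1 := (hecke_spec t i h f).trans hg.symm
  rw [← sub_eq_zero, ← mul_sub] at h1
  exact sub_eq_zero.1 ((mul_eq_zero.1 h1).resolve_left hne)

/-- The Hecke operator `T_i` as a linear map. -/
noncomputable def heckeLin (t : Fˣ) (i : ℕ) (h : i + 1 < m) : R F m →ₗ[F] R F m where
  toFun := hecke t i h
  map_add' f g := by
    refine hecke_eq_of t i h ?_
    rw [map_add]
    linear_combination hecke_spec t i h f + hecke_spec t i h g
  map_smul' c f := by
    refine hecke_eq_of t i h ?_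
    rw [map_smul, RingHom.id_apply, Algebra.smul_def, Algebra.smul_def, Algebra.smul_def]
    linear_combination algebraMap F (R F m) c * hecke_spec t i h f

theorem heckeLin_apply (t : Fˣ) (i : ℕ) (h : i + 1 < m) (f : R F m) :
    heckeLin t i h f = hecke t i h f := rfl

theorem hecke_mul_of_swapVar_eq (t : Fˣ) (i : ℕ) (h : i + 1 < m) (f : R F m) {g : R F m}
    (hg : swapVar i h g = g) : hecke t i h (f * g) = hecke t i h f * g := by
  refine hecke_eq_of t i h ?_
  rw [map_mul, hg]
  linear_combination g * hecke_spec t i h f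

theorem hecke_of_swapVar_eq (t : Fˣ) (i : ℕ) (h : i + 1 < m) {f : R F m}
    (hf : swapVar i h f = f) : hecke t i h f = (t : F) • f := by
  refine hecke_eq_of t i h ?_
  rw [hf, Algebra.smul_def]
  ring

theorem hecke_one (i : ℕ) (h : i + 1 < m) (f : R F m) :
    hecke (1 : Fˣ) i h f = swapVar i h f := by
  refine hecke_eq_of 1 i h ?_
  simp

theorem hecke_xVar_mul (t : Fˣ) (i : ℕ) (h : i + 1 < m) (f : R F m) :
    hecke t i h (xVar F ⟨i, Nat.lt_of_succ_lt h⟩ * f)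
      = xVar F ⟨i + 1, h⟩ * hecke t i h f
        + (1 - algebraMap F (R F m) t) * (xVar F ⟨i + 1, h⟩ * f) := by
  refine hecke_eq_of t i h ?_
  rw [map_mul, swapVar_xVar, Equiv.swap_apply_left]
  linear_combination xVar F ⟨i + 1, h⟩ * hecke_spec t i h f

theorem hecke_xVar_succ_mul (t : Fˣ) (i : ℕ) (h : i + 1 < m) (f : R F m) :
    hecke t i h (xVar F ⟨i + 1, h⟩ * f)
      = xVar F ⟨i, Nat.lt_of_succ_lt h⟩ * hecke t i h f
        - (1 - algebraMap F (R F m) t) * (xVar F ⟨i + 1, h⟩ * f) := by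
  refine hecke_eq_of t i h ?_
  rw [map_mul, swapVar_xVar, Equiv.swap_apply_right]
  linear_combination xVar F ⟨i, Nat.lt_of_succ_lt h⟩ * hecke_spec t i h f

/-- The quadratic relation `(T_i - t)(T_i + 1) = 0`. -/
theorem hecke_hecke (t : Fˣ) (i : ℕ) (h : i + 1 < m) (f : R F m) :
    hecke t i h (hecke t i h f) = ((t : F) - 1) • hecke t i h f + (t : F) • f := by
  refine hecke_eq_of t i h ?_
  have hne : xVar F ⟨i, Nat.lt_of_succ_lt h⟩ - xVar F ⟨i + 1, h⟩ ≠ 0 :=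
    xVar_sub_ne_zero fun hc => by simpa using congrArg Fin.val hc
  have e1 := hecke_spec t i h f
  have e2 := congrArg (swapVar i h) e1
  simp only [map_mul, map_add, map_sub, map_one, AlgHom.commutes, swapVar_xVar,
    Equiv.swap_apply_left, Equiv.swap_apply_right, swapVar_swapVar] at e2
  rw [Algebra.smul_def, Algebra.smul_def, map_sub, map_one]
  set x := xVar F ⟨i, Nat.lt_of_succ_lt h⟩
  set y := xVar F ⟨i + 1, h⟩
  set τ := algebraMap F (R F m) t
  refine sub_eq_zero.1 ((mul_eq_zero.1 (?_ : (x - y) * _ = 0)).resolve_left hne)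
  linear_combination ((τ - 1) * (x - y) - (1 - τ) * y) * e1 + (τ * x - y) * e2

theorem hecke_comm (t : Fˣ) {i j : ℕ} (hi : i + 1 < m) (hj : j + 1 < m) (hij : i + 1 < j)
    (f : R F m) : hecke t i hi (hecke t j hj f) = hecke t j hj (hecke t i hi f) := by
  have hne : xVar F ⟨i, Nat.lt_of_succ_lt hi⟩ - xVar F ⟨i + 1, hi⟩ ≠ 0 :=
    xVar_sub_ne_zero fun hc => by simpa using congrArg Fin.val hc
  have hne' : xVar F ⟨j, Nat.lt_of_succ_lt hj⟩ - xVar F ⟨j + 1, hj⟩ ≠ 0 :=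
    xVar_sub_ne_zero fun hc => by simpa using congrArg Fin.val hc
  have x1 : swapVar j hj (xVar F ⟨i, Nat.lt_of_succ_lt hi⟩) = xVar F ⟨i, Nat.lt_of_succ_lt hi⟩ := by
    rw [swapVar_xVar, Equiv.swap_apply_of_ne_of_ne] <;> simp [Fin.ext_iff] <;> omega
  have x2 : swapVar j hj (xVar F ⟨i + 1, hi⟩) = xVar F ⟨i + 1, hi⟩ := by
    rw [swapVar_xVar, Equiv.swap_apply_of_ne_of_ne] <;> simp [Fin.ext_iff] <;> omega
  have x3 : swapVar i hi (xVar F ⟨j, Nat.lt_of_succ_lt hj⟩) = xVar F ⟨j, Nat.lt_of_succ_lt hj⟩ := by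
    rw [swapVar_xVar, Equiv.swap_apply_of_ne_of_ne] <;> simp [Fin.ext_iff] <;> omega
  have x4 : swapVar i hi (xVar F ⟨j + 1, hj⟩) = xVar F ⟨j + 1, hj⟩ := by
    rw [swapVar_xVar, Equiv.swap_apply_of_ne_of_ne] <;> simp [Fin.ext_iff] <;> omega
  have a1 := hecke_spec t i hi f
  have a2 := congrArg (swapVar j hj) a1
  have a3 := hecke_spec t j hj (hecke t i hi f)
  have b1 := hecke_spec t j hj f
  have b2 := congrArg (swapVar i hi) b1
  have b3 := hecke_spec t i hi (hecke t j hj f)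
  simp only [map_mul, map_add, map_sub, map_one, AlgHom.commutes, x1, x2, x3, x4] at a2 b2
  rw [swapVar_comm hi hj hij] at b2
  set x := xVar F ⟨i, Nat.lt_of_succ_lt hi⟩
  set y := xVar F ⟨i + 1, hi⟩
  set z := xVar F ⟨j, Nat.lt_of_succ_lt hj⟩
  set w := xVar F ⟨j + 1, hj⟩
  set τ := algebraMap F (R F m) t
  refine sub_eq_zero.1 ((mul_eq_zero.1 (?_ : ((x - y) * (z - w)) * _ = 0)).resolve_left
    (mul_ne_zero hne hne'))
  linear_combination (z - w) * b3 + (1 - τ) * y * b1 + (τ * x - y) * b2 - (x - y) * a3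
    - (1 - τ) * w * a1 - (τ * z - w) * a2

/-- The braid relation. Each Hecke operator is written as a combination of `1` and `K` with rational
coefficients, so that both sides are combinations of the six permutations of `f`. -/
theorem hecke_braid (t : Fˣ) {i : ℕ} (h : i + 1 < m) (h' : i + 1 + 1 < m) (f : R F m) :
    hecke t i h (hecke t (i + 1) h' (hecke t i h f))
      = hecke t (i + 1) h' (hecke t i h (hecke t (i + 1) h' f)) := by
  have hxy : xVar F ⟨i, Nat.lt_of_succ_lt h⟩ - xVar F ⟨i + 1, h⟩ ≠ 0 :=
    xVar_sub_ne_zero fun hc => by simpa using congrArg Fin.val hc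
  have hyz : xVar F ⟨i + 1, h⟩ - xVar F ⟨i + 1 + 1, h'⟩ ≠ 0 :=
    xVar_sub_ne_zero fun hc => by simpa using congrArg Fin.val hc
  have hxz : xVar F ⟨i, Nat.lt_of_succ_lt h⟩ - xVar F ⟨i + 1 + 1, h'⟩ ≠ 0 :=
    xVar_sub_ne_zero fun hc => by
      have : i = i + 1 + 1 := congrArg Fin.val hc
      omega
  have i1 : swapVar i h (xVar F ⟨i, Nat.lt_of_succ_lt h⟩) = xVar F ⟨i + 1, h⟩ := by
    rw [swapVar_xVar, Equiv.swap_apply_left]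
  have i2 : swapVar i h (xVar F ⟨i + 1, h⟩) = xVar F ⟨i, Nat.lt_of_succ_lt h⟩ := by
    rw [swapVar_xVar, Equiv.swap_apply_right]
  have i3 : swapVar i h (xVar F ⟨i + 1 + 1, h'⟩) = xVar F ⟨i + 1 + 1, h'⟩ := by
    rw [swapVar_xVar, Equiv.swap_apply_of_ne_of_ne] <;> rw [Ne, Fin.ext_iff] <;> simp only <;> omega
  have j1 : swapVar (i + 1) h' (xVar F ⟨i, Nat.lt_of_succ_lt h⟩)
      = xVar F ⟨i, Nat.lt_of_succ_lt h⟩ := by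
    rw [swapVar_xVar, Equiv.swap_apply_of_ne_of_ne] <;> rw [Ne, Fin.ext_iff] <;> simp only <;> omega
  have j2 : swapVar (i + 1) h' (xVar F ⟨i + 1, h⟩) = xVar F ⟨i + 1 + 1, h'⟩ := by
    rw [swapVar_xVar, Equiv.swap_apply_left]
  have j3 : swapVar (i + 1) h' (xVar F ⟨i + 1 + 1, h'⟩) = xVar F ⟨i + 1, h⟩ := by
    rw [swapVar_xVar, Equiv.swap_apply_right]
  have a1 := hecke_spec t i h f
  have a2 := congrArg (swapVar (i + 1) h') a1
  have b := hecke_spec t (i + 1) h' (hecke t i h f)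
  have a3 := congrArg (swapVar i h) a1
  have a4 := congrArg (swapVar i h) a2
  have b2 := congrArg (swapVar i h) b
  have c := hecke_spec t i h (hecke t (i + 1) h' (hecke t i h f))
  have a1' := hecke_spec t (i + 1) h' f
  have a2' := congrArg (swapVar i h) a1'
  have b' := hecke_spec t i h (hecke t (i + 1) h' f)
  have a3' := congrArg (swapVar (i + 1) h') a1'
  have a4' := congrArg (swapVar (i + 1) h') a2'
  have b2' := congrArg (swapVar (i + 1) h') b'
  have c' := hecke_spec t (i + 1) h' (hecke t i h (hecke t (i + 1) h' f))
  simp only [map_mul, map_add, map_sub, map_one, AlgHom.commutes, i1, i2, i3, j1, j2, j3,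
    swapVar_swapVar] at a2 a3 a4 b2 a2' a3' a4' b2'
  rw [swapVar_braid] at a4
  set x := xVar F ⟨i, Nat.lt_of_succ_lt h⟩
  set y := xVar F ⟨i + 1, h⟩
  set z := xVar F ⟨i + 1 + 1, h'⟩
  set τ := algebraMap F (R F m) t
  generalize swapVar (i + 1) h' (swapVar i h (swapVar (i + 1) h' f)) = fw at *
  generalize swapVar (i + 1) h' (swapVar i h f) = fji at *
  generalize swapVar i h (swapVar (i + 1) h' f) = fij at *
  generalize swapVar i h f = fi at *
  generalize swapVar (i + 1) h' f = fj at *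
  refine sub_eq_zero.1 ((mul_eq_zero.1
    (?_ : ((x - y) * (y - z) * ((x - y) * (y - z) * (x - z))) * _ = 0)).resolve_left
    (mul_ne_zero (mul_ne_zero hxy hyz) (mul_ne_zero (mul_ne_zero hxy hyz) hxz)))
  linear_combination (y - z) * ((x - y) * (y - z) * (x - z) * c
      + (1 - τ) * y * (x - y) * (x - z) * b + (1 - τ) * y * (1 - τ) * z * (x - z) * a1
      + (1 - τ) * y * (τ * y - z) * (x - y) * a2 + (τ * x - y) * (x - y) * (y - z) * b2
      - (τ * x - y) * (1 - τ) * z * (y - z) * a3 + (τ * x - y) * (τ * x - z) * (x - y) * a4)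
    - (x - y) * ((x - y) * (y - z) * (x - z) * c'
      + (1 - τ) * z * (y - z) * (x - z) * b' + (1 - τ) * z * (1 - τ) * y * (x - z) * a1'
      + (1 - τ) * z * (τ * x - y) * (y - z) * a2' + (τ * y - z) * (x - y) * (y - z) * b2'
      - (τ * y - z) * (1 - τ) * z * (x - y) * a3' + (τ * y - z) * (τ * x - z) * (y - z) * a4')

end Hecke

/-! ### The basis `k_L(x;t)` -/

section HallLittlewood

variable {F : Type u} [Field F] {m : ℕ}

theorem swapComp_left (i : ℕ) (h : i + 1 < m) (a : Fin m → ℕ) :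
    swapComp i h a ⟨i, Nat.lt_of_succ_lt h⟩ = a ⟨i + 1, h⟩ := by
  simp [swapComp]

theorem swapComp_right (i : ℕ) (h : i + 1 < m) (a : Fin m → ℕ) :
    swapComp i h a ⟨i + 1, h⟩ = a ⟨i, Nat.lt_of_succ_lt h⟩ := by
  simp [swapComp]

theorem swapComp_of_ne (i : ℕ) (h : i + 1 < m) (a : Fin m → ℕ) {j : ℕ} (hj : j < m)
    (h1 : j ≠ i) (h2 : j ≠ i + 1) : swapComp i h a ⟨j, hj⟩ = a ⟨j, hj⟩ := by
  rw [swapComp, Equiv.swap_apply_of_ne_of_ne (fun hc => h1 (congrArg Fin.val hc))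
    (fun hc => h2 (congrArg Fin.val hc))]

theorem swapComp_swapComp (i : ℕ) (h : i + 1 < m) (a : Fin m → ℕ) :
    swapComp i h (swapComp i h a) = a := by
  funext j
  simp [swapComp]

theorem val_swap (i : ℕ) (h : i + 1 < m) (n : Fin m) :
    ((Equiv.swap (⟨i, Nat.lt_of_succ_lt h⟩ : Fin m) ⟨i + 1, h⟩ n : Fin m) : ℕ)
      = Equiv.swap i (i + 1) (n : ℕ) := by
  simp only [Equiv.swap_apply_def, Fin.ext_iff]
  split_ifs <;> rfl

theorem swapComp_comm {i j : ℕ} (hi : i + 1 < m) (hj : j + 1 < m) (hij : i + 1 < j)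
    (a : Fin m → ℕ) :
    swapComp i hi (swapComp j hj a) = swapComp j hj (swapComp i hi a) := by
  funext n
  simp only [swapComp]
  congr 1
  refine Fin.ext ?_
  simp only [val_swap]
  simp only [Equiv.swap_apply_def]
  split_ifs <;> omega

theorem swapComp_braid {i : ℕ} (h : i + 1 < m) (h' : i + 1 + 1 < m) (a : Fin m → ℕ) :
    swapComp i h (swapComp (i + 1) h' (swapComp i h a))
      = swapComp (i + 1) h' (swapComp i h (swapComp (i + 1) h' a)) := by
  funext n
  simp only [swapComp]
  congr 1
  refine Fin.ext ?_
  simp only [val_swap]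
  simp only [Equiv.swap_apply_def]
  split_ifs <;> omega

theorem sum_swapComp (i : ℕ) (h : i + 1 < m) (a : Fin m → ℕ) (g : ℕ → ℕ) :
    ∑ j, g (swapComp i h a j) = ∑ j, g (a j) :=
  Equiv.sum_comp (Equiv.swap (⟨i, Nat.lt_of_succ_lt h⟩ : Fin m) ⟨i + 1, h⟩) fun j => g (a j)

theorem swapVar_xPow (i : ℕ) (h : i + 1 < m) (a : Fin m → ℕ) :
    swapVar i h (xPow F a) = xPow F (swapComp i h a) := by
  rw [xPow, map_prod, xPow]
  simp only [map_pow, swapVar_xVar]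
  rw [← Equiv.prod_comp (Equiv.swap ⟨i, Nat.lt_of_succ_lt h⟩ ⟨i + 1, h⟩)]
  simp [swapComp]

/-- The factor of `x^a` in the variables other than `x_i` and `x_{i+1}`. -/
noncomputable def restPow (F : Type u) [Field F] (i : ℕ) (h : i + 1 < m) (a : Fin m → ℕ) :
    R F m :=
  ∏ j ∈ (Finset.univ.erase (⟨i, Nat.lt_of_succ_lt h⟩ : Fin m)).erase ⟨i + 1, h⟩, xVar F j ^ a j

theorem xPow_eq_restPow_mul (i : ℕ) (h : i + 1 < m) (a : Fin m → ℕ) :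
    xPow F a = restPow F i h a * (xVar F ⟨i, Nat.lt_of_succ_lt h⟩ ^ a ⟨i, Nat.lt_of_succ_lt h⟩
      * xVar F ⟨i + 1, h⟩ ^ a ⟨i + 1, h⟩) := by
  have h1 : (⟨i + 1, h⟩ : Fin m) ∈ Finset.univ.erase (⟨i, Nat.lt_of_succ_lt h⟩ : Fin m) := by
    simp
  rw [xPow, ← Finset.mul_prod_erase Finset.univ _ (Finset.mem_univ ⟨i, Nat.lt_of_succ_lt h⟩),
    ← Finset.mul_prod_erase _ _ h1, restPow]
  ring

theorem swapVar_restPow (i : ℕ) (h : i + 1 < m) (a : Fin m → ℕ) :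
    swapVar i h (restPow F i h a) = restPow F i h a := by
  rw [restPow, map_prod]
  refine Finset.prod_congr rfl fun j hj => ?_
  simp only [Finset.mem_erase, Finset.mem_univ, and_true] at hj
  rw [map_pow, swapVar_xVar, Equiv.swap_apply_of_ne_of_ne hj.2 hj.1]

/-- The composition `a` with the entries `a_i`, `a_{i+1}` replaced by `u`, `v`. -/
def updatePair (i : ℕ) (h : i + 1 < m) (a : Fin m → ℕ) (u v : ℕ) : Fin m → ℕ :=
  Function.update (Function.update a ⟨i, Nat.lt_of_succ_lt h⟩ u) ⟨i + 1, h⟩ v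

theorem xPow_updatePair (i : ℕ) (h : i + 1 < m) (a : Fin m → ℕ) (u v : ℕ) :
    xPow F (updatePair i h a u v) = restPow F i h a *
      (xVar F ⟨i, Nat.lt_of_succ_lt h⟩ ^ u * xVar F ⟨i + 1, h⟩ ^ v) := by
  have h1 : (⟨i, Nat.lt_of_succ_lt h⟩ : Fin m) ≠ ⟨i + 1, h⟩ := by simp
  rw [xPow_eq_restPow_mul i h]
  have h2 : restPow F i h (updatePair i h a u v) = restPow F i h a := by
    refine Finset.prod_congr rfl fun j hj => ?_
    simp only [Finset.mem_erase, Finset.mem_univ, and_true] at hj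
    rw [updatePair, Function.update_of_ne hj.1, Function.update_of_ne hj.2]
  rw [h2, updatePair, Function.update_self, Function.update_of_ne h1, Function.update_self]

/-- The sum of the squares of the entries, which the Hecke operators do not increase. -/
def sumSq (a : Fin m → ℕ) : ℕ := ∑ j, a j ^ 2

theorem sumSq_swapComp (i : ℕ) (h : i + 1 < m) (a : Fin m → ℕ) :
    sumSq (swapComp i h a) = sumSq a := sum_swapComp i h a fun x => x ^ 2

theorem sumSq_updatePair (i : ℕ) (h : i + 1 < m) (a : Fin m → ℕ) (u v : ℕ) :
    sumSq (updatePair i h a u v)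
        + (a ⟨i, Nat.lt_of_succ_lt h⟩ ^ 2 + a ⟨i + 1, h⟩ ^ 2)
      = sumSq a + (u ^ 2 + v ^ 2) := by
  have h0 : (⟨i, Nat.lt_of_succ_lt h⟩ : Fin m) ≠ ⟨i + 1, h⟩ := by simp
  have h1 : (⟨i + 1, h⟩ : Fin m) ∈ Finset.univ.erase (⟨i, Nat.lt_of_succ_lt h⟩ : Fin m) := by
    simp
  have key : ∀ c : Fin m → ℕ, sumSq c = c ⟨i, Nat.lt_of_succ_lt h⟩ ^ 2 + (c ⟨i + 1, h⟩ ^ 2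
      + ∑ j ∈ (Finset.univ.erase (⟨i, Nat.lt_of_succ_lt h⟩ : Fin m)).erase ⟨i + 1, h⟩,
        c j ^ 2) := fun c => by
    rw [sumSq, ← Finset.add_sum_erase Finset.univ _ (Finset.mem_univ ⟨i, Nat.lt_of_succ_lt h⟩),
      ← Finset.add_sum_erase _ _ h1]
  rw [key, key a]
  have h2 : ∑ j ∈ (Finset.univ.erase (⟨i, Nat.lt_of_succ_lt h⟩ : Fin m)).erase ⟨i + 1, h⟩,
      updatePair i h a u v j ^ 2
      = ∑ j ∈ (Finset.univ.erase (⟨i, Nat.lt_of_succ_lt h⟩ : Fin m)).erase ⟨i + 1, h⟩,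
        a j ^ 2 := by
    refine Finset.sum_congr rfl fun j hj => ?_
    simp only [Finset.mem_erase, Finset.mem_univ, and_true] at hj
    rw [updatePair, Function.update_of_ne hj.1, Function.update_of_ne hj.2]
  rw [h2, updatePair, Function.update_self, Function.update_of_ne h0, Function.update_self]
  ring

theorem mul_mem_span_of_forall {S : Set (R F m)} {W : Submodule F (R F m)} (y : R F m)
    (h : ∀ g ∈ S, y * g ∈ W) {f : R F m} (hf : f ∈ Submodule.span F S) : y * f ∈ W := by
  have h1 := (Submodule.map_span_le (LinearMap.mulLeft F y) S W).2 h
  exact h1 ⟨f, hf, rfl⟩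

theorem algebraMap_mul_mem {W : Submodule F (R F m)} (c : F) {f : R F m} (hf : f ∈ W) :
    (1 - algebraMap F (R F m) c) * f ∈ W := by
  have h1 : (1 - algebraMap F (R F m) c) * f = (1 - c) • f := by
    rw [Algebra.smul_def, map_sub, map_one]
  rw [h1]
  exact W.smul_mem _ hf

/-- `T_i (x_i^{q+d+1} x_{i+1}^q)` is `x_i^q x_{i+1}^{q+d+1}` up to monomials whose exponents lie
strictly between. -/
theorem hecke_pow_mul_pow_sub_mem (t : Fˣ) (i : ℕ) (h : i + 1 < m) (q d : ℕ) :
    hecke t i h (xVar F ⟨i, Nat.lt_of_succ_lt h⟩ ^ (q + d + 1) * xVar F ⟨i + 1, h⟩ ^ q)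
        - xVar F ⟨i, Nat.lt_of_succ_lt h⟩ ^ q * xVar F ⟨i + 1, h⟩ ^ (q + d + 1)
      ∈ Submodule.span F {f | ∃ u v, u + v = 2 * q + d + 1 ∧ q < u ∧ q < v ∧
          f = xVar F ⟨i, Nat.lt_of_succ_lt h⟩ ^ u * xVar F ⟨i + 1, h⟩ ^ v} := by
  have hsym : hecke t i h (xVar F ⟨i, Nat.lt_of_succ_lt h⟩ ^ q * xVar F ⟨i + 1, h⟩ ^ q)
      = algebraMap F (R F m) t
        * (xVar F ⟨i, Nat.lt_of_succ_lt h⟩ ^ q * xVar F ⟨i + 1, h⟩ ^ q) := by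
    rw [hecke_of_swapVar_eq, Algebra.smul_def]
    rw [map_mul, map_pow, map_pow, swapVar_xVar, swapVar_xVar, Equiv.swap_apply_left,
      Equiv.swap_apply_right, mul_comm]
  induction d with
  | zero =>
    have h1 : xVar F ⟨i, Nat.lt_of_succ_lt h⟩ ^ (q + 0 + 1) * xVar F ⟨i + 1, h⟩ ^ q
        = xVar F ⟨i, Nat.lt_of_succ_lt h⟩
          * (xVar F ⟨i, Nat.lt_of_succ_lt h⟩ ^ q * xVar F ⟨i + 1, h⟩ ^ q) := by ring
    rw [h1, hecke_xVar_mul, hsym]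
    convert Submodule.zero_mem _ using 1
    ring
  | succ d ih =>
    have h1 : xVar F ⟨i, Nat.lt_of_succ_lt h⟩ ^ (q + (d + 1) + 1) * xVar F ⟨i + 1, h⟩ ^ q
        = xVar F ⟨i, Nat.lt_of_succ_lt h⟩ * (xVar F ⟨i, Nat.lt_of_succ_lt h⟩ ^ (q + d + 1)
          * xVar F ⟨i + 1, h⟩ ^ q) := by ring
    rw [h1, hecke_xVar_mul]
    set T := hecke t i h (xVar F ⟨i, Nat.lt_of_succ_lt h⟩ ^ (q + d + 1) * xVar F ⟨i + 1, h⟩ ^ q)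
    have h2 : xVar F ⟨i + 1, h⟩ * T
          + (1 - algebraMap F (R F m) t) * (xVar F ⟨i + 1, h⟩ *
            (xVar F ⟨i, Nat.lt_of_succ_lt h⟩ ^ (q + d + 1) * xVar F ⟨i + 1, h⟩ ^ q))
          - xVar F ⟨i, Nat.lt_of_succ_lt h⟩ ^ q * xVar F ⟨i + 1, h⟩ ^ (q + (d + 1) + 1)
        = xVar F ⟨i + 1, h⟩ * (T - xVar F ⟨i, Nat.lt_of_succ_lt h⟩ ^ q
            * xVar F ⟨i + 1, h⟩ ^ (q + d + 1))
          + (1 - algebraMap F (R F m) t) *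
            (xVar F ⟨i, Nat.lt_of_succ_lt h⟩ ^ (q + d + 1) * xVar F ⟨i + 1, h⟩ ^ (q + 1)) := by
      ring
    rw [h2]
    refine Submodule.add_mem _ (mul_mem_span_of_forall _ ?_ ih) (algebraMap_mul_mem _ ?_)
    · rintro _ ⟨u, v, huv, hu, hv, rfl⟩
      exact Submodule.subset_span ⟨u, v + 1, by omega, hu, by omega, by ring⟩
    · exact Submodule.subset_span ⟨q + d + 1, q + 1, by omega, by omega, by omega, rfl⟩

theorem hecke_pow_mul_pow_mem (t : Fˣ) (i : ℕ) (h : i + 1 < m) (q d : ℕ) :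
    hecke t i h (xVar F ⟨i, Nat.lt_of_succ_lt h⟩ ^ q * xVar F ⟨i + 1, h⟩ ^ (q + d))
      ∈ Submodule.span F {f | ∃ u v, u + v = 2 * q + d ∧ q ≤ u ∧ q ≤ v ∧
          f = xVar F ⟨i, Nat.lt_of_succ_lt h⟩ ^ u * xVar F ⟨i + 1, h⟩ ^ v} := by
  induction d with
  | zero =>
    rw [hecke_of_swapVar_eq]
    · exact Submodule.smul_mem _ _
        (Submodule.subset_span ⟨q, q, by omega, le_rfl, le_rfl, rfl⟩)
    · rw [map_mul, map_pow, map_pow, swapVar_xVar, swapVar_xVar, Equiv.swap_apply_left,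
        Equiv.swap_apply_right, add_zero, mul_comm]
  | succ d ih =>
    have h1 : xVar F ⟨i, Nat.lt_of_succ_lt h⟩ ^ q * xVar F ⟨i + 1, h⟩ ^ (q + (d + 1))
        = xVar F ⟨i + 1, h⟩ * (xVar F ⟨i, Nat.lt_of_succ_lt h⟩ ^ q
          * xVar F ⟨i + 1, h⟩ ^ (q + d)) := by ring
    rw [h1, hecke_xVar_succ_mul]
    refine Submodule.sub_mem _ (mul_mem_span_of_forall _ ?_ ih) (algebraMap_mul_mem _ ?_)
    · rintro _ ⟨u, v, huv, hu, hv, rfl⟩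
      exact Submodule.subset_span ⟨u + 1, v, by omega, by omega, hv, by ring⟩
    · exact Submodule.subset_span ⟨q, q + d + 1, by omega, le_rfl, by omega, by ring⟩

/-- For `a_i > a_{i+1}`, the leading term of `T_i x^a` is `x^{s_i a}`. -/
theorem hecke_xPow_sub_mem (t : Fˣ) (i : ℕ) (h : i + 1 < m) (a : Fin m → ℕ)
    (ha : a ⟨i + 1, h⟩ < a ⟨i, Nat.lt_of_succ_lt h⟩) :
    hecke t i h (xPow F a) - xPow F (swapComp i h a)
      ∈ Submodule.span F (xPow F '' {b | sumSq b < sumSq a}) := by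
  obtain ⟨d, hd⟩ := Nat.exists_eq_add_of_lt ha
  have hrest := swapVar_restPow (F := F) i h a
  have h1 := swapVar_xPow (F := F) i h a
  rw [xPow_eq_restPow_mul i h a, map_mul, hrest, map_mul, map_pow, map_pow, swapVar_xVar,
    swapVar_xVar, Equiv.swap_apply_left, Equiv.swap_apply_right] at h1
  rw [← h1, xPow_eq_restPow_mul i h a, mul_comm (restPow F i h a), hecke_mul_of_swapVar_eq _ _ _ _
    hrest, hd, mul_comm _ (restPow F i h a), ← mul_sub]
  rw [mul_comm (xVar F ⟨i + 1, h⟩ ^ _) (xVar F ⟨i, _⟩ ^ _)]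
  refine mul_mem_span_of_forall _ ?_ (hecke_pow_mul_pow_sub_mem t i h (a ⟨i + 1, h⟩) d)
  rintro _ ⟨u, v, huv, hu, hv, rfl⟩
  rw [← xPow_updatePair]
  refine Submodule.subset_span ⟨_, ?_, rfl⟩
  have h2 := sumSq_updatePair i h a u v
  rw [hd] at h2
  set q := a ⟨i + 1, h⟩
  simp only [Set.mem_ofPred_eq]
  have h3 : u ^ 2 + v ^ 2 < (q + d + 1) ^ 2 + q ^ 2 := by
    obtain ⟨u', rfl⟩ := Nat.exists_eq_add_of_lt hu
    have h4 : v = q + d - u' := by omega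
    obtain ⟨w, hw⟩ : ∃ w, d = u' + w + 1 := ⟨d - u' - 1, by omega⟩
    have h5 : v = q + w + 1 := by omega
    subst h5 hw
    nlinarith
  omega

theorem hecke_xPow_mem (t : Fˣ) (i : ℕ) (h : i + 1 < m) (a : Fin m → ℕ) :
    hecke t i h (xPow F a) ∈ Submodule.span F (xPow F '' {b | sumSq b ≤ sumSq a}) := by
  rcases lt_or_ge (a ⟨i + 1, h⟩) (a ⟨i, Nat.lt_of_succ_lt h⟩) with ha | ha
  · have h1 : xPow F (swapComp i h a) ∈ Submodule.span F (xPow F '' {b | sumSq b ≤ sumSq a}) :=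
      Submodule.subset_span ⟨_, (sumSq_swapComp i h a).le, rfl⟩
    have h2 := Submodule.span_mono (Set.image_mono fun b (hb : sumSq b < sumSq a) => hb.le)
      (hecke_xPow_sub_mem t i h a ha)
    have h3 := Submodule.add_mem _ h2 h1
    rwa [sub_add_cancel] at h3
  · obtain ⟨d, hd⟩ := Nat.exists_eq_add_of_le ha
    have hrest := swapVar_restPow (F := F) i h a
    rw [xPow_eq_restPow_mul i h a, mul_comm (restPow F i h a), hecke_mul_of_swapVar_eq _ _ _ _
      hrest, hd, mul_comm _ (restPow F i h a)]
    refine mul_mem_span_of_forall _ ?_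
      (hecke_pow_mul_pow_mem t i h (a ⟨i, Nat.lt_of_succ_lt h⟩) d)
    rintro _ ⟨u, v, huv, hu, hv, rfl⟩
    rw [← xPow_updatePair]
    refine Submodule.subset_span ⟨_, ?_, rfl⟩
    have h2 := sumSq_updatePair i h a u v
    rw [hd] at h2
    set q := a ⟨i, Nat.lt_of_succ_lt h⟩
    simp only [Set.mem_ofPred_eq]
    have h3 : u ^ 2 + v ^ 2 ≤ q ^ 2 + (q + d) ^ 2 := by
      obtain ⟨u', rfl⟩ := Nat.exists_eq_add_of_le hu
      obtain ⟨w, rfl⟩ := Nat.exists_eq_add_of_le hv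
      obtain rfl : d = u' + w := by omega
      nlinarith
    omega

theorem hallLittlewood_of_not_ascent (t : Fˣ) {a : Fin m → ℕ} (H : ¬ ∃ i, IsAscent a i) :
    hallLittlewood t a = xPow F a := by
  rw [hallLittlewood, dif_neg H]

theorem exists_hallLittlewood_eq (t : Fˣ) {a : Fin m → ℕ} (H : ∃ i, IsAscent a i) :
    ∃ i, ∃ h : i + 1 < m, a ⟨i, Nat.lt_of_succ_lt h⟩ < a ⟨i + 1, h⟩ ∧
      (hallLittlewood t a : R F m) = hecke t i h (hallLittlewood t (swapComp i h a)) := by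
  classical
  refine ⟨Nat.find H, (Nat.find_spec H).1, (Nat.find_spec H).2, ?_⟩
  conv_lhs => rw [hallLittlewood, dif_pos H]

theorem hallLittlewood_sub_mem (t : Fˣ) (a : Fin m → ℕ) :
    hallLittlewood t a - xPow F a ∈ Submodule.span F (xPow F '' {b | sumSq b < sumSq a}) := by
  induction hw : ∑ j : Fin m, (j : ℕ) * a j using Nat.strong_induction_on generalizing a with
  | _ w ih =>
    by_cases H : ∃ i, IsAscent a i
    · obtain ⟨i, h, ha, hH⟩ := exists_hallLittlewood_eq (F := F) t H
      have h1 := ih _ (hw ▸ swapComp_weight_lt a i h ha) (swapComp i h a) rfl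
      rw [sumSq_swapComp] at h1
      have h2 := hecke_xPow_sub_mem (F := F) t i h (swapComp i h a)
        (by rwa [swapComp_left, swapComp_right])
      rw [swapComp_swapComp, sumSq_swapComp] at h2
      have h3 : ∀ f ∈ Submodule.span F (xPow F '' {b | sumSq b < sumSq a}),
          heckeLin t i h f ∈ Submodule.span F (xPow F '' {b | sumSq b < sumSq a}) := by
        intro f hf
        refine (Submodule.map_span_le (heckeLin t i h) _ _).2 ?_ ⟨f, hf, rfl⟩
        rintro _ ⟨b, hb, rfl⟩
        refine Submodule.span_mono (Set.image_mono ?_) (hecke_xPow_mem t i h b)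
        exact fun c (hc : sumSq c ≤ sumSq b) => lt_of_le_of_lt hc (show sumSq b < sumSq a from hb)
      have h4 := Submodule.add_mem _ (h3 _ h1) h2
      rw [map_sub, heckeLin_apply, heckeLin_apply, ← hH, sub_add_sub_cancel] at h4
      exact h4
    · rw [hallLittlewood_of_not_ascent t H, sub_self]
      exact Submodule.zero_mem _

theorem k_sub_mem (t : Fˣ) (L : MPartition m) :
    k t L - kOne F L ∈ Submodule.span F (kOne F '' {O | sumSq O.comp < sumSq L.comp}) := by
  rw [k, kOne, ← sub_mul, mul_comm]
  refine mul_mem_span_of_forall _ ?_ (hallLittlewood_sub_mem t L.comp)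
  rintro _ ⟨b, hb, rfl⟩
  exact Submodule.subset_span ⟨⟨b, L.part⟩, hb, mul_comm _ _⟩

/-- The functions `k_L(x;t)` form a basis of `R_m`. -/
theorem exists_basis_k (t : Fˣ) :
    ∃ b : Module.Basis (MPartition m) F (R F m), ∀ L, b L = k t L := by
  classical
  obtain ⟨b, hb⟩ := exists_basis_kOne (F := F) (m := m)
  have key : ∀ L O, b.repr (k t L) O ≠ (Finsupp.single L (1 : F)) O →
      sumSq O.comp < sumSq L.comp := by
    intro L O hne
    have h1 := k_sub_mem t L
    have hb' : kOne F = ⇑b := funext fun L => (hb L).symm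
    rw [hb', b.mem_span_image] at h1
    refine h1 ?_
    rw [Finset.mem_coe, Finsupp.mem_support_iff, map_sub, b.repr_self, Finsupp.sub_apply]
    exact sub_ne_zero.2 hne
  obtain ⟨b', hb', -⟩ := exists_basis_of_triangular
    (lt := fun O L : MPartition m => sumSq O.comp < sumSq L.comp) (InvImage.wf _ wellFounded_lt)
    (fun _ _ _ h h' => lt_trans h h') b (k t)
    (fun L O h => by
      by_cases hOL : O = L
      · exact Or.inl hOL
      · refine Or.inr (key L O ?_)
        rwa [Finsupp.single_eq_of_ne hOL])
    (fun L h => by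
      refine lt_irrefl _ (key L L ?_)
      rw [h, Finsupp.single_eq_same]
      exact zero_ne_one)
  exact ⟨b', hb'⟩

end HallLittlewood

/-! ### The action of the Hecke operators on the basis `k_L(x;t)` -/

section Action

variable {F : Type u} [Field F] {m : ℕ}

/-- The recursion `H_a = T_i H_{s_i a}` holds for every ascent `i` of `a`, not only for the smallest
one: two ascents are compared with the commutation and braid relations. -/
theorem hallLittlewood_of_lt (t : Fˣ) (a : Fin m → ℕ) (i : ℕ) (h : i + 1 < m)
    (ha : a ⟨i, Nat.lt_of_succ_lt h⟩ < a ⟨i + 1, h⟩) :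
    (hallLittlewood t a : R F m) = hecke t i h (hallLittlewood t (swapComp i h a)) := by
  induction hw : ∑ j : Fin m, (j : ℕ) * a j using Nat.strong_induction_on generalizing a i with
  | _ w ih =>
    subst hw
    obtain ⟨j, hj, haj, hH⟩ := exists_hallLittlewood_eq (F := F) t ⟨i, h, ha⟩
    -- Ascents far apart: both recursions can be continued to the same composition.
    have hfar : ∀ (p q : ℕ) (hp : p + 1 < m) (hq : q + 1 < m), p + 1 < q →
        a ⟨p, Nat.lt_of_succ_lt hp⟩ < a ⟨p + 1, hp⟩ → a ⟨q, Nat.lt_of_succ_lt hq⟩ < a ⟨q + 1, hq⟩ →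
        hecke t p hp (hallLittlewood t (swapComp p hp a))
          = hecke t q hq (hallLittlewood (F := F) t (swapComp q hq a)) := by
      intro p q hp hq hpq hap haq
      rw [ih _ (swapComp_weight_lt a p hp hap) (swapComp p hp a) q hq
          (by rw [swapComp_of_ne p hp a _ (by omega) (by omega),
                swapComp_of_ne p hp a _ (by omega) (by omega)]; exact haq) rfl,
        ih _ (swapComp_weight_lt a q hq haq) (swapComp q hq a) p hp
          (by rw [swapComp_of_ne q hq a _ (by omega) (by omega),
                swapComp_of_ne q hq a _ (by omega) (by omega)]; exact hap) rfl,
        swapComp_comm hp hq hpq, hecke_comm t hp hq hpq]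
    -- Adjacent ascents: both recursions can be continued twice, to the reversed triple.
    have hadj : ∀ (p : ℕ) (hp : p + 1 < m) (hq : p + 1 + 1 < m),
        a ⟨p, Nat.lt_of_succ_lt hp⟩ < a ⟨p + 1, hp⟩ →
        a ⟨p + 1, Nat.lt_of_succ_lt hq⟩ < a ⟨p + 1 + 1, hq⟩ →
        hecke t p hp (hallLittlewood t (swapComp p hp a))
          = hecke t (p + 1) hq (hallLittlewood (F := F) t (swapComp (p + 1) hq a)) := by
      intro p hp hq hap haq
      have w1 := swapComp_weight_lt a p hp hap
      have w2 := swapComp_weight_lt a (p + 1) hq haq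
      have v1 : swapComp p hp a ⟨p + 1, Nat.lt_of_succ_lt hq⟩
          < swapComp p hp a ⟨p + 1 + 1, hq⟩ := by
        rw [swapComp_right, swapComp_of_ne p hp a _ (by omega) (by omega)]
        exact hap.trans haq
      have v2 : swapComp (p + 1) hq a ⟨p, Nat.lt_of_succ_lt hp⟩
          < swapComp (p + 1) hq a ⟨p + 1, hp⟩ := by
        rw [swapComp_left, swapComp_of_ne (p + 1) hq a _ (by omega) (by omega)]
        exact hap.trans haq
      have w1' := swapComp_weight_lt _ _ _ v1
      have w2' := swapComp_weight_lt _ _ _ v2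
      rw [ih _ w1 _ (p + 1) hq v1 rfl, ih _ w2 _ p hp v2 rfl,
        ih _ (w1'.trans w1) _ p hp (by
          rw [swapComp_left, swapComp_of_ne (p + 1) hq _ _ (by omega) (by omega), swapComp_left,
            swapComp_of_ne p hp a _ (by omega) (by omega)]
          exact haq) rfl,
        ih _ (w2'.trans w2) _ (p + 1) hq (by
          rw [swapComp_right, swapComp_of_ne p hp _ _ (by omega) (by omega), swapComp_right,
            swapComp_of_ne (p + 1) hq a _ (by omega) (by omega)]
          exact hap) rfl,
        hecke_braid, swapComp_braid]
    rw [hH]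
    rcases lt_trichotomy i j with hij | rfl | hij
    · rcases (Nat.succ_le_of_lt hij).lt_or_eq with hij' | rfl
      · exact (hfar i j h hj hij' ha haj).symm
      · exact (hadj i h hj ha haj).symm
    · rfl
    · rcases (Nat.succ_le_of_lt hij).lt_or_eq with hij' | rfl
      · exact hfar j i hj h hij' haj ha
      · exact hadj j hj h haj ha

theorem hecke_hallLittlewood_of_eq (t : Fˣ) (a : Fin m → ℕ) (i : ℕ) (h : i + 1 < m)
    (ha : a ⟨i, Nat.lt_of_succ_lt h⟩ = a ⟨i + 1, h⟩) :
    hecke t i h (hallLittlewood t a) = (t : F) • (hallLittlewood t a : R F m) := by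
  induction hw : ∑ j : Fin m, (j : ℕ) * a j using Nat.strong_induction_on generalizing a i with
  | _ w ih =>
    subst hw
    have hsmul : ∀ (p : ℕ) (hp : p + 1 < m) (f : R F m),
        hecke t p hp ((t : F) • f) = (t : F) • hecke t p hp f :=
      fun p hp f => map_smul (heckeLin t p hp) (t : F) f
    by_cases H : ∃ j, IsAscent a j
    · obtain ⟨j, hj, haj, hH⟩ := exists_hallLittlewood_eq (F := F) t H
      have wj := swapComp_weight_lt a j hj haj
      rcases lt_trichotomy i j with hij | rfl | hij
      · rcases (Nat.succ_le_of_lt hij).lt_or_eq with hij' | rfl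
        · rw [hH, hecke_comm t h hj hij', ih _ wj _ i h (by
            rw [swapComp_of_ne j hj a _ (by omega) (by omega),
              swapComp_of_ne j hj a _ (by omega) (by omega)]
            exact ha) rfl, hsmul]
        · have v : swapComp (i + 1) hj a ⟨i, Nat.lt_of_succ_lt h⟩
              < swapComp (i + 1) hj a ⟨i + 1, h⟩ := by
            rw [swapComp_left, swapComp_of_ne (i + 1) hj a _ (by omega) (by omega), ha]
            exact haj
          have wi := swapComp_weight_lt _ _ _ v
          rw [hH, hallLittlewood_of_lt t _ i h v, hecke_braid, ih _ (wi.trans wj) _ (i + 1) hj (by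
            rw [swapComp_right, swapComp_of_ne i h _ _ (by omega) (by omega), swapComp_right,
              swapComp_of_ne (i + 1) hj a _ (by omega) (by omega)]
            exact ha) rfl, hsmul, hsmul]
      · exact absurd haj (by rw [ha]; exact lt_irrefl _)
      · rcases (Nat.succ_le_of_lt hij).lt_or_eq with hij' | rfl
        · rw [hH, ← hecke_comm t hj h hij', ih _ wj _ i h (by
            rw [swapComp_of_ne j hj a _ (by omega) (by omega),
              swapComp_of_ne j hj a _ (by omega) (by omega)]
            exact ha) rfl, hsmul]
        · have v : swapComp j hj a ⟨j + 1, Nat.lt_of_succ_lt h⟩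
              < swapComp j hj a ⟨j + 1 + 1, h⟩ := by
            rw [swapComp_right, swapComp_of_ne j hj a _ (by omega) (by omega), ← ha]
            exact haj
          have wi := swapComp_weight_lt _ _ _ v
          rw [hH, hallLittlewood_of_lt t _ (j + 1) h v, ← hecke_braid, ih _ (wi.trans wj) _ j hj (by
            rw [swapComp_left, swapComp_of_ne (j + 1) h _ _ (by omega) (by omega), swapComp_left,
              swapComp_of_ne j hj a _ (by omega) (by omega)]
            exact ha) rfl, hsmul, hsmul]
    · rw [hallLittlewood_of_not_ascent t H, hecke_of_swapVar_eq]
      rw [swapVar_xPow]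
      congr 1
      funext j
      rw [swapComp]
      by_cases h1 : j = ⟨i, Nat.lt_of_succ_lt h⟩
      · rw [h1, Equiv.swap_apply_left, ha]
      · by_cases h2 : j = ⟨i + 1, h⟩
        · rw [h2, Equiv.swap_apply_right, ha]
        · rw [Equiv.swap_apply_of_ne_of_ne h1 h2]

/-- The `m`-partition `s_i L`. -/
def MPartition.swap (i : ℕ) (h : i + 1 < m) (L : MPartition m) : MPartition m :=
  ⟨swapComp i h L.comp, L.part⟩

theorem swap_swap (i : ℕ) (h : i + 1 < m) (L : MPartition m) :
    (L.swap i h).swap i h = L := by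
  ext1
  · exact swapComp_swapComp i h L.comp
  · rfl

theorem hecke_k (t : Fˣ) (i : ℕ) (h : i + 1 < m) (L : MPartition m) :
    hecke t i h (k t L) = hecke t i h (hallLittlewood t L.comp) * schur F m L.part :=
  hecke_mul_of_swapVar_eq t i h _ (swapVar_schur i h _)

theorem hecke_k_of_eq (t : Fˣ) (i : ℕ) (h : i + 1 < m) {L : MPartition m}
    (hL : L.comp ⟨i, Nat.lt_of_succ_lt h⟩ = L.comp ⟨i + 1, h⟩) :
    hecke t i h (k t L) = (t : F) • (k t L : R F m) := by
  rw [hecke_k, hecke_hallLittlewood_of_eq t _ i h hL, smul_mul_assoc, k]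

theorem hecke_k_of_gt (t : Fˣ) (i : ℕ) (h : i + 1 < m) {L : MPartition m}
    (hL : L.comp ⟨i + 1, h⟩ < L.comp ⟨i, Nat.lt_of_succ_lt h⟩) :
    hecke t i h (k t L) = (k t (L.swap i h) : R F m) := by
  have h1 := hallLittlewood_of_lt (F := F) t (swapComp i h L.comp) i h
    (by rwa [swapComp_left, swapComp_right])
  rw [swapComp_swapComp] at h1
  rw [hecke_k, ← h1, k, MPartition.swap]

theorem hecke_k_of_lt (t : Fˣ) (i : ℕ) (h : i + 1 < m) {L : MPartition m}
    (hL : L.comp ⟨i, Nat.lt_of_succ_lt h⟩ < L.comp ⟨i + 1, h⟩) :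
    hecke t i h (k t L)
      = ((t : F) - 1) • (k t L : R F m) + (t : F) • (k t (L.swap i h) : R F m) := by
  rw [hecke_k, hallLittlewood_of_lt t _ i h hL, hecke_hecke, ← hallLittlewood_of_lt t _ i h hL,
    add_mul, smul_mul_assoc, smul_mul_assoc, k, k, MPartition.swap]

theorem hallLittlewood_one (a : Fin m → ℕ) : hallLittlewood (1 : Fˣ) a = xPow F a := by
  induction hw : ∑ j : Fin m, (j : ℕ) * a j using Nat.strong_induction_on generalizing a with
  | _ w ih =>
    by_cases H : ∃ i, IsAscent a i
    · obtain ⟨i, h, ha, hH⟩ := exists_hallLittlewood_eq (F := F) 1 H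
      rw [hH, ih _ (hw ▸ swapComp_weight_lt a i h ha) _ rfl, hecke_one, swapVar_xPow,
        swapComp_swapComp]
    · exact hallLittlewood_of_not_ascent 1 H

theorem k_one (L : MPartition m) : k (1 : Fˣ) L = kOne F L := by
  rw [k, hallLittlewood_one, kOne]

end Action

/-! ### Dominance and column counts -/

section Columns

variable {m : ℕ}

/-- The number of cells in the columns `c, c + 1, …`. -/
def colsFrom (lam : YoungDiagram) (c : ℕ) : ℕ := (lam.cells.filter fun x => c ≤ x.2).card

theorem colsFrom_zero (lam : YoungDiagram) : colsFrom lam 0 = lam.card := by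
  simp [colsFrom, YoungDiagram.card]

theorem colsFrom_eq_add (lam : YoungDiagram) (c : ℕ) :
    colsFrom lam c = lam.colLen c + colsFrom lam (c + 1) := by
  rw [colsFrom, colsFrom, YoungDiagram.colLen_eq_card, ← Finset.card_union_of_disjoint]
  · congr 1
    ext x
    simp only [Finset.mem_filter, YoungDiagram.mem_cells, Finset.mem_union,
      YoungDiagram.mem_col_iff]
    constructor
    · rintro ⟨h1, h2⟩
      rcases h2.eq_or_lt with h3 | h3
      · exact Or.inl ⟨h1, h3.symm⟩
      · exact Or.inr ⟨h1, h3⟩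
    · rintro (⟨h1, h2⟩ | ⟨h1, h2⟩)
      · exact ⟨h1, h2.ge⟩
      · exact ⟨h1, by omega⟩
  · rw [Finset.disjoint_left]
    intro x hx hx'
    have h1 := (YoungDiagram.mem_col_iff.1 hx).2
    have h2 := (Finset.mem_filter.1 hx').2
    omega

theorem eq_of_colLen_eq {lam mu : YoungDiagram} (h : ∀ c, lam.colLen c = mu.colLen c) :
    lam = mu := by
  ext ⟨i, j⟩
  rw [YoungDiagram.mem_cells, YoungDiagram.mem_cells, YoungDiagram.mem_iff_lt_colLen,
    YoungDiagram.mem_iff_lt_colLen, h]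

theorem eq_of_colsFrom_eq {lam mu : YoungDiagram} (h : ∀ c, colsFrom lam c = colsFrom mu c) :
    lam = mu := by
  refine eq_of_colLen_eq fun c => ?_
  have h1 := colsFrom_eq_add lam c
  have h2 := colsFrom_eq_add mu c
  rw [h, h, h2] at h1
  omega

theorem colsFrom_unionDiagram (a : Fin m → ℕ) (lam : YoungDiagram) (c : ℕ) :
    colsFrom (unionDiagram a lam) c = ∑ i, (a i - c) + colsFrom lam c := by
  set s : Multiset ℕ := Finset.univ.val.map a + (lam.rowLens : Multiset ℕ) with hs
  set w : List ℕ := s.sort (fun x y => x ≥ y) with hw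
  have hsorted : w.SortedGE := (Multiset.pairwise_sort _ _).sortedGE
  have hU : unionDiagram a lam = YoungDiagram.ofRowLens w hsorted := rfl
  have hlen : (YoungDiagram.ofRowLens w hsorted).colLen 0 ≤ w.length := by
    by_contra! hc
    obtain ⟨h1, -⟩ := YoungDiagram.mem_ofRowLens.1 (YoungDiagram.mem_iff_lt_colLen.2 hc)
    exact lt_irrefl _ h1
  rw [hU, colsFrom, card_filter_le_col _ c hlen, ← Fin.sum_univ_eq_sum_range
    fun i => (YoungDiagram.ofRowLens w hsorted).rowLen i - c]
  have h2 : ∑ i : Fin w.length, ((YoungDiagram.ofRowLens w hsorted).rowLen i - c)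
      = (w.map fun x => x - c).sum := by
    rw [← Fin.sum_univ_fun_getElem w fun x => x - c]
    exact Finset.sum_congr rfl fun i _ => by rw [YoungDiagram.rowLen_ofRowLens]; rfl
  rw [h2]
  have h3 : (w.map fun x => x - c).sum = (s.map fun x => x - c).sum := by
    rw [← Multiset.sum_coe, ← Multiset.map_coe, hw, Multiset.sort_eq]
  rw [h3, hs, Multiset.map_add, Multiset.sum_add, Multiset.map_map]
  congr 1
  rw [Multiset.map_coe, Multiset.sum_coe, YoungDiagram.rowLens, List.map_map, colsFrom,
    card_filter_le_col lam c le_rfl]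
  rfl

theorem colLen_unionDiagram (a : Fin m → ℕ) (lam : YoungDiagram) (c : ℕ) :
    (unionDiagram a lam).colLen c = lam.colLen c + (Finset.univ.filter fun i => c < a i).card := by
  have h1 := colsFrom_eq_add (unionDiagram a lam) c
  have h2 := colsFrom_eq_add lam c
  rw [colsFrom_unionDiagram, colsFrom_unionDiagram, h2] at h1
  have h3 : ∑ i, (a i - c) = (Finset.univ.filter fun i => c < a i).card + ∑ i, (a i - (c + 1)) := by
    rw [Finset.card_filter, ← Finset.sum_add_distrib]
    refine Finset.sum_congr rfl fun i _ => ?_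
    split_ifs <;> omega
  omega

theorem card_unionDiagram (a : Fin m → ℕ) (lam : YoungDiagram) :
    (unionDiagram a lam).card = ∑ i, a i + lam.card := by
  rw [← colsFrom_zero, colsFrom_unionDiagram, colsFrom_zero]
  simp

/-- Comparing the numbers of cells outside the first `c` columns, for all `c`, gives the dominance
order. -/
theorem dominates_of_colsFrom_le {lam mu : YoungDiagram} (hcard : mu.card = lam.card)
    (h : ∀ c, colsFrom mu c ≤ colsFrom lam c) : Dominates lam mu := by
  refine ⟨hcard, fun i => ?_⟩
  -- The bound `∑_{j < i} mu_j ≤ i c + colsFrom mu c` is an equality for `lam` and `c = lam_i`.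
  set c := lam.rowLen i with hc
  have h1 : ∑ j ∈ Finset.range i, mu.rowLen j ≤ i * c + colsFrom mu c := by
    rw [colsFrom, card_filter_le_col mu c (le_max_left (mu.colLen 0) i)]
    calc ∑ j ∈ Finset.range i, mu.rowLen j
        ≤ ∑ j ∈ Finset.range i, (c + (mu.rowLen j - c)) :=
          Finset.sum_le_sum fun j _ => by omega
      _ = i * c + ∑ j ∈ Finset.range i, (mu.rowLen j - c) := by
          rw [Finset.sum_add_distrib]; simp
      _ ≤ _ := by
          gcongr
          exact le_max_right _ _
  have h2 : ∑ j ∈ Finset.range i, lam.rowLen j = i * c + colsFrom lam c := by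
    rw [colsFrom, card_filter_le_col lam c (le_max_left (lam.colLen 0) i),
      ← Finset.sum_subset (Finset.range_mono (le_max_right (lam.colLen 0) i)) fun j _ hj => by
        have := lam.rowLen_anti i j (by simpa using hj)
        omega]
    calc ∑ j ∈ Finset.range i, lam.rowLen j
        = ∑ j ∈ Finset.range i, (c + (lam.rowLen j - c)) :=
          Finset.sum_congr rfl fun j hj => by
            have := lam.rowLen_anti j i (Finset.mem_range.1 hj).le
            omega
      _ = _ := by rw [Finset.sum_add_distrib]; simp
  have := h c
  omega

end Columns

/-! ### The skew tableaux `S_{L O}` -/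

section Tableaux

variable {m : ℕ} {L O : MPartition m}

theorem sum_card_filter_add_colsFrom (hsub : O.part.cells ⊆ (unionDiagram L.comp L.part).cells)
    (T : Filling L O) (c : ℕ) :
    ∑ i, (Finset.univ.filter fun x => T x = i ∧ c ≤ x.1.2).card + colsFrom O.part c
      = ∑ i, (L.comp i - c) + colsFrom L.part c := by
  rw [← colsFrom_unionDiagram, colsFrom, colsFrom]
  have h1 : ∑ i, (Finset.univ.filter fun x => T x = i ∧ c ≤ x.1.2).card
      = (Finset.univ.filter fun x : ↥((unionDiagram L.comp L.part).cells \ O.part.cells) =>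
          c ≤ x.1.2).card := by
    rw [Finset.card_eq_sum_card_fiberwise (f := T) (t := Finset.univ) fun _ _ => Finset.mem_univ _]
    refine Finset.sum_congr rfl fun i _ => ?_
    rw [Finset.filter_filter]
    congr 1
    ext x
    simp [and_comm]
  have h2 : (Finset.univ.filter fun x : ↥((unionDiagram L.comp L.part).cells \ O.part.cells) =>
      c ≤ x.1.2).card
      = (((unionDiagram L.comp L.part).cells \ O.part.cells).filter fun x => c ≤ x.2).card := by
    rw [← Finset.card_map (Function.Embedding.subtype _)]
    congr 1
    ext x
    simp [and_comm]
  rw [h1, h2, ← Finset.card_union_of_disjoint]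
  · rw [← Finset.filter_union, Finset.sdiff_union_of_subset hsub]
  · exact Finset.disjoint_filter_filter Finset.sdiff_disjoint

theorem card_filter_le (T : Filling L O)
    (hcol : ∀ x y, x.1.2 = y.1.2 → x.1.1 < y.1.1 → T x < T y)
    (hbound : ∀ x, x.1.2 < L.comp (T x)) (i : Fin m) (c : ℕ) :
    (Finset.univ.filter fun x => T x = i ∧ c ≤ x.1.2).card ≤ L.comp i - c := by
  rw [← Nat.card_Ico]
  refine Finset.card_le_card_of_injOn (fun x => x.1.2) ?_ ?_
  · intro x hx
    have hx' := (Finset.mem_filter.1 hx).2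
    have := hbound x
    rw [hx'.1] at this
    simp only [Finset.coe_Ico, Set.mem_Ico]
    exact ⟨hx'.2, this⟩
  · intro x hx y hy hxy
    have hx' := (Finset.mem_filter.1 hx).2.1
    have hy' := (Finset.mem_filter.1 hy).2.1
    rcases lt_trichotomy x.1.1 y.1.1 with h | h | h
    · exact absurd (hcol x y hxy h) (by rw [hx', hy']; exact lt_irrefl _)
    · exact Subtype.ext (Prod.ext h hxy)
    · exact absurd (hcol y x hxy.symm h) (by rw [hx', hy']; exact lt_irrefl _)

theorem card_le_add_card_filter (T : Filling L O)
    (hcol : ∀ x y, x.1.2 = y.1.2 → x.1.1 < y.1.1 → T x < T y) (i : Fin m) (c : ℕ) :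
    (Finset.univ.filter fun x => T x = i).card
      ≤ c + (Finset.univ.filter fun x => T x = i ∧ c ≤ x.1.2).card := by
  have h1 : (Finset.univ.filter fun x => T x = i ∧ ¬ c ≤ x.1.2).card ≤ c := by
    conv_rhs => rw [← Finset.card_range c]
    refine Finset.card_le_card_of_injOn (fun x => x.1.2) ?_ ?_
    · intro x hx
      have hx' := (Finset.mem_filter.1 hx).2
      simpa using hx'.2
    · intro x hx y hy hxy
      have hx' := (Finset.mem_filter.1 hx).2.1
      have hy' := (Finset.mem_filter.1 hy).2.1
      rcases lt_trichotomy x.1.1 y.1.1 with h | h | h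
      · exact absurd (hcol x y hxy h) (by rw [hx', hy']; exact lt_irrefl _)
      · exact Subtype.ext (Prod.ext h hxy)
      · exact absurd (hcol y x hxy.symm h) (by rw [hx', hy']; exact lt_irrefl _)
  rw [← Finset.card_filter_add_card_filter_not (s := Finset.univ.filter fun x => T x = i)
    (fun x => c ≤ x.1.2), Finset.filter_filter, Finset.filter_filter]
  omega

theorem mem_skewTableaux {T : Filling L O} : T ∈ skewTableaux L O ↔
    O.part.cells ⊆ (unionDiagram L.comp L.part).cells ∧
    (∀ x y, x.1.1 = y.1.1 → x.1.2 < y.1.2 → T x ≤ T y) ∧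
    (∀ x y, x.1.2 = y.1.2 → x.1.1 < y.1.1 → T x < T y) ∧
    (∀ i, (Finset.univ.filter fun x => T x = i).card = O.comp i) ∧
    (∀ x, x.1.2 < L.comp (T x)) := by
  rw [skewTableaux]
  simp only [Finset.mem_filter, Finset.mem_univ, true_and]

theorem comp_le_of_mem_skewTableaux {T : Filling L O} (hT : T ∈ skewTableaux L O) (i : Fin m) :
    O.comp i ≤ L.comp i := by
  obtain ⟨-, -, hcol, hcont, hbound⟩ := mem_skewTableaux.1 hT
  have h1 := card_filter_le T hcol hbound i 0
  have h2 := card_le_add_card_filter T hcol i 0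
  rw [hcont] at h2
  omega

theorem size_eq_of_mem_skewTableaux {T : Filling L O} (hT : T ∈ skewTableaux L O) :
    O.size = L.size := by
  obtain ⟨hsub, -, -, hcont, -⟩ := mem_skewTableaux.1 hT
  have h1 := sum_card_filter_add_colsFrom hsub T 0
  simp only [Nat.zero_le, and_true, hcont, colsFrom_zero, Nat.sub_zero] at h1
  exact h1

/-- If `T` has as many letters as possible then every admissible position in each column is used,
which forces the inner shape. -/
theorem eq_or_sum_lt_of_mem_skewTableaux {T : Filling L O} (hT : T ∈ skewTableaux L O) :
    O = L ∨ ∑ i, O.comp i < ∑ i, L.comp i := by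
  have hle := comp_le_of_mem_skewTableaux hT
  rcases (Finset.sum_le_sum fun i (_ : i ∈ Finset.univ) => hle i).lt_or_eq with h | h
  · exact Or.inr h
  · left
    have hcomp : ∀ i, O.comp i = L.comp i := fun i =>
      (Finset.sum_eq_sum_iff_of_le fun i _ => hle i).1 h i (Finset.mem_univ i)
    obtain ⟨hsub, -, hcol, hcont, hbound⟩ := mem_skewTableaux.1 hT
    ext1
    · exact funext hcomp
    · refine eq_of_colsFrom_eq fun c => ?_
      have h1 := sum_card_filter_add_colsFrom hsub T c
      have h2 : ∀ i, (Finset.univ.filter fun x => T x = i ∧ c ≤ x.1.2).card = L.comp i - c := by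
        intro i
        have h3 := card_filter_le T hcol hbound i c
        have h4 := card_le_add_card_filter T hcol i c
        rw [hcont, hcomp] at h4
        omega
      simp only [h2] at h1
      omega

/-- The order on `m`-partitions for which all sets of entries of `a` may be increased by one, not
only the initial segments; unlike the dominance order it is invariant under the simultaneous
permutation of entries. -/
def StrongLE (O L : MPartition m) : Prop :=
  ∀ e : Fin m → ℕ, (∀ i, e i ≤ 1) →
    Dominates (unionDiagram (L.comp + e) L.part) (unionDiagram (O.comp + e) O.part)

theorem StrongLE.le (h : StrongLE O L) : O ≤ L := by
  intro i _
  have key : ∀ M : MPartition m,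
      M.level i = unionDiagram (M.comp + fun j : Fin m => if (j : ℕ) < i then 1 else 0) M.part := by
    intro M
    rw [MPartition.level]
    congr 1
    funext j
    rw [Pi.add_apply]
    split_ifs <;> rfl
  rw [key, key]
  exact h _ fun j => by split_ifs <;> omega

theorem strongLE_of_mem_skewTableaux {T : Filling L O} (hT : T ∈ skewTableaux L O) :
    StrongLE O L := by
  intro e he
  have hle := comp_le_of_mem_skewTableaux hT
  have hsize := size_eq_of_mem_skewTableaux hT
  obtain ⟨hsub, -, hcol, hcont, hbound⟩ := mem_skewTableaux.1 hT
  refine dominates_of_colsFrom_le ?_ fun c => ?_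
  · simp only [MPartition.size] at hsize
    simp only [card_unionDiagram, Pi.add_apply, Finset.sum_add_distrib]
    omega
  · rw [colsFrom_unionDiagram, colsFrom_unionDiagram]
    have h1 := sum_card_filter_add_colsFrom hsub T c
    have h2 : ∑ i, ((O.comp + e) i - c) + ∑ i, (L.comp i - c) ≤ ∑ i, ((L.comp + e) i - c)
        + ∑ i, (Finset.univ.filter fun x => T x = i ∧ c ≤ x.1.2).card := by
      rw [← Finset.sum_add_distrib, ← Finset.sum_add_distrib]
      refine Finset.sum_le_sum fun i _ => ?_
      have h4 := card_le_add_card_filter T hcol i c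
      rw [hcont] at h4
      have h5 := hle i
      have h6 := he i
      simp only [Pi.add_apply]
      omega
    omega

theorem unionDiagram_swapComp (i : ℕ) (h : i + 1 < m) (a : Fin m → ℕ) (lam : YoungDiagram) :
    unionDiagram (swapComp i h a) lam = unionDiagram a lam := by
  refine eq_of_colsFrom_eq fun c => ?_
  rw [colsFrom_unionDiagram, colsFrom_unionDiagram, sum_swapComp i h a fun x => x - c]

theorem StrongLE.swap (h : StrongLE O L) (i : ℕ) (hi : i + 1 < m) :
    StrongLE (O.swap i hi) (L.swap i hi) := by
  intro e he
  have key : ∀ M : MPartition m, unionDiagram ((M.swap i hi).comp + e) (M.swap i hi).part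
      = unionDiagram (M.comp + swapComp i hi e) M.part := by
    intro M
    rw [← unionDiagram_swapComp i hi (M.comp + swapComp i hi e)]
    congr 1
    funext j
    simp [MPartition.swap, swapComp]
  rw [key, key]
  exact h _ fun j => he _

theorem antitone_of_not_ascent {a : Fin m → ℕ} (H : ¬ ∃ i, IsAscent a i) : Antitone a := by
  have key : ∀ (k i : ℕ) (h : i + k < m), a ⟨i + k, h⟩ ≤ a ⟨i, by omega⟩ := by
    intro k
    induction k with
    | zero => intro i h; exact le_rfl
    | succ k ih =>
      intro i h
      refine le_trans ?_ (ih i (by omega))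
      by_contra! hc
      exact H ⟨i + k, h, hc⟩
  intro i j hij
  obtain ⟨k, hk⟩ := Nat.exists_eq_add_of_le (Fin.le_iff_val_le_val.1 hij)
  have h1 := key k i (by rw [← hk]; exact j.2)
  have h2 : j = ⟨i + k, by rw [← hk]; exact j.2⟩ := Fin.ext hk
  rw [h2]
  exact h1

theorem lt_card_filter_iff {a : Fin m → ℕ} (ha : Antitone a) (c : ℕ) (j : Fin m) :
    (j : ℕ) < (Finset.univ.filter fun i => c < a i).card ↔ c < a j := by
  constructor
  · intro h
    by_contra hc
    have h1 : (Finset.univ.filter fun i => c < a i) ⊆ Finset.Iio j := by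
      intro i hi
      rw [Finset.mem_Iio]
      by_contra hij
      exact hc (lt_of_lt_of_le (Finset.mem_filter.1 hi).2 (ha (not_lt.1 hij)))
    have h2 := Finset.card_le_card h1
    rw [Fin.card_Iio] at h2
    omega
  · intro h
    have h1 : Finset.Iic j ⊆ Finset.univ.filter fun i => c < a i := by
      intro i hi
      rw [Finset.mem_filter]
      exact ⟨Finset.mem_univ _, lt_of_lt_of_le h (ha (Finset.mem_Iic.1 hi))⟩
    have h2 := Finset.card_le_card h1
    rw [Fin.card_Iic] at h2
    omega

/-- For dominant `a` there is exactly one tableau in `S_{L L}`: column `c` contains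
the letters `1, 2, …` in order. -/
theorem card_skewTableaux_self (L : MPartition m) (hL : Antitone L.comp) :
    (skewTableaux L L).card = 1 := by
  classical
  have hU := colLen_unionDiagram L.comp L.part
  have hk := fun c j => lt_card_filter_iff hL c j
  have hmem : ∀ x : ↥((unionDiagram L.comp L.part).cells \ L.part.cells),
      L.part.colLen x.1.2 ≤ x.1.1 ∧ x.1.1 < L.part.colLen x.1.2
        + (Finset.univ.filter fun i => x.1.2 < L.comp i).card := by
    intro x
    obtain ⟨h1, h2⟩ := Finset.mem_sdiff.1 x.2
    have h1' : (x.1.1, x.1.2) ∈ unionDiagram L.comp L.part := by simpa using h1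
    have h2' : (x.1.1, x.1.2) ∉ L.part := by simpa using h2
    rw [YoungDiagram.mem_iff_lt_colLen] at h1' h2'
    rw [← hU]
    omega
  have hmem' : ∀ r c, L.part.colLen c ≤ r → r < (unionDiagram L.comp L.part).colLen c →
      (r, c) ∈ (unionDiagram L.comp L.part).cells \ L.part.cells := by
    intro r c h1 h2
    rw [Finset.mem_sdiff, YoungDiagram.mem_cells, YoungDiagram.mem_cells,
      YoungDiagram.mem_iff_lt_colLen, YoungDiagram.mem_iff_lt_colLen]
    omega
  have hcardle : ∀ c, (Finset.univ.filter fun i => c < L.comp i).card ≤ m := fun c => by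
    simpa using Finset.card_le_univ (Finset.univ.filter fun i => c < L.comp i)
  let T₀ : Filling L L := fun x => ⟨x.1.1 - L.part.colLen x.1.2, by
    have := hmem x
    have := hcardle x.1.2
    omega⟩
  have hT₀ : ∀ x, (T₀ x : ℕ) = x.1.1 - L.part.colLen x.1.2 := fun _ => rfl
  refine Finset.card_eq_one.2 ⟨T₀, Finset.eq_singleton_iff_unique_mem.2 ⟨?_, fun T hT => ?_⟩⟩
  · have hsub : L.part.cells ⊆ (unionDiagram L.comp L.part).cells := by
      rintro ⟨r, c⟩ hx
      rw [YoungDiagram.mem_cells, YoungDiagram.mem_iff_lt_colLen] at hx ⊢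
      rw [hU]
      omega
    have hcol : ∀ x y, x.1.2 = y.1.2 → x.1.1 < y.1.1 → T₀ x < T₀ y := by
      intro x y hxy h
      rw [Fin.lt_def, hT₀, hT₀]
      have h1 := hmem x
      rw [hxy] at h1 ⊢
      omega
    have hbound : ∀ x, x.1.2 < L.comp (T₀ x) := by
      intro x
      rw [← hk, hT₀]
      have := hmem x
      omega
    refine mem_skewTableaux.2 ⟨hsub, ?_, hcol, ?_, hbound⟩
    · intro x y hxy h
      rw [Fin.le_def, hT₀, hT₀, hxy]
      have := L.part.colLen_anti _ _ h.le
      omega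
    · -- No letter occurs too often, and the total number of cells is right.
      have h1 := sum_card_filter_add_colsFrom hsub T₀ 0
      have h2 := fun i => card_filter_le T₀ hcol hbound i 0
      simp only [Nat.zero_le, and_true, Nat.sub_zero, add_left_inj] at h1 h2
      intro i
      exact (Finset.sum_eq_sum_iff_of_le fun i _ => h2 i).1 h1 i (Finset.mem_univ i)
  · obtain ⟨-, -, hcol, -, hbound⟩ := mem_skewTableaux.1 hT
    -- A strictly increasing column bounds its entries from below by counting from the top,
    have hlow : ∀ (n : ℕ) x, x.1.1 = n → x.1.1 - L.part.colLen x.1.2 ≤ (T x : ℕ) := by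
      intro n
      induction n with
      | zero => intro x hx; omega
      | succ n ih =>
        intro x hx
        by_cases hn : L.part.colLen x.1.2 ≤ n
        · have hx' := hmem x
          rw [← hU] at hx'
          have h1 := ih ⟨(n, x.1.2), hmem' n x.1.2 hn (by omega)⟩ rfl
          have h2 := Fin.lt_def.1 (hcol ⟨(n, x.1.2), hmem' n x.1.2 hn (by omega)⟩ x rfl
            (by rw [hx]; exact Nat.lt_succ_self n))
          simp only at h1
          omega
        · omega
    -- and from above by counting from the bottom.
    have hupp : ∀ (d : ℕ) x, x.1.1 + d + 1 = (unionDiagram L.comp L.part).colLen x.1.2 →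
        (T x : ℕ) + d < (Finset.univ.filter fun i => x.1.2 < L.comp i).card := by
      intro d
      induction d with
      | zero => intro x _; exact (hk _ _).2 (hbound x)
      | succ d ih =>
        intro x hx
        have hx' := hmem x
        have hy := hmem' (x.1.1 + 1) x.1.2 (by omega) (by omega)
        have h1 := ih ⟨(x.1.1 + 1, x.1.2), hy⟩ (by simp only; omega)
        have h2 := Fin.lt_def.1 (hcol x ⟨(x.1.1 + 1, x.1.2), hy⟩ rfl (Nat.lt_succ_self _))
        simp only at h1
        omega
    funext x
    refine Fin.ext ?_
    rw [hT₀]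
    have hx := hmem x
    have h1 := hlow _ x rfl
    have h2 := hU x.1.2
    have h3 := hupp ((unionDiagram L.comp L.part).colLen x.1.2 - 1 - x.1.1) x (by omega)
    omega

end Tableaux

/-! ### The coefficients of the dual `m`-symmetric Schur functions -/

section Coefficients

variable {m : ℕ} {A : Type*} [CommRing A]

/-- The coefficients of `T_i^* g`, in terms of the coefficients `P` of `g` in the basis
`k_L(x;t)`. -/
def adjStep (t : A) (i : ℕ) (h : i + 1 < m) (P : MPartition m → A) (O : MPartition m) : A :=
  if O.comp ⟨i, Nat.lt_of_succ_lt h⟩ = O.comp ⟨i + 1, h⟩ then t * P O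
  else if O.comp ⟨i, Nat.lt_of_succ_lt h⟩ < O.comp ⟨i + 1, h⟩ then
    (t - 1) * P O + t * P (O.swap i h)
  else P (O.swap i h)

open Classical in
/-- The coefficients of `s^*_{(a; lam)}` over an arbitrary commutative ring, computed by the
recursion that defines `s^*`. -/
noncomputable def dualCoeff (t : Aˣ) (lam : YoungDiagram) (a : Fin m → ℕ) : MPartition m → A :=
  if H : ∃ i, IsAscent a i then fun O =>
    ((t⁻¹ : Aˣ) : A) * adjStep (t : A) (Nat.find H) (Nat.find_spec H).1
      (dualCoeff t lam (swapComp (Nat.find H) (Nat.find_spec H).1 a)) O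
  else fun O => dominantCoeff (t : A) ⟨a, lam⟩ O
termination_by ∑ j : Fin m, (j : ℕ) * a j
decreasing_by exact swapComp_weight_lt a _ _ (Nat.find_spec H).2

theorem dualCoeff_of_not_ascent (t : Aˣ) (lam : YoungDiagram) {a : Fin m → ℕ}
    (H : ¬ ∃ i, IsAscent a i) (O : MPartition m) :
    dualCoeff t lam a O = dominantCoeff (t : A) ⟨a, lam⟩ O := by
  rw [dualCoeff, dif_neg H]

open Classical in
theorem dualCoeff_of_ascent (t : Aˣ) (lam : YoungDiagram) {a : Fin m → ℕ}
    (H : ∃ i, IsAscent a i) (O : MPartition m) :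
    dualCoeff t lam a O = ((t⁻¹ : Aˣ) : A) * adjStep (t : A) (Nat.find H) (Nat.find_spec H).1
      (dualCoeff t lam (swapComp (Nat.find H) (Nat.find_spec H).1 a)) O := by
  rw [dualCoeff, dif_pos H]

theorem exists_dualCoeff_eq (t : Aˣ) (lam : YoungDiagram) {a : Fin m → ℕ}
    (H : ∃ i, IsAscent a i) :
    ∃ i, ∃ h : i + 1 < m, a ⟨i, Nat.lt_of_succ_lt h⟩ < a ⟨i + 1, h⟩ ∧ ∀ O, dualCoeff t lam a O
      = ((t⁻¹ : Aˣ) : A) * adjStep (t : A) i h (dualCoeff t lam (swapComp i h a)) O := by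
  classical
  exact ⟨Nat.find H, (Nat.find_spec H).1, (Nat.find_spec H).2, dualCoeff_of_ascent t lam H⟩

theorem map_dualCoeff {B : Type*} [CommRing B] (f : A →+* B) (t : Aˣ) (lam : YoungDiagram)
    (a : Fin m → ℕ) (O : MPartition m) :
    f (dualCoeff t lam a O) = dualCoeff (Units.map (f : A →* B) t) lam a O := by
  classical
  induction hw : ∑ j : Fin m, (j : ℕ) * a j using Nat.strong_induction_on generalizing a O with
  | _ w ih =>
    by_cases H : ∃ i, IsAscent a i
    · rw [dualCoeff_of_ascent t lam H, dualCoeff_of_ascent _ lam H, map_mul]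
      have h1 := fun O => ih _ (hw ▸ swapComp_weight_lt a _ (Nat.find_spec H).1
        (Nat.find_spec H).2) (swapComp (Nat.find H) (Nat.find_spec H).1 a) O rfl
      congr 1
      rw [adjStep, adjStep, ← h1, ← h1]
      split_ifs <;> simp
    · rw [dualCoeff_of_not_ascent t lam H, dualCoeff_of_not_ascent _ lam H]
      simp [dominantCoeff, map_sum]

theorem dominantCoeff_eq_zero_or (t : A) (L O : MPartition m) :
    dominantCoeff t L O = 0 ∨ ∃ T, T ∈ skewTableaux L O := by
  rcases (skewTableaux L O).eq_empty_or_nonempty with h | h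
  · left
    rw [dominantCoeff, h, Finset.sum_empty]
  · exact Or.inr h

theorem swap_comp_left (i : ℕ) (h : i + 1 < m) (L : MPartition m) :
    (L.swap i h).comp ⟨i, Nat.lt_of_succ_lt h⟩ = L.comp ⟨i + 1, h⟩ := swapComp_left i h L.comp

theorem swap_comp_right (i : ℕ) (h : i + 1 < m) (L : MPartition m) :
    (L.swap i h).comp ⟨i + 1, h⟩ = L.comp ⟨i, Nat.lt_of_succ_lt h⟩ := swapComp_right i h L.comp

theorem swap_ne {i : ℕ} {h : i + 1 < m} {L : MPartition m}
    (hL : L.comp ⟨i, Nat.lt_of_succ_lt h⟩ ≠ L.comp ⟨i + 1, h⟩) : L.swap i h ≠ L := by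
  intro hc
  apply hL
  have h1 := congrFun (congrArg MPartition.comp hc) ⟨i, Nat.lt_of_succ_lt h⟩
  rw [swap_comp_left] at h1
  exact h1.symm

/-- The relation between the indices `O` and `L` when `k_O` occurs as a lower term in `s^*_L`. -/
def CompLT (O L : MPartition m) : Prop :=
  O.size = L.size ∧ ∑ i, O.comp i < ∑ i, L.comp i

theorem CompLT.trans {L₁ L₂ L₃ : MPartition m} (h : CompLT L₁ L₂) (h' : CompLT L₂ L₃) :
    CompLT L₁ L₃ := ⟨h.1.trans h'.1, h.2.trans h'.2⟩

theorem CompLT.irrefl (L : MPartition m) : ¬ CompLT L L := fun h => lt_irrefl _ h.2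

theorem sum_comp_swap (i : ℕ) (h : i + 1 < m) (L : MPartition m) :
    ∑ j, (L.swap i h).comp j = ∑ j, L.comp j := sum_swapComp i h L.comp id

theorem size_swap (i : ℕ) (h : i + 1 < m) (L : MPartition m) : (L.swap i h).size = L.size := by
  rw [MPartition.size, sum_comp_swap, MPartition.size]
  rfl

theorem CompLT.of_swap {i : ℕ} {h : i + 1 < m} {O L : MPartition m}
    (hOL : CompLT (O.swap i h) (L.swap i h)) : CompLT O L := by
  rw [CompLT, size_swap, size_swap, sum_comp_swap, sum_comp_swap] at hOL
  exact hOL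

theorem CompLT.of_swap_right {i : ℕ} {h : i + 1 < m} {O L : MPartition m}
    (hOL : CompLT O (L.swap i h)) : CompLT O L := by
  rw [CompLT, size_swap, sum_comp_swap] at hOL
  exact hOL

/-- The leading term of `s^*_L` is `k_L`: for `b_i > b_{i+1}` the operator `t⁻¹ T_i^*` sends `k_b` to
`k_{s_i b}`, and it does not change the sum of the entries. -/
theorem dualCoeff_triangular [Nontrivial A] (t : Aˣ) (lam : YoungDiagram) (a : Fin m → ℕ) :
    (∀ O, dualCoeff t lam a O ≠ 0 → O = ⟨a, lam⟩ ∨ CompLT O ⟨a, lam⟩) ∧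
      ∃ n : ℕ, dualCoeff t lam a ⟨a, lam⟩ = (t : A) ^ n := by
  classical
  induction hw : ∑ j : Fin m, (j : ℕ) * a j using Nat.strong_induction_on generalizing a with
  | _ w ih =>
    by_cases H : ∃ i, IsAscent a i
    · obtain ⟨i, h, ha, hrec⟩ := exists_dualCoeff_eq t lam H
      obtain ⟨hoff, n, hdiag⟩ := ih _ (hw ▸ swapComp_weight_lt a i h ha) (swapComp i h a) rfl
      set P := dualCoeff t lam (swapComp i h a)
      have hswap : (⟨swapComp i h a, lam⟩ : MPartition m) = MPartition.swap i h ⟨a, lam⟩ := rfl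
      rw [hswap] at hdiag hoff
      have hne : MPartition.swap i h ⟨a, lam⟩ ≠ ⟨a, lam⟩ := swap_ne ha.ne
      have hzero : P ⟨a, lam⟩ = 0 := by
        by_contra hc
        rcases hoff _ hc with h1 | h1
        · exact hne h1.symm
        · exact CompLT.irrefl _ h1.of_swap_right
      -- In each case the coefficient at `O` comes from those at `O` and `s_i O`.
      have hP1 : ∀ O, P O ≠ 0 → O = MPartition.swap i h ⟨a, lam⟩ ∨ CompLT O ⟨a, lam⟩ :=
        fun O hO => (hoff O hO).imp id fun h1 => h1.of_swap_right
      have hP2 : ∀ O : MPartition m, P (O.swap i h) ≠ 0 → O = ⟨a, lam⟩ ∨ CompLT O ⟨a, lam⟩ := by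
        intro O hO
        rcases hoff _ hO with h1 | h1
        · left
          rw [← swap_swap i h O, h1, swap_swap]
        · exact Or.inr h1.of_swap
      constructor
      · intro O hO
        rw [hrec] at hO
        have hO' := right_ne_zero_of_mul hO
        rw [adjStep] at hO'
        split_ifs at hO' with h1 h2
        · rcases hP1 O (right_ne_zero_of_mul hO') with h3 | h3
          · exfalso
            rw [h3, swap_comp_left, swap_comp_right] at h1
            exact ha.ne' h1
          · exact Or.inr h3
        · by_cases h4 : P O = 0
          · rw [h4, mul_zero, zero_add] at hO'
            exact hP2 O (right_ne_zero_of_mul hO')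
          · rcases hP1 O h4 with h3 | h3
            · exfalso
              rw [h3, swap_comp_left, swap_comp_right] at h2
              exact lt_asymm ha h2
            · exact Or.inr h3
        · exact hP2 O hO'
      · refine ⟨n, ?_⟩
        rw [hrec, adjStep, if_neg ha.ne, if_pos ha, hzero, hdiag, mul_zero, zero_add, ← mul_assoc,
          Units.inv_mul, one_mul]
    · constructor
      · intro O hO
        rw [dualCoeff_of_not_ascent t lam H] at hO
        obtain ⟨T, hT⟩ := (dominantCoeff_eq_zero_or _ _ _).resolve_left hO
        exact (eq_or_sum_lt_of_mem_skewTableaux hT).imp id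
          fun h => ⟨size_eq_of_mem_skewTableaux hT, h⟩
      · obtain ⟨T, hT⟩ := Finset.card_eq_one.1
          (card_skewTableaux_self ⟨a, lam⟩ (antitone_of_not_ascent H))
        refine ⟨tableauCharge ⟨a, lam⟩ ⟨a, lam⟩ T, ?_⟩
        rw [dualCoeff_of_not_ascent t lam H, dominantCoeff, hT, Finset.sum_singleton]

theorem adjStep_one (i : ℕ) (h : i + 1 < m) (P : MPartition m → A) (O : MPartition m) :
    adjStep 1 i h P O = P (O.swap i h) := by
  rw [adjStep]
  split_ifs with h1 h2
  · by_cases h3 : O.swap i h = O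
    · rw [h3, one_mul]
    · exfalso
      refine h3 (MPartition.ext (funext fun j => ?_) rfl)
      simp only [MPartition.swap]
      by_cases hj : j = ⟨i, Nat.lt_of_succ_lt h⟩
      · rw [hj, swapComp_left, h1]
      · by_cases hj' : j = ⟨i + 1, h⟩
        · rw [hj', swapComp_right, h1]
        · rw [swapComp, Equiv.swap_apply_of_ne_of_ne hj hj']
  · ring
  · rfl

/-- At `t = 1` the recursion permutes the entries of both indices simultaneously, so that the
support is that of the dominant case. -/
theorem strongLE_of_dualCoeff_one_ne_zero (lam : YoungDiagram) (a : Fin m → ℕ) (O : MPartition m)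
    (hO : dualCoeff (1 : Aˣ) lam a O ≠ 0) : StrongLE O ⟨a, lam⟩ := by
  classical
  induction hw : ∑ j : Fin m, (j : ℕ) * a j using Nat.strong_induction_on generalizing a O with
  | _ w ih =>
    by_cases H : ∃ i, IsAscent a i
    · obtain ⟨i, h, ha, hrec⟩ := exists_dualCoeff_eq (1 : Aˣ) lam H
      rw [hrec, Units.val_one, adjStep_one] at hO
      have h1 := ih _ (hw ▸ swapComp_weight_lt a i h ha) _ _ (right_ne_zero_of_mul hO) rfl
      have h2 := h1.swap i h
      have h3 : (⟨swapComp i h a, lam⟩ : MPartition m) = MPartition.swap i h ⟨a, lam⟩ := rfl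
      rwa [swap_swap, h3, swap_swap] at h2
    · rw [dualCoeff_of_not_ascent 1 lam H] at hO
      obtain ⟨T, hT⟩ := (dominantCoeff_eq_zero_or _ _ _).resolve_left hO
      exact strongLE_of_mem_skewTableaux hT

end Coefficients

/-! ### The scalar product and the expansion of the dual Schur functions -/

section Scalar

variable {F : Type u} [Field F] {m : ℕ}

/-- The basis `k_L(x;t)`. -/
noncomputable def kBasis (t : Fˣ) : Module.Basis (MPartition m) F (R F m) :=
  (exists_basis_k t).choose

theorem kBasis_apply (t : Fˣ) (L : MPartition m) : kBasis t L = k t L :=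
  (exists_basis_k t).choose_spec L

theorem kCoeff_eq (t : Fˣ) (f : R F m) : kCoeff t f = (kBasis t).repr f := by
  rw [kCoeff, dif_pos (exists_basis_k t), kBasis]

theorem isDual_scalar (t : Fˣ) : IsDual (scalar t) (k t) (k t : MPartition m → R F m) := by
  classical
  have H : ∃ B : LinearMap.BilinForm F (R F m), IsDual B (k t) (k t) := by
    refine ⟨(kBasis t).constr F fun L => (Finsupp.lapply L) ∘ₗ (kBasis t).repr.toLinearMap, ?_⟩
    intro L O
    rw [← kBasis_apply, ← kBasis_apply, Module.Basis.constr_basis]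
    simp [Finsupp.single_apply, eq_comm]
  rw [scalar, dif_pos H]
  exact H.choose_spec

theorem scalar_k_left (t : Fˣ) (L : MPartition m) (g : R F m) :
    scalar t (k t L) g = (kBasis t).repr g L := by
  classical
  have h : scalar t (k t L) = (Finsupp.lapply L) ∘ₗ (kBasis t).repr.toLinearMap := by
    refine (kBasis t).ext fun O => ?_
    rw [kBasis_apply, isDual_scalar, ← kBasis_apply]
    simp [Finsupp.single_apply, eq_comm]
  rw [h]
  rfl

theorem scalar_k_right (t : Fˣ) (L : MPartition m) (f : R F m) :
    scalar t f (k t L) = (kBasis t).repr f L := by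
  classical
  have h : (scalar t).flip (k t L) = (Finsupp.lapply L) ∘ₗ (kBasis t).repr.toLinearMap := by
    refine (kBasis t).ext fun O => ?_
    rw [kBasis_apply, LinearMap.BilinForm.flip_apply, isDual_scalar, ← kBasis_apply]
    simp [Finsupp.single_apply]
  have h1 := congrArg (fun φ => φ f) h
  simpa using h1

theorem scalar_hecke_k (t : Fˣ) (i : ℕ) (h : i + 1 < m) (O : MPartition m) (g : R F m) :
    scalar t (hecke t i h (k t O)) g = adjStep (t : F) i h ((kBasis t).repr g) O := by
  rw [adjStep]
  split_ifs with h1 h2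
  · rw [hecke_k_of_eq t i h h1, map_smul, LinearMap.smul_apply, scalar_k_left, smul_eq_mul]
  · rw [hecke_k_of_lt t i h h2, map_add, map_smul, map_smul, LinearMap.add_apply,
      LinearMap.smul_apply, LinearMap.smul_apply, scalar_k_left, scalar_k_left, smul_eq_mul,
      smul_eq_mul]
  · rw [hecke_k_of_gt t i h (lt_of_le_of_ne (not_lt.1 h2) (Ne.symm h1)), scalar_k_left]

theorem finite_support_adjStep (t : F) (i : ℕ) (h : i + 1 < m) (P : MPartition m →₀ F) :
    (Function.support (adjStep t i h P)).Finite := by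
  refine (P.hasFiniteSupport.union (P.hasFiniteSupport.image (MPartition.swap i h))).subset ?_
  intro O hO
  by_contra hc
  rw [Set.mem_union, not_or] at hc
  have h1 : P O = 0 := by simpa using hc.1
  have h2 : P (O.swap i h) = 0 := by
    by_contra h2
    exact hc.2 ⟨O.swap i h, h2, swap_swap i h O⟩
  apply hO
  rw [adjStep, h1, h2]
  simp

theorem scalar_hecke_left (t : Fˣ) (i : ℕ) (h : i + 1 < m) (f g : R F m) :
    scalar t (hecke t i h f) g = scalar t f (heckeAdj t i h g) := by
  have H : ∃ S : R F m → R F m, ∀ f g, scalar t (hecke t i h f) g = scalar t f (S g) := by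
    refine ⟨fun g => (kBasis t).repr.symm
      (Finsupp.ofSupportFinite _ (finite_support_adjStep (t : F) i h ((kBasis t).repr g))), ?_⟩
    intro f g
    set g' := (kBasis t).repr.symm
      (Finsupp.ofSupportFinite _ (finite_support_adjStep (t : F) i h ((kBasis t).repr g)))
    have h1 : (scalar t).flip g ∘ₗ heckeLin t i h = (scalar t).flip g' := by
      refine (kBasis t).ext fun O => ?_
      rw [LinearMap.comp_apply, LinearMap.BilinForm.flip_apply, LinearMap.BilinForm.flip_apply, kBasis_apply,
        heckeLin_apply, scalar_hecke_k, scalar_k_left, LinearEquiv.apply_symm_apply]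
      rfl
    exact congrArg (fun φ => φ f) h1
  rw [heckeAdj, dif_pos H]
  exact H.choose_spec f g

theorem repr_heckeAdj (t : Fˣ) (i : ℕ) (h : i + 1 < m) (g : R F m) (O : MPartition m) :
    (kBasis t).repr (heckeAdj t i h g) O = adjStep (t : F) i h ((kBasis t).repr g) O := by
  rw [← scalar_k_left, ← scalar_hecke_left, scalar_hecke_k]

theorem finite_support_dominantCoeff (t : F) (L : MPartition m) :
    (Function.support (dominantCoeff t L)).Finite := by
  refine (finite_size_le m L.size).subset fun O hO => ?_
  obtain ⟨T, hT⟩ := (dominantCoeff_eq_zero_or t L O).resolve_left hO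
  exact (size_eq_of_mem_skewTableaux hT).le

theorem repr_dualSchurAux (t : Fˣ) (lam : YoungDiagram) (a : Fin m → ℕ) (O : MPartition m) :
    (kBasis t).repr (dualSchurAux t lam a) O = dualCoeff t lam a O := by
  classical
  induction hw : ∑ j : Fin m, (j : ℕ) * a j using Nat.strong_induction_on generalizing a O with
  | _ w ih =>
    by_cases H : ∃ i, IsAscent a i
    · have h1 : ⇑((kBasis t).repr (dualSchurAux t lam
          (swapComp (Nat.find H) (Nat.find_spec H).1 a))) = dualCoeff t lam _ :=
        funext fun O => ih _ (hw ▸ swapComp_weight_lt a _ (Nat.find_spec H).1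
          (Nat.find_spec H).2) _ O rfl
      rw [dualCoeff_of_ascent t lam H, dualSchurAux, dif_pos H, map_smul, Finsupp.smul_apply,
        repr_heckeAdj, h1, smul_eq_mul]
    · have hfin := finite_support_dominantCoeff (t : F) (⟨a, lam⟩ : MPartition m)
      rw [dualCoeff_of_not_ascent t lam H, dualSchurAux, dif_neg H]
      have h1 : ∑ᶠ O : MPartition m, dominantCoeff (t : F) ⟨a, lam⟩ O • k t O
          = (kBasis t).repr.symm (Finsupp.ofSupportFinite _ hfin) := by
        rw [Module.Basis.repr_symm_apply, Finsupp.linearCombination_apply, Finsupp.sum,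
          finsum_eq_sum_of_support_subset (s := (Finsupp.ofSupportFinite _ hfin).support)]
        · exact Finset.sum_congr rfl fun O _ => by rw [kBasis_apply]; rfl
        · intro O hO
          rw [Finset.mem_coe, Finsupp.mem_support_iff]
          exact left_ne_zero_of_smul hO
      rw [h1, LinearEquiv.apply_symm_apply]
      rfl

theorem D_eq_dualCoeff (t : Fˣ) (L O : MPartition m) : D t L O = dualCoeff t L.part L.comp O := by
  rw [D, kCoeff_eq, dualSchur, repr_dualSchurAux]

theorem D_eq_repr (t : Fˣ) (L O : MPartition m) : D t L O = (kBasis t).repr (dualSchur t L) O := by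
  rw [D, kCoeff_eq]

theorem wellFounded_compLT : WellFounded (CompLT (m := m)) :=
  wellFounded_of_finite (fun _ _ _ h h' => h.trans h') CompLT.irrefl
    fun L => (finite_size_le m L.size).subset fun _ hO => hO.1.le

/-- The dual Schur functions form a basis for every invertible `t`, and so does the family that is
dual to them with respect to the scalar product. -/
theorem exists_basis_dualSchur (t : Fˣ) :
    (∃ b : Module.Basis (MPartition m) F (R F m), ∀ L, b L = dualSchur t L) ∧
      ∃ s : Module.Basis (MPartition m) F (R F m), IsDual (scalar t) s (dualSchur t) ∧
        ∀ w : MPartition m → R F m, IsDual (scalar t) w (dualSchur t) → w = s := by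
  classical
  have hoff : ∀ L O : MPartition m, (kBasis t).repr (dualSchur t L) O ≠ 0 → O = L ∨ CompLT O L := by
    intro L O h
    rw [← D_eq_repr, D_eq_dualCoeff] at h
    exact (dualCoeff_triangular t L.part L.comp).1 O h
  have hdiag : ∀ L : MPartition m, (kBasis t).repr (dualSchur t L) L ≠ 0 := by
    intro L
    obtain ⟨n, hn⟩ := (dualCoeff_triangular t L.part L.comp).2
    rw [← D_eq_repr, D_eq_dualCoeff]
    exact hn ▸ pow_ne_zero n t.ne_zero
  obtain ⟨b, hb, hboff, hbdiag⟩ := exists_basis_of_triangular wellFounded_compLT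
    (fun _ _ _ h h' => h.trans h') (kBasis t) (dualSchur t) hoff hdiag
  refine ⟨⟨b, hb⟩, ?_⟩
  -- The dual family has the transposed inverse matrix, whose columns are finite by homogeneity.
  have hfin : ∀ L : MPartition m, (Function.support fun O => b.repr (kBasis t O) L).Finite := by
    intro L
    refine (finite_size_le m L.size).subset fun O hO => ?_
    rcases hboff O L hO with rfl | h
    · exact le_rfl (a := L.size)
    · exact h.1.ge
  let v : MPartition m → R F m := fun L =>
    (kBasis t).repr.symm (Finsupp.ofSupportFinite _ (hfin L))
  have hv : ∀ L O, (kBasis t).repr (v L) O = b.repr (kBasis t O) L := by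
    intro L O
    rw [LinearEquiv.apply_symm_apply]
    rfl
  have hwf : WellFounded fun O L : MPartition m => CompLT L O :=
    wellFounded_of_finite (fun _ _ _ h h' => h'.trans h) CompLT.irrefl
      fun L => (finite_size_le m L.size).subset fun _ hO => hO.1.ge
  obtain ⟨s, hs, -⟩ := exists_basis_of_triangular hwf (fun _ _ _ h h' => h'.trans h) (kBasis t) v
    (fun L O h => by
      rw [hv] at h
      exact (hboff O L h).imp Eq.symm id)
    (fun L => by
      rw [hv]
      exact hbdiag L)
  have hscalar : ∀ L g, scalar t (v L) g = b.repr g L := by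
    intro L g
    have h1 : scalar t (v L) = (Finsupp.lapply L) ∘ₗ b.repr.toLinearMap := by
      refine (kBasis t).ext fun O => ?_
      rw [kBasis_apply, scalar_k_right, hv, ← kBasis_apply]
      rfl
    rw [h1]
    rfl
  have hdual : IsDual (scalar t) s (dualSchur t) := by
    intro L O
    rw [hs, hscalar, ← hb, b.repr_self, Finsupp.single_apply]
    exact if_congr eq_comm rfl rfl
  refine ⟨s, hdual, fun w hw => funext fun L => ?_⟩
  have h1 : scalar t (w L) = scalar t (s L) := b.ext fun O => by rw [hb, hw L O, hdual L O]
  refine (kBasis t).repr.injective (Finsupp.ext fun O => ?_)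
  rw [← scalar_k_right, ← scalar_k_right, h1]

end Scalar

/-! ### Laurent polynomials and the specialization `t = 1` -/

section Specialization

variable {m : ℕ}

/-- The indeterminate of the ring of Laurent polynomials, as a unit. -/
noncomputable def laurentT : (LaurentPolynomial ℤ)ˣ where
  val := LaurentPolynomial.T 1
  inv := LaurentPolynomial.T (-1)
  val_inv := by rw [← LaurentPolynomial.T_add, add_neg_cancel, LaurentPolynomial.T_zero]
  inv_val := by rw [← LaurentPolynomial.T_add, neg_add_cancel, LaurentPolynomial.T_zero]

theorem D_eq_eval {F : Type u} [Field F] (t : Fˣ) (L O : MPartition m) :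
    D t L O = LaurentPolynomial.eval₂ (Int.castRingHom F) t
      (dualCoeff laurentT L.part L.comp O) := by
  rw [D_eq_dualCoeff, map_dualCoeff]
  congr 1
  refine Units.ext ?_
  rw [Units.coe_map]
  change (t : F) = LaurentPolynomial.eval₂ (Int.castRingHom F) t (LaurentPolynomial.T 1)
  rw [LaurentPolynomial.eval₂_T, zpow_one]

variable {F : Type u} [Field F]

theorem D_one_self (L : MPartition m) : D (1 : Fˣ) L L = 1 := by
  obtain ⟨n, hn⟩ := (dualCoeff_triangular (1 : Fˣ) L.part L.comp).2
  rw [D_eq_dualCoeff]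
  exact hn.trans (by simp)

theorem D_one_eq_zero {L O : MPartition m} (h : ¬ O ≤ L) : D (1 : Fˣ) L O = 0 := by
  by_contra hc
  rw [D_eq_dualCoeff] at hc
  exact h (strongLE_of_dualCoeff_one_ne_zero L.part L.comp O hc).le

theorem finite_support_D (t : Fˣ) (L : MPartition m) :
    (Function.support fun O => D t L O).Finite := by
  simp only [D_eq_repr]
  exact ((kBasis t).repr (dualSchur t L)).hasFiniteSupport

theorem dualSchur_one_eq (L : MPartition m) :
    dualSchur (1 : Fˣ) L = kOne F L +
      ∑ᶠ (O : MPartition m) (_ : O ≤ L ∧ O ≠ L), D (1 : Fˣ) L O • kOne F O := by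
  classical
  have hfin := finite_support_D (1 : Fˣ) L
  have hsum : dualSchur (1 : Fˣ) L = ∑ O ∈ hfin.toFinset, D (1 : Fˣ) L O • kOne F O := by
    have h1 := (kBasis (1 : Fˣ)).linearCombination_repr (dualSchur 1 L)
    rw [Finsupp.linearCombination_apply, Finsupp.sum] at h1
    refine h1.symm.trans (Finset.sum_congr ?_ fun O _ => ?_)
    · ext O
      simp [D_eq_repr]
    · rw [D_eq_repr, kBasis_apply, k_one]
  have hL : L ∈ hfin.toFinset := by
    rw [Set.Finite.mem_toFinset, Function.mem_support, D_one_self]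
    exact one_ne_zero
  rw [hsum, ← Finset.add_sum_erase _ _ hL, D_one_self, one_smul]
  congr 1
  refine (finsum_cond_eq_sum_of_cond_iff _ fun {O} hO => ?_).symm
  have hD : D (1 : Fˣ) L O ≠ 0 := left_ne_zero_of_smul hO
  rw [Finset.mem_erase, Set.Finite.mem_toFinset, Function.mem_support]
  refine ⟨fun h => ⟨h.2, hD⟩, fun h => ⟨?_, h.1⟩⟩
  by_contra hc
  exact hD (D_one_eq_zero hc)

end Specialization

end MSym

theorem mainTheorem5 (m : ℕ) :
    -- The coefficients `D_{L O}(t)` are integral Laurent polynomials in `t`, independent of the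
    -- field and of the value of `t`, so that `D_{L O}(1)` is their value at `t = 1`.
    (∃ P : MSym.MPartition m → MSym.MPartition m → LaurentPolynomial ℤ,
      ∀ (F : Type u) [Field F] (t : Fˣ) (L O : MSym.MPartition m),
        MSym.D t L O = LaurentPolynomial.eval₂ (Int.castRingHom F) t (P L O)) ∧
    -- At `t = 1`: unitriangularity, and the basis property.
    (∀ (F : Type u) [Field F],
      (∀ L : MSym.MPartition m, MSym.D (1 : Fˣ) L L = 1) ∧
      (∀ L O : MSym.MPartition m, ¬ O ≤ L → MSym.D (1 : Fˣ) L O = 0) ∧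
      (∀ L : MSym.MPartition m,
        (Function.support fun O => MSym.D (1 : Fˣ) L O).Finite ∧
        MSym.dualSchur (1 : Fˣ) L = MSym.kOne F L +
          ∑ᶠ (O : MSym.MPartition m) (_ : O ≤ L ∧ O ≠ L), MSym.D (1 : Fˣ) L O • MSym.kOne F O) ∧
      ∃ b : Module.Basis (MSym.MPartition m) F (MSym.R F m),
        ∀ L, b L = MSym.dualSchur (1 : Fˣ) L) ∧
    -- For generic `t`: the basis property, and the dual basis.
    (∀ (F : Type u) [Field F] [CharZero F] (t : Fˣ), Transcendental ℚ (t : F) →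
      (∃ b : Module.Basis (MSym.MPartition m) F (MSym.R F m),
        ∀ L, b L = MSym.dualSchur t L) ∧
      ∃ s : Module.Basis (MSym.MPartition m) F (MSym.R F m),
        MSym.IsDual (MSym.scalar t) s (MSym.dualSchur t) ∧
        ∀ w : MSym.MPartition m → MSym.R F m,
          MSym.IsDual (MSym.scalar t) w (MSym.dualSchur t) → w = s) := by
  refine ⟨⟨fun L O => MSym.dualCoeff MSym.laurentT L.part L.comp O,
    fun F _ t L O => MSym.D_eq_eval t L O⟩, fun F _ => ⟨MSym.D_one_self,
      fun L O h => MSym.D_one_eq_zero h, fun L => ⟨MSym.finite_support_D 1 L,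
        MSym.dualSchur_one_eq L⟩, (MSym.exists_basis_dualSchur (1 : Fˣ)).1⟩,
    fun F _ _ t _ => MSym.exists_basis_dualSchur t⟩
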